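/- Let $a,b,\alpha>0$ and $\xi\in(0,1)$ be real numbers with $\alpha b<6$ and $\xi\notin\mathbb Q$. On the complex energy space $\mathcal H=[H^2(0,1)\cap H^1_0(0,1)]\times L^2(0,1)$ consider the unbounded operator $$\mathcal A(u,v)=\bigl(v,\,-a\,u_{xxxx}-b\,v-\alpha\,v(\xi)\,\delta_\xi\bigr)$$ (derivatives in the sense of distributions on $(0,1)$), whose domain $D(\mathcal A)$ consists of all $(u,v)$ with $u\in H^4(0,\xi)\cap H^4(\xi,1)\cap H^2(0,1)$, $v\in H^2(0,1)$, $u(0)=u(1)=v(0)=v(1)=0$, $u_{xx}(0)=u_{xx}(1)=0$, $u_{xx}(\xi^-)=u_{xx}(\xi^+)$ and $u_{xxx}(\xi^+)-u_{xxx}(\xi^-)=-\frac{\alpha}{a}v(\xi)$. To a complex number $\mu$ associate the complex numbers $\lambda$ with $\lambda^4=-\frac{b\mu+\mu^2}{a}$. The solutions of the asymptotic characteristic equation $$\sinh(z)\sin(z)=0 \tag{1}$$ are exactly the numbers $z=n\pi$ and $z=in\pi$, $n\in\mathbb Z$. Moreover there are constants $C,\rho,R>0$ (depending on $a,b,\alpha,\xi$)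 such that: 1. An eigenvalue $\mu$ of $\mathcal A$ is large, in the sense that $|\mu|>R$, if and only if each of the corresponding $\lambda$'s is close to a large root of (1), in the sense that there is a root $z$ of (1) with $|z|\ge\rho$ and $|\lambda-z|\le C/|z|$. 2. Conversely, for every root $z$ of (1) with $|z|\ge\rho$ there are exactly one pair $(\mu,\lambda)$ with $\operatorname{Im}\mu>0$ and exactly one pair $(\mu,\lambda)$ with $\operatorname{Im}\mu<0$ such that $\mu$ is an eigenvalue of $\mathcal A$, $\lambda^4=-\frac{b\mu+\mu^2}{a}$ and $|\lambda-z|\le C/|z|$. 3. Every eigenvalue $\mu$ of $\mathcal A$ with $|\mu|>R$ has geometric multiplicity $\dim\ker(\mathcal A-\mu)=1$ and algebraic multiplicity $\dim\bigcup_{k}\ker(\mathcal A-\mu)^k=1$. -/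

import Mathlib

open MeasureTheory Set
open scoped ContDiff

/-- `g` is a weak derivative of order `k` of `f` on the open interval `(c, d)`. -/
def HasWeakDeriv (k : ℕ) (c d : ℝ) (f g : ℝ → ℂ) : Prop :=
  ∀ φ : ℝ → ℝ, ContDiff ℝ ∞ φ → HasCompactSupport φ → tsupport φ ⊆ Ioo c d →
    ∫ x in Ioo c d, iteratedDeriv k φ x • f x = (-1 : ℂ) ^ k * ∫ x in Ioo c d, φ x • g x

/-- The Sobolev space `H^m(c, d)` of complex-valued functions: `f` and its weak derivatives of order
at most `m` are square integrable on `(c, d)`. -/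
def MemSobolev (m : ℕ) (c d : ℝ) (f : ℝ → ℂ) : Prop :=
  MemLp f 2 (volume.restrict (Ioo c d)) ∧
    ∀ k ≤ m, ∃ g : ℝ → ℂ, MemLp g 2 (volume.restrict (Ioo c d)) ∧ HasWeakDeriv k c d f g

/-- `g` is the representative of the `k`-th weak derivative of `f` on `(c, d)` that is continuous on
the closed interval `[c, d]`. For `c < d` its values on `[c, d]`, the (one-sided) boundary values
included, are determined by `f`. For `k = 0` it is the continuous representative of `f` itself. -/
def IsContinuousRep (k : ℕ) (c d : ℝ) (f g : ℝ → ℂ) : Prop :=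
  ContinuousOn g (Icc c d) ∧ HasWeakDeriv k c d f g

/-- The complex Lebesgue space `L²(0, 1)`. -/
abbrev L2 : Type := Lp ℂ 2 (volume.restrict (Ioo (0 : ℝ) 1))

theorem tsupport_iteratedDeriv_subset' (φ : ℝ → ℝ) (k : ℕ) :
    tsupport (iteratedDeriv k φ) ⊆ tsupport φ := by
  induction k with
  | zero => simp
  | succ k ih =>
    rw [iteratedDeriv_succ]
    exact tsupport_deriv_subset.trans ih

theorem integrable_smooth_smul {c d : ℝ} {f : ℝ → ℂ} (hf : IntegrableOn f (Ioo c d))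
    {φ : ℝ → ℝ} (hφ : Continuous φ) :
    IntegrableOn (fun x => φ x • f x) (Ioo c d) := by
  obtain ⟨C, hC⟩ := (isCompact_Icc (a := c) (b := d)).exists_bound_of_continuousOn hφ.continuousOn
  refine Integrable.bdd_smul (C := C) hf hφ.aestronglyMeasurable ?_
  filter_upwards [ae_restrict_mem measurableSet_Ioo] with x hx using hC x (Ioo_subset_Icc_self hx)

theorem continuous_iteratedDeriv_of_smooth {φ : ℝ → ℝ} (hφ : ContDiff ℝ ∞ φ) (k : ℕ) :
    Continuous (iteratedDeriv k φ) :=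
  hφ.continuous_iteratedDeriv k (by exact_mod_cast le_top)

namespace HasWeakDeriv
variable {k : ℕ} {c d : ℝ} {f f' g g' : ℝ → ℂ}

theorem congr_ae (h : HasWeakDeriv k c d f g) (hf : f =ᵐ[volume.restrict (Ioo c d)] f')
    (hg : g =ᵐ[volume.restrict (Ioo c d)] g') : HasWeakDeriv k c d f' g' := by
  intro φ h1 h2 h3
  have e1 : ∫ x in Ioo c d, iteratedDeriv k φ x • f' x
      = ∫ x in Ioo c d, iteratedDeriv k φ x • f x :=
    integral_congr_ae (by filter_upwards [hf] with x hx; rw [hx])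
  have e2 : ∫ x in Ioo c d, φ x • g' x = ∫ x in Ioo c d, φ x • g x :=
    integral_congr_ae (by filter_upwards [hg] with x hx; rw [hx])
  rw [e1, e2]; exact h φ h1 h2 h3

theorem add (h : HasWeakDeriv k c d f g) (h' : HasWeakDeriv k c d f' g')
    (hf : IntegrableOn f (Ioo c d)) (hf' : IntegrableOn f' (Ioo c d))
    (hg : IntegrableOn g (Ioo c d)) (hg' : IntegrableOn g' (Ioo c d)) :
    HasWeakDeriv k c d (f + f') (g + g') := by
  intro φ h1 h2 h3
  have hk := continuous_iteratedDeriv_of_smooth h1 k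
  simp only [Pi.add_apply, smul_add]
  rw [integral_add (integrable_smooth_smul hf hk) (integrable_smooth_smul hf' hk),
    integral_add (integrable_smooth_smul hg h1.continuous)
      (integrable_smooth_smul hg' h1.continuous), h φ h1 h2 h3, h' φ h1 h2 h3, mul_add]

theorem const_smul (h : HasWeakDeriv k c d f g) (z : ℂ) :
    HasWeakDeriv k c d (z • f) (z • g) := by
  intro φ h1 h2 h3
  simp only [Pi.smul_apply, smul_comm _ z]
  rw [integral_smul, integral_smul, h φ h1 h2 h3, smul_eq_mul, smul_eq_mul]; ring

theorem zero : HasWeakDeriv k c d 0 0 := by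
  intro φ _ _ _; simp

theorem mono (h : HasWeakDeriv k c d f g) {c' d' : ℝ} (hc : c ≤ c') (hd : d' ≤ d) :
    HasWeakDeriv k c' d' f g := by
  intro φ h1 h2 h3
  have hs : Ioo c' d' ⊆ Ioo c d := Ioo_subset_Ioo hc hd
  have key := h φ h1 h2 (h3.trans hs)
  have e (ψ : ℝ → ℝ) (hψ : tsupport ψ ⊆ tsupport φ) (F : ℝ → ℂ) :
      ∫ x in Ioo c d, ψ x • F x = ∫ x in Ioo c' d', ψ x • F x := by
    refine (setIntegral_eq_of_subset_of_forall_sdiff_eq_zero measurableSet_Ioo hs ?_)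
    intro x hx
    rw [image_eq_zero_of_notMem_tsupport (fun hx' => hx.2 (h3 (hψ hx'))), zero_smul]
  rwa [e _ (tsupport_iteratedDeriv_subset' φ k), e _ subset_rfl] at key

theorem ae_unique (h : HasWeakDeriv k c d f g) (h' : HasWeakDeriv k c d f g')
    (hg : IntegrableOn g (Ioo c d)) (hg' : IntegrableOn g' (Ioo c d)) :
    g =ᵐ[volume.restrict (Ioo c d)] g' := by
  have key := IsOpen.ae_eq_zero_of_integral_contDiff_smul_eq_zero (μ := volume) (f := g - g')
    (isOpen_Ioo (a := c) (b := d)) (hg.sub hg').locallyIntegrableOn ?_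
  · filter_upwards [(ae_restrict_iff' measurableSet_Ioo).2 key] with x hx
    exact sub_eq_zero.1 hx
  · intro φ h1 h2 h3
    have e := (h φ h1 h2 h3).symm.trans (h' φ h1 h2 h3)
    have e' := mul_left_cancel₀ (pow_ne_zero k (by norm_num)) e
    rw [← setIntegral_eq_integral_of_forall_compl_eq_zero (s := Ioo c d)]
    · simp only [Pi.sub_apply, smul_sub]
      rw [integral_sub (integrable_smooth_smul hg h1.continuous)
        (integrable_smooth_smul hg' h1.continuous), e', sub_self]
    · intro x hx
      rw [image_eq_zero_of_notMem_tsupport (fun hx' => hx (h3 hx')), zero_smul]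

/-- A function with vanishing weak derivative is constant. -/
theorem exists_const (h : HasWeakDeriv 1 c d f 0) (hcd : c < d) (hf : IntegrableOn f (Ioo c d)) :
    ∃ C : ℂ, f =ᵐ[volume.restrict (Ioo c d)] fun _ => C := by
  -- a bump function supported in the interval
  obtain ⟨θ, hθs, hθc, hθd, hθ1⟩ : ∃ θ : ℝ → ℝ, tsupport θ ⊆ Ioo c d ∧ HasCompactSupport θ ∧
      ContDiff ℝ ∞ θ ∧ ∫ x, θ x = 1 := by
    let b : ContDiffBump ((c + d) / 2) :=
      ⟨(d - c) / 8, (d - c) / 4, by linarith, by linarith⟩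
    refine ⟨b.normed volume, ?_, b.hasCompactSupport_normed, b.contDiff_normed,
      b.integral_normed⟩
    rw [b.tsupport_normed_eq, Real.closedBall_eq_Icc]
    intro x hx
    have : b.rOut = (d - c) / 4 := rfl
    rw [this] at hx
    exact ⟨by linarith [hx.1], by linarith [hx.2]⟩
  refine ⟨∫ x in Ioo c d, θ x • f x, ?_⟩
  refine ae_unique (k := 0) (f := f) (fun φ _ _ _ => by simp) ?_ hf (by simp)
  intro φ h1 h2 h3
  set m : ℝ := ∫ x, φ x with hm
  set ρ : ℝ → ℝ := fun x => φ x - m * θ x with hρ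
  have hρd : ContDiff ℝ ∞ ρ := h1.sub (contDiff_const.mul hθd)
  set ψ : ℝ → ℝ := fun x => ∫ t in c..x, ρ t with hψ
  have hψ' : deriv ψ = ρ := by
    ext x; exact hρd.continuous.deriv_integral _ _ _
  have hψd : ContDiff ℝ ∞ ψ := by
    rw [contDiff_infty_iff_deriv, hψ']
    exact ⟨fun x => (intervalIntegral.integral_hasDerivAt_right
      (hρd.continuous.intervalIntegrable _ _)
      (hρd.continuous.stronglyMeasurableAtFilter _ _) hρd.continuous.continuousAt).differentiableAt, hρd⟩
  have hρs : tsupport ρ ⊆ tsupport φ ∪ tsupport θ := by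
    refine closure_minimal ?_ ((isClosed_tsupport φ).union (isClosed_tsupport θ))
    intro x hx
    by_contra hx'
    rw [mem_union, not_or] at hx'
    exact hx (by simp [hρ, image_eq_zero_of_notMem_tsupport hx'.1,
      image_eq_zero_of_notMem_tsupport hx'.2])
  have hK : IsCompact (tsupport φ ∪ tsupport θ) := h2.isCompact.union hθc.isCompact
  have hKs : tsupport φ ∪ tsupport θ ⊆ Ioo c d := union_subset h3 hθs
  obtain ⟨c', d', hcc, hdd, hcd', hK'⟩ : ∃ c' d', c < c' ∧ d' < d ∧ c' ≤ d' ∧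
      tsupport φ ∪ tsupport θ ⊆ Icc c' d' := by
    rcases (tsupport φ ∪ tsupport θ).eq_empty_or_nonempty with h0 | h0
    · exact ⟨(c + d) / 2, (c + d) / 2, by linarith, by linarith, le_rfl, by simp [h0]⟩
    · obtain ⟨x, hx, hx'⟩ := hK.exists_isLeast h0
      obtain ⟨y, hy, hy'⟩ := hK.exists_isGreatest h0
      exact ⟨x, y, (hKs hx).1, (hKs hy).2, hx' hy, fun z hz => ⟨hx' hz, hy' hz⟩⟩
  have hρ0 : ∀ x, x ∉ Icc c' d' → ρ x = 0 := fun x hx =>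
    image_eq_zero_of_notMem_tsupport (fun h' => hx (hK' (hρs h')))
  have hθi : Integrable θ := hθd.continuous.integrable_of_hasCompactSupport hθc
  have hφi : Integrable φ := h1.continuous.integrable_of_hasCompactSupport h2
  have hρi : ∫ x, ρ x = 0 := by
    simp only [hρ]
    rw [integral_sub hφi (hθi.const_mul m), integral_const_mul, hθ1]; simp [hm]
  have hψs : ∀ x, x ∉ Icc c' d' → ψ x = 0 := by
    intro x hx
    rw [mem_Icc, not_and_or, not_le, not_le] at hx
    rcases hx with hx | hx
    · refine (intervalIntegral.integral_congr (g := fun _ => (0 : ℝ)) ?_).trans (by simp)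
      intro t ht
      refine hρ0 t (fun h' => ?_)
      have := ht.2
      rcases le_total c x with h | h <;> simp [h] at this <;> linarith [h'.1]
    · have hcx : c ≤ x := by linarith
      rw [hψ]; simp only
      rw [intervalIntegral.integral_of_le hcx, ← hρi]
      refine setIntegral_eq_integral_of_forall_compl_eq_zero ?_
      intro t ht
      refine hρ0 t (fun h' => ht ⟨by linarith [h'.1], by linarith [h'.2]⟩)
  have hψs' : tsupport ψ ⊆ Icc c' d' := by
    refine closure_minimal ?_ isClosed_Icc
    intro x hx
    by_contra hx'
    exact hx (hψs x hx')
  have key := h ψ hψd (HasCompactSupport.of_support_subset_isCompact isCompact_Icc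
    ((subset_tsupport ψ).trans hψs')) (hψs'.trans (fun x hx => ⟨by linarith [hx.1],
      by linarith [hx.2]⟩))
  rw [iteratedDeriv_one, hψ'] at key
  simp only [hρ, Pi.zero_apply, smul_zero, integral_zero, mul_zero, sub_smul, mul_smul] at key
  have hθf : Integrable (fun x => m • θ x • f x) (volume.restrict (Ioo c d)) :=
    (integrable_smooth_smul hf hθd.continuous).smul m
  rw [integral_sub (integrable_smooth_smul hf h1.continuous) hθf, integral_smul,
    sub_eq_zero] at key
  simp only [iteratedDeriv_zero, pow_zero, one_mul]
  rw [key, integral_smul_const]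
  congr 1
  rw [hm, setIntegral_eq_integral_of_forall_compl_eq_zero]
  intro x hx
  exact image_eq_zero_of_notMem_tsupport (fun h' => hx (h3 h'))

end HasWeakDeriv

theorem integral_primitive_real {c d : ℝ} {q φ : ℝ → ℝ}
    (hq : IntervalIntegrable q volume c d) (hφ : ContDiff ℝ ∞ φ) :
    ∫ x in c..d, deriv φ x * (∫ t in c..x, q t) =
      φ d * (∫ t in c..d, q t) - ∫ x in c..d, φ x * q x := by
  have h1 := hq.absolutelyContinuousOnInterval_intervalIntegral (c := c) (by simp)
  have h2 : AbsolutelyContinuousOnInterval φ c d :=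
    (hφ.of_le (by exact_mod_cast le_top)).contDiffOn.absolutelyContinuousOnInterval
  have h3 := h1.integral_mul_deriv_eq_deriv_mul h2
  have h4 : ∫ x in c..d, deriv (fun x => ∫ t in c..x, q t) x * φ x = ∫ x in c..d, φ x * q x := by
    refine intervalIntegral.integral_congr_ae ?_
    filter_upwards [hq.ae_hasDerivAt_integral] with x hx hx'
    rw [(hx (uIoc_subset_uIcc hx') c (by simp)).deriv, mul_comm]
  rw [h4] at h3
  simp only [intervalIntegral.integral_same, zero_mul, sub_zero] at h3
  rw [mul_comm (φ d), ← h3]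
  simp only [mul_comm]

theorem integral_primitive {c d : ℝ} {q : ℝ → ℂ} {φ : ℝ → ℝ}
    (hq : IntervalIntegrable q volume c d) (hφ : ContDiff ℝ ∞ φ) :
    ∫ x in c..d, deriv φ x • (∫ t in c..x, q t) =
      φ d • (∫ t in c..d, q t) - ∫ x in c..d, φ x • q x := by
  have hφ' : Continuous (deriv φ) := hφ.continuous_deriv (by exact_mod_cast le_top)
  have hre : IntervalIntegrable (fun x => (q x).re) volume c d := ⟨hq.1.re, hq.2.re⟩
  have him : IntervalIntegrable (fun x => (q x).im) volume c d := ⟨hq.1.im, hq.2.im⟩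
  have hF : ContinuousOn (fun x => ∫ t in c..x, q t) (uIcc c d) :=
    intervalIntegral.continuousOn_primitive_interval' hq (by simp)
  have i1 : IntervalIntegrable (fun x => deriv φ x • (∫ t in c..x, q t)) volume c d :=
    (hφ'.continuousOn.smul hF).intervalIntegrable
  have i2 : IntervalIntegrable (fun x => φ x • q x) volume c d :=
    hq.continuousOn_smul hφ.continuous.continuousOn
  have sub (x : ℝ) (hx : x ∈ uIcc c d) : IntervalIntegrable q volume c x :=
    hq.mono_set (uIcc_subset_uIcc_left hx)
  apply Complex.ext
  · have e := integral_primitive_real hre hφ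
    have a1 := Complex.reCLM.intervalIntegral_comp_comm i1
    have a2 := Complex.reCLM.intervalIntegral_comp_comm i2
    have a3 := Complex.reCLM.intervalIntegral_comp_comm hq
    simp only [Complex.reCLM_apply, Complex.smul_re] at a1 a2 a3
    rw [Complex.sub_re, ← a1, ← a2, Complex.smul_re, ← a3]
    refine Eq.trans ?_ e
    refine intervalIntegral.integral_congr (fun x hx => ?_)
    have a4 := Complex.reCLM.intervalIntegral_comp_comm (sub x hx)
    simp only [Complex.reCLM_apply] at a4
    simp only [a4, smul_eq_mul]
  · have e := integral_primitive_real him hφ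
    have a1 := Complex.imCLM.intervalIntegral_comp_comm i1
    have a2 := Complex.imCLM.intervalIntegral_comp_comm i2
    have a3 := Complex.imCLM.intervalIntegral_comp_comm hq
    simp only [Complex.imCLM_apply, Complex.smul_im] at a1 a2 a3
    rw [Complex.sub_im, ← a1, ← a2, Complex.smul_im, ← a3]
    refine Eq.trans ?_ e
    refine intervalIntegral.integral_congr (fun x hx => ?_)
    have a4 := Complex.imCLM.intervalIntegral_comp_comm (sub x hx)
    simp only [Complex.imCLM_apply] at a4
    simp only [a4, smul_eq_mul]

/-- Integration by parts up to the boundary. -/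
theorem IsContinuousRep.integral_deriv_smul {k : ℕ} {c d : ℝ} {f p q : ℝ → ℂ} (hcd : c < d)
    (hp : IsContinuousRep k c d f p) (hq : HasWeakDeriv (k + 1) c d f q)
    (hqi : IntegrableOn q (Ioo c d)) {φ : ℝ → ℝ} (hφ : ContDiff ℝ ∞ φ) :
    ∫ x in Ioo c d, deriv φ x • p x =
      φ d • p d - φ c • p c - ∫ x in Ioo c d, φ x • q x := by
  have hqI : IntervalIntegrable q volume c d := by
    rwa [intervalIntegrable_iff_integrableOn_Ioo_of_le hcd.le]
  set F : ℝ → ℂ := fun x => ∫ t in c..x, q t with hF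
  have hFc : ContinuousOn F (Icc c d) := by
    rw [← uIcc_of_le hcd.le]
    exact intervalIntegral.continuousOn_primitive_interval' hqI (by simp)
  have hpi : IntegrableOn p (Ioo c d) := (hp.1.integrableOn_Icc).mono_set Ioo_subset_Icc_self
  have hFi : IntegrableOn F (Ioo c d) := (hFc.integrableOn_Icc).mono_set Ioo_subset_Icc_self
  have smooth_deriv {ψ : ℝ → ℝ} (hψ : ContDiff ℝ ∞ ψ) : ContDiff ℝ ∞ (deriv ψ) :=
    (contDiff_infty_iff_deriv.1 hψ).2
  have prim {ψ : ℝ → ℝ} (hψ : ContDiff ℝ ∞ ψ) : ∫ x in Ioo c d, deriv ψ x • F x =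
      ψ d • F d - ∫ x in Ioo c d, ψ x • q x := by
    have := integral_primitive hqI hψ
    rwa [intervalIntegral.integral_of_le hcd.le, integral_Ioc_eq_integral_Ioo,
      intervalIntegral.integral_of_le (f := fun x => ψ x • q x) hcd.le,
      integral_Ioc_eq_integral_Ioo] at this
  have w1 : HasWeakDeriv 1 c d p q := by
    intro ψ h1 h2 h3
    have e1 := hp.2 (deriv ψ) (smooth_deriv h1) h2.deriv (tsupport_deriv_subset.trans h3)
    have e2 := hq ψ h1 h2 h3
    rw [iteratedDeriv_succ', e1, pow_succ, mul_assoc] at e2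
    rw [iteratedDeriv_one, pow_one]
    exact mul_left_cancel₀ (pow_ne_zero k (by norm_num)) e2
  have w2 : HasWeakDeriv 1 c d F q := by
    intro ψ h1 h2 h3
    have hd0 : ψ d = 0 := image_eq_zero_of_notMem_tsupport fun h' => lt_irrefl _ (h3 h').2
    rw [iteratedDeriv_one, prim h1, hd0]; simp
  have w3 : HasWeakDeriv 1 c d (p + (-1 : ℂ) • F) 0 := by
    have := w1.add (w2.const_smul (-1)) hpi (hFi.smul (-1 : ℂ)) hqi (hqi.smul (-1 : ℂ))
    simpa using this
  obtain ⟨C, hC⟩ := w3.exists_const hcd (hpi.add (hFi.smul (-1 : ℂ)))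
  have hC' : EqOn (p + (-1 : ℂ) • F) (fun _ => C) (Icc c d) := by
    refine Measure.eqOn_Icc_of_ae_eq (μ := volume) hcd.ne ?_ (hp.1.add (hFc.const_smul (-1 : ℂ)))
      continuousOn_const
    rwa [← restrict_Ioo_eq_restrict_Icc]
  have hpF : ∀ x ∈ Icc c d, p x = F x + C := by
    intro x hx
    have := hC' hx
    simp only [Pi.add_apply, Pi.smul_apply, smul_eq_mul] at this
    linear_combination this
  have hφ' : Continuous (deriv φ) := (smooth_deriv hφ).continuous
  have e1 : ∫ x in Ioo c d, deriv φ x • p x =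
      ∫ x in Ioo c d, (deriv φ x • F x + deriv φ x • C) := by
    refine setIntegral_congr_fun measurableSet_Ioo (fun x hx => ?_)
    rw [hpF x (Ioo_subset_Icc_self hx), smul_add]
  have e2 : ∫ x in Ioo c d, deriv φ x • C = (φ d - φ c) • C := by
    rw [integral_smul_const, ← integral_Ioc_eq_integral_Ioo,
      ← intervalIntegral.integral_of_le hcd.le, intervalIntegral.integral_deriv_eq_sub]
    · intro x _; exact (hφ.differentiable (by simp)) x
    · exact hφ'.intervalIntegrable _ _
  have hFz : F c = 0 := by simp [hF]
  rw [e1, integral_add (integrable_smooth_smul hFi hφ')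
    (integrable_smooth_smul (by simp) hφ'), prim hφ, e2,
    hpF d (right_mem_Icc.2 hcd.le), hpF c (left_mem_Icc.2 hcd.le), hFz]
  simp only [smul_add, sub_smul, smul_zero]
  ring

namespace MemSobolev
variable {m : ℕ} {c d : ℝ} {f f' : ℝ → ℂ}

theorem integrableOn (h : MemSobolev m c d f) : IntegrableOn f (Ioo c d) :=
  h.1.integrable (by norm_num)

theorem zero : MemSobolev m c d 0 :=
  ⟨MemLp.zero', fun _ _ => ⟨0, MemLp.zero', HasWeakDeriv.zero⟩⟩

theorem add (h : MemSobolev m c d f) (h' : MemSobolev m c d f') : MemSobolev m c d (f + f') := by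
  refine ⟨h.1.add h'.1, fun k hk => ?_⟩
  obtain ⟨g, hg, hw⟩ := h.2 k hk
  obtain ⟨g', hg', hw'⟩ := h'.2 k hk
  exact ⟨g + g', hg.add hg', hw.add hw' h.integrableOn h'.integrableOn
    (hg.integrable (by norm_num)) (hg'.integrable (by norm_num))⟩

theorem const_smul (h : MemSobolev m c d f) (z : ℂ) : MemSobolev m c d (z • f) := by
  refine ⟨h.1.const_smul z, fun k hk => ?_⟩
  obtain ⟨g, hg, hw⟩ := h.2 k hk
  exact ⟨z • g, hg.const_smul z, hw.const_smul z⟩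

theorem congr_ae (h : MemSobolev m c d f) (hf : f =ᵐ[volume.restrict (Ioo c d)] f') :
    MemSobolev m c d f' := by
  refine ⟨(memLp_congr_ae hf).1 h.1, fun k hk => ?_⟩
  obtain ⟨g, hg, hw⟩ := h.2 k hk
  exact ⟨g, hg, hw.congr_ae hf Filter.EventuallyEq.rfl⟩

end MemSobolev

namespace IsContinuousRep
variable {k : ℕ} {c d : ℝ} {f f' g g' : ℝ → ℂ}

theorem integrableOn (h : IsContinuousRep k c d f g) : IntegrableOn g (Ioo c d) :=
  h.1.integrableOn_Icc.mono_set Ioo_subset_Icc_self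

theorem zero : IsContinuousRep k c d 0 0 := ⟨continuousOn_const, HasWeakDeriv.zero⟩

theorem add (h : IsContinuousRep k c d f g) (h' : IsContinuousRep k c d f' g')
    (hf : IntegrableOn f (Ioo c d)) (hf' : IntegrableOn f' (Ioo c d)) :
    IsContinuousRep k c d (f + f') (g + g') :=
  ⟨h.1.add h'.1, h.2.add h'.2 hf hf' h.integrableOn h'.integrableOn⟩

theorem const_smul (h : IsContinuousRep k c d f g) (z : ℂ) :
    IsContinuousRep k c d (z • f) (z • g) :=
  ⟨h.1.const_smul z, h.2.const_smul z⟩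

theorem congr_ae (h : IsContinuousRep k c d f g) (hf : f =ᵐ[volume.restrict (Ioo c d)] f') :
    IsContinuousRep k c d f' g :=
  ⟨h.1, h.2.congr_ae hf Filter.EventuallyEq.rfl⟩

theorem eqOn (h : IsContinuousRep k c d f g) (h' : IsContinuousRep k c d f g') (hcd : c < d) :
    EqOn g g' (Icc c d) := by
  refine Measure.eqOn_Icc_of_ae_eq (μ := volume) hcd.ne ?_ h.1 h'.1
  rw [← restrict_Ioo_eq_restrict_Icc]
  exact h.2.ae_unique h'.2 h.integrableOn h'.integrableOn

end IsContinuousRep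

theorem L2.ae_zero {c d : ℝ} (hc : 0 ≤ c) (hd : d ≤ 1) :
    (0 : ℝ → ℂ) =ᵐ[volume.restrict (Ioo c d)] ((0 : L2) : ℝ → ℂ) :=
  ae_mono (Measure.restrict_mono (Ioo_subset_Ioo hc hd) le_rfl) (Lp.coeFn_zero ℂ 2 _).symm

theorem L2.ae_add {c d : ℝ} (hc : 0 ≤ c) (hd : d ≤ 1) (f g : L2) :
    (f + g : ℝ → ℂ) =ᵐ[volume.restrict (Ioo c d)] ((f + g : L2) : ℝ → ℂ) :=
  ae_mono (Measure.restrict_mono (Ioo_subset_Ioo hc hd) le_rfl) (Lp.coeFn_add f g).symm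

theorem L2.ae_smul {c d : ℝ} (hc : 0 ≤ c) (hd : d ≤ 1) (z : ℂ) (f : L2) :
    (z • (f : ℝ → ℂ)) =ᵐ[volume.restrict (Ioo c d)] ((z • f : L2) : ℝ → ℂ) :=
  ae_mono (Measure.restrict_mono (Ioo_subset_Ioo hc hd) le_rfl) (Lp.coeFn_smul z f).symm

theorem L2.integrableOn {c d : ℝ} (hc : 0 ≤ c) (hd : d ≤ 1) (f : L2) :
    IntegrableOn f (Ioo c d) :=
  IntegrableOn.mono_set ((Lp.memLp f).integrable (by norm_num)) (Ioo_subset_Ioo hc hd)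

/-- `u ∈ H²(0, 1) ∩ H¹₀(0, 1)`: in one dimension, the functions of `H²(0, 1)` whose continuous
representative vanishes at `0` and at `1`. -/
def MemH2H10 (u : ℝ → ℂ) : Prop :=
  MemSobolev 2 0 1 u ∧ ∃ u₀ : ℝ → ℂ, IsContinuousRep 0 0 1 u u₀ ∧ u₀ 0 = 0 ∧ u₀ 1 = 0

/-- The vector space underlying the energy space `[H²(0, 1) ∩ H¹₀(0, 1)] × L²(0, 1)`. -/
def energySpace : Submodule ℂ (L2 × L2) where
  carrier := {U | MemH2H10 U.1}
  zero_mem' := ⟨MemSobolev.zero.congr_ae (L2.ae_zero le_rfl le_rfl), 0,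
    IsContinuousRep.zero.congr_ae (L2.ae_zero le_rfl le_rfl), rfl, rfl⟩
  add_mem' := by
    rintro U V ⟨hU, u₀, hu, hu0, hu1⟩ ⟨hV, v₀, hv, hv0, hv1⟩
    exact ⟨(hU.add hV).congr_ae (L2.ae_add le_rfl le_rfl _ _), u₀ + v₀,
      (hu.add hv hU.integrableOn hV.integrableOn).congr_ae (L2.ae_add le_rfl le_rfl _ _),
      by simp [hu0, hv0], by simp [hu1, hv1]⟩
  smul_mem' := by
    rintro z U ⟨hU, u₀, hu, hu0, hu1⟩
    exact ⟨(hU.const_smul z).congr_ae (L2.ae_smul le_rfl le_rfl _ _), z • u₀,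
      (hu.const_smul z).congr_ae (L2.ae_smul le_rfl le_rfl _ _), by simp [hu0], by simp [hu1]⟩

/-- The conditions that define the domain of the beam operator. Here `u₀`, `v₀` are the continuous
representatives of `u`, `v` on `[0, 1]`, while `l₂`, `l₃` (resp. `r₂`, `r₃`) are those of `u_xx`,
`u_xxx` on `[0, ξ]` (resp. on `[ξ, 1]`), so that for instance `u_xxx(ξ⁻) = l₃ ξ` and
`u_xxx(ξ⁺) = r₃ ξ`. -/
def IsInBeamDomain (a α ξ : ℝ) (u v : ℝ → ℂ) : Prop :=
  MemSobolev 4 0 ξ u ∧ MemSobolev 4 ξ 1 u ∧ MemSobolev 2 0 1 u ∧ MemSobolev 2 0 1 v ∧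
  ∃ u₀ v₀ l₂ r₂ l₃ r₃ : ℝ → ℂ,
    IsContinuousRep 0 0 1 u u₀ ∧ IsContinuousRep 0 0 1 v v₀ ∧
    IsContinuousRep 2 0 ξ u l₂ ∧ IsContinuousRep 2 ξ 1 u r₂ ∧
    IsContinuousRep 3 0 ξ u l₃ ∧ IsContinuousRep 3 ξ 1 u r₃ ∧
    u₀ 0 = 0 ∧ v₀ 0 = 0 ∧ u₀ 1 = 0 ∧ v₀ 1 = 0 ∧
    l₂ 0 = 0 ∧ r₂ 1 = 0 ∧
    l₂ ξ = r₂ ξ ∧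
    r₃ ξ - l₃ ξ = -((α / a : ℝ) : ℂ) * v₀ ξ

/-- The domain of the beam operator, a subspace of the energy space. -/
def beamDomain (a α : ℝ) (ξ : Ioo (0 : ℝ) 1) : Submodule ℂ energySpace where
  carrier := {U | IsInBeamDomain a α ξ U.1.1 U.1.2}
  zero_mem' := by
    have z {c d : ℝ} := @L2.ae_zero c d
    have h0 := ξ.2.1.le
    have h1 := ξ.2.2.le
    exact ⟨MemSobolev.zero.congr_ae (z le_rfl h1), MemSobolev.zero.congr_ae (z h0 le_rfl),
      MemSobolev.zero.congr_ae (z le_rfl le_rfl), MemSobolev.zero.congr_ae (z le_rfl le_rfl),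
      0, 0, 0, 0, 0, 0, IsContinuousRep.zero.congr_ae (z le_rfl le_rfl),
      IsContinuousRep.zero.congr_ae (z le_rfl le_rfl), IsContinuousRep.zero.congr_ae (z le_rfl h1),
      IsContinuousRep.zero.congr_ae (z h0 le_rfl), IsContinuousRep.zero.congr_ae (z le_rfl h1),
      IsContinuousRep.zero.congr_ae (z h0 le_rfl), by simp⟩
  add_mem' := by
    rintro U V ⟨s1, s2, s3, s4, u₀, v₀, l₂, r₂, l₃, r₃, c1, c2, c3, c4, c5, c6, e1, e2, e3, e4,
      e5, e6, e7, e8⟩ ⟨s1', s2', s3', s4', u₀', v₀', l₂', r₂', l₃', r₃', c1', c2', c3', c4', c5',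
      c6', e1', e2', e3', e4', e5', e6', e7', e8'⟩
    have z {c d : ℝ} := @L2.ae_add c d
    have h0 := ξ.2.1.le
    have h1 := ξ.2.2.le
    refine ⟨(s1.add s1').congr_ae (z le_rfl h1 _ _), (s2.add s2').congr_ae (z h0 le_rfl _ _),
      (s3.add s3').congr_ae (z le_rfl le_rfl _ _), (s4.add s4').congr_ae (z le_rfl le_rfl _ _),
      u₀ + u₀', v₀ + v₀', l₂ + l₂', r₂ + r₂', l₃ + l₃', r₃ + r₃',
      (c1.add c1' s3.integrableOn s3'.integrableOn).congr_ae (z le_rfl le_rfl _ _),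
      (c2.add c2' s4.integrableOn s4'.integrableOn).congr_ae (z le_rfl le_rfl _ _),
      (c3.add c3' s1.integrableOn s1'.integrableOn).congr_ae (z le_rfl h1 _ _),
      (c4.add c4' s2.integrableOn s2'.integrableOn).congr_ae (z h0 le_rfl _ _),
      (c5.add c5' s1.integrableOn s1'.integrableOn).congr_ae (z le_rfl h1 _ _),
      (c6.add c6' s2.integrableOn s2'.integrableOn).congr_ae (z h0 le_rfl _ _),
      by simp [e1, e1'], by simp [e2, e2'], by simp [e3, e3'], by simp [e4, e4'],
      by simp [e5, e5'], by simp [e6, e6'], by simp [e7, e7'], ?_⟩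
    simp only [Pi.add_apply]
    linear_combination e8 + e8'
  smul_mem' := by
    rintro w U ⟨s1, s2, s3, s4, u₀, v₀, l₂, r₂, l₃, r₃, c1, c2, c3, c4, c5, c6, e1, e2, e3, e4,
      e5, e6, e7, e8⟩
    have z {c d : ℝ} := @L2.ae_smul c d
    have h0 := ξ.2.1.le
    have h1 := ξ.2.2.le
    refine ⟨(s1.const_smul w).congr_ae (z le_rfl h1 _ _),
      (s2.const_smul w).congr_ae (z h0 le_rfl _ _),
      (s3.const_smul w).congr_ae (z le_rfl le_rfl _ _),
      (s4.const_smul w).congr_ae (z le_rfl le_rfl _ _),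
      w • u₀, w • v₀, w • l₂, w • r₂, w • l₃, w • r₃,
      (c1.const_smul w).congr_ae (z le_rfl le_rfl _ _),
      (c2.const_smul w).congr_ae (z le_rfl le_rfl _ _),
      (c3.const_smul w).congr_ae (z le_rfl h1 _ _),
      (c4.const_smul w).congr_ae (z h0 le_rfl _ _),
      (c5.const_smul w).congr_ae (z le_rfl h1 _ _),
      (c6.const_smul w).congr_ae (z h0 le_rfl _ _),
      by simp [e1], by simp [e2], by simp [e3], by simp [e4],
      by simp [e5], by simp [e6], by simp [e7], ?_⟩
    simp only [Pi.smul_apply, smul_eq_mul]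
    linear_combination w * e8

/-- The identity `F = -a u_xxxx - b v - α v(ξ) δ_ξ` of distributions on `(0, 1)`. -/
def IsBeamImage (a b α ξ : ℝ) (u v F : ℝ → ℂ) : Prop :=
  ∃ v₀ : ℝ → ℂ, IsContinuousRep 0 0 1 v v₀ ∧
    ∀ φ : ℝ → ℝ, ContDiff ℝ ∞ φ → HasCompactSupport φ → tsupport φ ⊆ Ioo 0 1 →
      ∫ x in Ioo (0 : ℝ) 1, φ x • F x =
        -(a : ℂ) * (∫ x in Ioo (0 : ℝ) 1, iteratedDeriv 4 φ x • u x)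
          - b * (∫ x in Ioo (0 : ℝ) 1, φ x • v x) - α * (φ ξ • v₀ ξ)

theorem IsBeamImage.congr_ae {a b α ξ : ℝ} {u v F u' v' F' : ℝ → ℂ} (h : IsBeamImage a b α ξ u v F)
    (hu : u =ᵐ[volume.restrict (Ioo 0 1)] u') (hv : v =ᵐ[volume.restrict (Ioo 0 1)] v')
    (hF : F =ᵐ[volume.restrict (Ioo 0 1)] F') : IsBeamImage a b α ξ u' v' F' := by
  obtain ⟨v₀, c, e⟩ := h
  refine ⟨v₀, c.congr_ae hv, fun φ h1 h2 h3 => ?_⟩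
  have I (ψ : ℝ → ℝ) {g g' : ℝ → ℂ} (hg : g =ᵐ[volume.restrict (Ioo 0 1)] g') :
      ∫ x in Ioo (0 : ℝ) 1, ψ x • g' x = ∫ x in Ioo (0 : ℝ) 1, ψ x • g x :=
    integral_congr_ae (by filter_upwards [hg] with x hx; rw [hx])
  rw [I _ hu, I _ hv, I _ hF]
  exact e φ h1 h2 h3

/-- The graph of the beam operator `(u, v) ↦ (v, -a u_xxxx - b v - α v(ξ) δ_ξ)`. -/
def beamGraph (a b α : ℝ) (ξ : Ioo (0 : ℝ) 1) : Submodule ℂ (energySpace × energySpace) where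
  carrier := {p | p.1 ∈ beamDomain a α ξ ∧ p.2.1.1 = p.1.1.2 ∧
    IsBeamImage a b α ξ p.1.1.1 p.1.1.2 p.2.1.2}
  zero_mem' := by
    refine ⟨Submodule.zero_mem _, rfl, ?_⟩
    have z := L2.ae_zero (c := 0) (d := 1) le_rfl le_rfl
    exact IsBeamImage.congr_ae (u := 0) (v := 0) (F := 0)
      ⟨0, IsContinuousRep.zero, fun φ _ _ _ => by simp⟩ z z z
  add_mem' := by
    rintro p q ⟨hp, hp', v₀, c, e⟩ ⟨hq, hq', v₀', c', e'⟩
    refine ⟨Submodule.add_mem _ hp hq, congrArg₂ (· + ·) hp' hq', ?_⟩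
    have z := L2.ae_add (c := 0) (d := 1) le_rfl le_rfl
    have i := L2.integrableOn (c := 0) (d := 1) le_rfl le_rfl
    refine IsBeamImage.congr_ae ⟨v₀ + v₀', c.add c' (i _) (i _), fun φ h1 h2 h3 => ?_⟩
      (z _ _) (z _ _) (z _ _)
    have I {ψ : ℝ → ℝ} (hψ : Continuous ψ) (g g' : L2) :
        ∫ x in Ioo (0 : ℝ) 1, ψ x • (g + g' : ℝ → ℂ) x =
          (∫ x in Ioo (0 : ℝ) 1, ψ x • g x) + ∫ x in Ioo (0 : ℝ) 1, ψ x • g' x := by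
      simp only [Pi.add_apply, smul_add]
      exact integral_add (integrable_smooth_smul (i g) hψ) (integrable_smooth_smul (i g') hψ)
    rw [I h1.continuous, I h1.continuous, I (continuous_iteratedDeriv_of_smooth h1 4),
      e φ h1 h2 h3, e' φ h1 h2 h3, Pi.add_apply, smul_add]
    ring
  smul_mem' := by
    rintro w p ⟨hp, hp', v₀, c, e⟩
    refine ⟨Submodule.smul_mem _ _ hp, congrArg (w • ·) hp', ?_⟩
    have z := L2.ae_smul (c := 0) (d := 1) le_rfl le_rfl w
    refine IsBeamImage.congr_ae ⟨w • v₀, c.const_smul w, fun φ h1 h2 h3 => ?_⟩ (z _) (z _) (z _)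
    have I (ψ : ℝ → ℝ) (g : L2) : ∫ x in Ioo (0 : ℝ) 1, ψ x • (w • (g : ℝ → ℂ)) x =
        w * ∫ x in Ioo (0 : ℝ) 1, ψ x • g x := by
      simp only [Pi.smul_apply, smul_comm _ w]
      exact integral_smul w _
    rw [I, I, I, e φ h1 h2 h3, Pi.smul_apply, smul_comm, smul_eq_mul w]
    ring

/-- The graph is single-valued. -/
theorem beamGraph_singleValued (a b α : ℝ) (ξ : Ioo (0 : ℝ) 1) :
    ∀ p ∈ beamGraph a b α ξ, p.1 = 0 → p.2 = 0 := by
  rintro ⟨U, W⟩ ⟨-, h2, v₀, c, e⟩ hU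
  simp only at hU h2 c e
  subst hU
  have z := L2.ae_zero (c := 0) (d := 1) le_rfl le_rfl
  have hv : v₀ ξ = 0 :=
    (c.congr_ae z.symm).eqOn IsContinuousRep.zero one_pos (Ioo_subset_Icc_self ξ.2)
  have I (ψ : ℝ → ℝ) : ∫ x in Ioo (0 : ℝ) 1, ψ x • ((0 : L2) : ℝ → ℂ) x = 0 := by
    rw [← integral_zero (α := ℝ) (G := ℂ) (μ := volume.restrict (Ioo 0 1))]
    refine integral_congr_ae ?_
    filter_upwards [z] with x hx
    exact (congrArg (ψ x • ·) hx.symm).trans (smul_zero _)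
  have w : HasWeakDeriv 0 0 1 0 (W.1.2 : ℝ → ℂ) := by
    intro φ h1 h2 h3
    have e' := e φ h1 h2 h3
    have I1 := I φ
    have I4 := I (iteratedDeriv 4 φ)
    rw [hv, smul_zero, mul_zero, sub_zero] at e'
    erw [I1, I4] at e'
    rw [e']; simp
  have w' := w.ae_unique HasWeakDeriv.zero (L2.integrableOn le_rfl le_rfl _)
    (integrable_zero ℝ ℂ _)
  refine Subtype.ext (Prod.ext h2 (Lp.ext (w'.trans z)))

/-- The beam operator `𝒜(u, v) = (v, -a u_xxxx - b v - α v(ξ) δ_ξ)`, as an unbounded (partially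
defined) linear operator on the energy space. -/
noncomputable def beamOperator (a b α : ℝ) (ξ : Ioo (0 : ℝ) 1) : energySpace →ₗ.[ℂ] energySpace :=
  (beamGraph a b α ξ).toLinearPMap

theorem beamOperator_graph (a b α : ℝ) (ξ : Ioo (0 : ℝ) 1) :
    (beamOperator a b α ξ).graph = beamGraph a b α ξ :=
  Submodule.toLinearPMap_graph_eq _ (beamGraph_singleValued a b α ξ)

/-- The domain of the beam operator is exactly `beamDomain`: the jump condition on `u_xxx` makes the
Dirac masses cancel, so that `-a u_xxxx - b v - α v(ξ) δ_ξ` is square integrable. -/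
theorem beamOperator_domain {a : ℝ} (ha : 0 < a) (b α : ℝ) (ξ : Ioo (0 : ℝ) 1) :
    (beamOperator a b α ξ).domain = beamDomain a α ξ := by
  refine le_antisymm ?_ ?_
  · rintro U ⟨p, hp, rfl⟩
    exact hp.1
  intro U hU
  obtain ⟨s1, s2, s3, s4, u₀, v₀, l₂, r₂, l₃, r₃, c1, c2, c3, c4, c5, c6, e1, e2, e3, e4,
    e5, e6, e7, e8⟩ := hU
  have h0 := ξ.2.1
  have h1 := ξ.2.2
  obtain ⟨x, hx⟩ := ξ
  simp only at *
  obtain ⟨gl, hgl, wl⟩ := s1.2 4 le_rfl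
  obtain ⟨gr, hgr, wr⟩ := s2.2 4 le_rfl
  obtain ⟨g₂, hg₂, w₂⟩ := s3.2 2 le_rfl
  have split (F : ℝ → ℂ) (hF : IntegrableOn F (Ioo 0 1)) : ∫ t in Ioo (0 : ℝ) 1, F t =
      (∫ t in Ioo 0 x, F t) + ∫ t in Ioo x 1, F t := by
    have hI {c d : ℝ} (hc : 0 ≤ c) (hd : d ≤ 1) (hcd : c ≤ d) : IntervalIntegrable F volume c d :=
      (intervalIntegrable_iff_integrableOn_Ioo_of_le hcd).2 (hF.mono_set (Ioo_subset_Ioo hc hd))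
    rw [← integral_Ioc_eq_integral_Ioo, ← integral_Ioc_eq_integral_Ioo,
      ← integral_Ioc_eq_integral_Ioo, ← intervalIntegral.integral_of_le zero_le_one,
      ← intervalIntegral.integral_of_le h0.le, ← intervalIntegral.integral_of_le h1.le]
    exact (intervalIntegral.integral_add_adjacent_intervals (hI le_rfl h1.le h0.le)
      (hI h0.le le_rfl h1.le)).symm
  -- the piecewise fourth derivative
  set w : ℝ → ℂ := (Iio x).indicator gl + (Ici x).indicator gr with hw
  have hwl : ∀ t ∈ Ioo 0 x, w t = gl t := fun t ht => by simp [hw, ht.2]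
  have hwr : ∀ t ∈ Ioo x 1, w t = gr t := fun t ht => by simp [hw, ht.1.le]
  have hwm : MemLp w 2 (volume.restrict (Ioo 0 1)) := by
    refine MemLp.add ?_ ?_
    · rw [memLp_indicator_iff_restrict measurableSet_Iio, Measure.restrict_restrict
        measurableSet_Iio]
      refine hgl.mono_measure (Measure.restrict_mono ?_ le_rfl)
      rintro t ⟨ht, ht'⟩
      exact ⟨ht'.1, ht⟩
    · rw [memLp_indicator_iff_restrict measurableSet_Ici, Measure.restrict_restrict
        measurableSet_Ici]
      have : Ici x ∩ Ioo 0 1 = Ico x 1 := by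
        ext t; simp only [mem_inter_iff, mem_Ici, mem_Ioo, mem_Ico]
        exact ⟨fun h => ⟨h.1, h.2.2⟩, fun h => ⟨h.1, h0.trans_le h.1, h.2⟩⟩
      rw [this, restrict_Ico_eq_restrict_Ioc, ← restrict_Ioo_eq_restrict_Ioc]
      exact hgr
  have hwi : IntegrableOn w (Ioo 0 1) := hwm.integrable (by norm_num)
  have hgli : IntegrableOn gl (Ioo 0 x) := hgl.integrable (by norm_num)
  have hgri : IntegrableOn gr (Ioo x 1) := hgr.integrable (by norm_num)
  have hg₂i : IntegrableOn g₂ (Ioo 0 1) := hg₂.integrable (by norm_num)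
  have hgl₂ : g₂ =ᵐ[volume.restrict (Ioo 0 x)] l₂ := (w₂.mono le_rfl h1.le).ae_unique c3.2
    (hg₂i.mono_set (Ioo_subset_Ioo le_rfl h1.le)) c3.integrableOn
  have hgr₂ : g₂ =ᵐ[volume.restrict (Ioo x 1)] r₂ := (w₂.mono h0.le le_rfl).ae_unique c4.2
    (hg₂i.mono_set (Ioo_subset_Ioo h0.le le_rfl)) c4.integrableOn
  set v : L2 := U.1.2 with hv
  have hFm : MemLp ((-(a : ℂ)) • w + (-(b : ℂ)) • (v : ℝ → ℂ)) 2 (volume.restrict (Ioo 0 1)) :=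
    (hwm.const_smul _).add ((Lp.memLp v).const_smul _)
  refine ⟨⟨U, ⟨(v, hFm.toLp _), s4, v₀, c2, e2, e4⟩⟩, ⟨?_, rfl, ?_⟩, rfl⟩
  · exact ⟨s1, s2, s3, s4, u₀, v₀, l₂, r₂, l₃, r₃, c1, c2, c3, c4, c5, c6, e1, e2, e3, e4,
      e5, e6, e7, e8⟩
  refine IsBeamImage.congr_ae ?_ Filter.EventuallyEq.rfl Filter.EventuallyEq.rfl
    hFm.coeFn_toLp.symm
  refine ⟨v₀, c2, fun φ f1 f2 f3 => ?_⟩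
  have smooth_deriv {ψ : ℝ → ℝ} (hψ : ContDiff ℝ ∞ ψ) : ContDiff ℝ ∞ (deriv ψ) :=
    (contDiff_infty_iff_deriv.1 hψ).2
  have d1 := smooth_deriv f1
  have d2 := smooth_deriv d1
  have z (ψ : ℝ → ℝ) (hψ : tsupport ψ ⊆ Ioo 0 1) : ψ 0 = 0 ∧ ψ 1 = 0 :=
    ⟨image_eq_zero_of_notMem_tsupport fun h' => lt_irrefl _ (hψ h').1,
      image_eq_zero_of_notMem_tsupport fun h' => lt_irrefl _ (hψ h').2⟩
  have t1 : tsupport (deriv φ) ⊆ Ioo 0 1 := tsupport_deriv_subset.trans f3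
  have t2 : tsupport (deriv (deriv φ)) ⊆ Ioo 0 1 := tsupport_deriv_subset.trans t1
  have k1 := w₂ (deriv (deriv φ)) d2 f2.deriv.deriv t2
  have k2 : iteratedDeriv 2 (deriv (deriv φ)) = iteratedDeriv 4 φ := by
    rw [← iteratedDeriv_succ', ← iteratedDeriv_succ']
  have J1 : ∫ t in Ioo 0 x, deriv (deriv φ) t • g₂ t
      = ∫ t in Ioo 0 x, deriv (deriv φ) t • l₂ t :=
    integral_congr_ae (by filter_upwards [hgl₂] with t ht; rw [ht])
  have J2 : ∫ t in Ioo x 1, deriv (deriv φ) t • g₂ t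
      = ∫ t in Ioo x 1, deriv (deriv φ) t • r₂ t :=
    integral_congr_ae (by filter_upwards [hgr₂] with t ht; rw [ht])
  have J3 : ∫ t in Ioo 0 x, φ t • w t = ∫ t in Ioo 0 x, φ t • gl t :=
    setIntegral_congr_fun measurableSet_Ioo (fun t ht => by simp only [hwl t ht])
  have J4 : ∫ t in Ioo x 1, φ t • w t = ∫ t in Ioo x 1, φ t • gr t :=
    setIntegral_congr_fun measurableSet_Ioo (fun t ht => by simp only [hwr t ht])
  rw [k2, split _ (integrable_smooth_smul hg₂i d2.continuous), J1, J2,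
    c3.integral_deriv_smul h0 c5.2 c5.integrableOn d1,
    c4.integral_deriv_smul h1 c6.2 c6.integrableOn d1,
    c5.integral_deriv_smul h0 wl hgli f1, c6.integral_deriv_smul h1 wr hgri f1,
    (z _ t1).1, (z _ t1).2, (z _ f3).1, (z _ f3).2, ← J3, ← J4, e7] at k1
  have k3 := split _ (integrable_smooth_smul hwi f1.continuous)
  have hvi : IntegrableOn v (Ioo 0 1) := L2.integrableOn le_rfl le_rfl v
  have k4 : ∫ t in Ioo (0 : ℝ) 1, φ t • ((-(a : ℂ)) • w + (-(b : ℂ)) • (v : ℝ → ℂ)) t =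
      -(a : ℂ) * (∫ t in Ioo (0 : ℝ) 1, φ t • w t) - b * ∫ t in Ioo (0 : ℝ) 1, φ t • v t := by
    have i1 : Integrable (fun t => -(a : ℂ) • φ t • w t) (volume.restrict (Ioo 0 1)) :=
      (integrable_smooth_smul hwi f1.continuous).smul (-(a : ℂ))
    have i2 : Integrable (fun t => -(b : ℂ) • φ t • v t) (volume.restrict (Ioo 0 1)) :=
      (integrable_smooth_smul hvi f1.continuous).smul (-(b : ℂ))
    rw [sub_eq_add_neg, ← neg_mul, ← smul_eq_mul, ← smul_eq_mul, ← integral_smul,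
      ← integral_smul, ← integral_add i1 i2]
    refine integral_congr_ae (Filter.Eventually.of_forall fun t => ?_)
    simp only [Pi.add_apply, Pi.smul_apply, smul_add, smul_comm (φ t)]
  have ha' : (a : ℂ) ≠ 0 := by exact_mod_cast ha.ne'
  have e9 : (a : ℂ) * (r₃ x - l₃ x) = -(α * v₀ x) := by
    rw [e8]; push_cast; field_simp
  rw [k4, k1, k3]
  simp only [Complex.real_smul, Complex.ofReal_zero]
  linear_combination (φ x : ℂ) * e9

/-- The kernel of `(T - μ)^k` for a partially defined operator `T`, where `(T - μ)^(k+1) x = 0`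
means that `x` belongs to the domain of `T` and `(T - μ)^k (T x - μ x) = 0`. -/
def kerPow {E : Type*} [AddCommGroup E] [Module ℂ E] (T : E →ₗ.[ℂ] E) (μ : ℂ) : ℕ → Submodule ℂ E
  | 0 => ⊥
  | k + 1 => ((kerPow T μ k).comap (T.toFun - μ • T.domain.subtype)).map T.domain.subtype

/-- The eigenspace of `T` for `μ`: the vectors `x` of the domain with `T x = μ x`. -/
def eigenspaceOf {E : Type*} [AddCommGroup E] [Module ℂ E] (T : E →ₗ.[ℂ] E) (μ : ℂ) :
    Submodule ℂ E :=
  kerPow T μ 1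

theorem mem_eigenspaceOf {E : Type*} [AddCommGroup E] [Module ℂ E] {T : E →ₗ.[ℂ] E} {μ : ℂ}
    {x : E} : x ∈ eigenspaceOf T μ ↔ ∃ h : x ∈ T.domain, T ⟨x, h⟩ = μ • x := by
  simp only [eigenspaceOf, kerPow, Submodule.mem_map, Submodule.mem_comap, Submodule.mem_bot,
    LinearMap.sub_apply, LinearMap.smul_apply, Submodule.subtype_apply, sub_eq_zero]
  constructor
  · rintro ⟨y, hy, rfl⟩
    exact ⟨y.2, hy⟩
  · rintro ⟨h, hx⟩
    exact ⟨⟨x, h⟩, hx, rfl⟩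

/-- The generalized eigenspace (root subspace) of `T` for `μ`. -/
def rootSpaceOf {E : Type*} [AddCommGroup E] [Module ℂ E] (T : E →ₗ.[ℂ] E) (μ : ℂ) :
    Submodule ℂ E :=
  ⨆ k : ℕ, kerPow T μ k

/-- `μ` is an eigenvalue of `T`. -/
def IsEigenvalueOf {E : Type*} [AddCommGroup E] [Module ℂ E] (T : E →ₗ.[ℂ] E) (μ : ℂ) : Prop :=
  ∃ x : T.domain, (x : E) ≠ 0 ∧ T x = μ • (x : E)

/-- The geometric multiplicity of `μ`: the dimension of the eigenspace. -/
noncomputable def geomMult {E : Type*} [AddCommGroup E] [Module ℂ E] (T : E →ₗ.[ℂ] E) (μ : ℂ) :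
    Cardinal :=
  Module.rank ℂ (eigenspaceOf T μ)

/-- The algebraic multiplicity of `μ`: the dimension of the generalized eigenspace. -/
noncomputable def algMult {E : Type*} [AddCommGroup E] [Module ℂ E] (T : E →ₗ.[ℂ] E) (μ : ℂ) :
    Cardinal :=
  Module.rank ℂ (rootSpaceOf T μ)

/-! With `Λ = l⁴`, an eigenvector solves `u'''' = Λ u` on each side of `ξ`. The hinged ends leave
only the combinations `A sinh(l x) + B sin(l x)`, with `x` measured from the nearer end of the
interval. The transmission conditions at `ξ` fix the coefficients up to one common factor and leave
one scalar equation, `BeamCharEq`, which characterises the large eigenvalues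
(`isEigenvalueOf_beamOperator_iff`). Irrationality of `ξ` keeps the elimination from degenerating.

Since `|μ|` is of order `|l|²` while the left side of that equation carries `l³`, the right side is
a perturbation of relative size `1/|l|`. The equation is invariant under `l ↦ i l`, so `l` can be
taken in the sector `|Im l| ≤ Re l`. There `sinh l` dominates all hyperbolic terms, and dividing by
it gives `|sin l| ≤ 2 |ε| |m|` with `m = sin(l ξ) sin(l (1 - ξ))` and `|ε| ≤ α / (√a |l|)`
(`BeamCharEq.norm_sin_le`, `norm_eps_le`). This puts `l` near some `n π` (`BeamCharEq.exists_root`).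
Conversely, on a holomorphic branch `μ = M(l)` with prescribed sign of `Im μ` (`exists_branch`) the
equation reads `sin l + G(l) = 0` with `G` small, and a contraction gives exactly one zero near each
large `n π` (`exists_unique_zero_sin_add`).

The explicit mode `φ` makes the eigenspaces one-dimensional. By Green's identity, a Jordan chain of
length two would force `(2 μ + b) ∫ φ² + α φ(ξ)² = 0` (`integral_beamMode_sq_of_chain`). After
division by `sinh l`, the integral is close to `-m cos l / 2` and `φ(ξ)` is `O(m)`, so this fails
for large `μ` as soon as `m ≠ 0`. Irrationality of `ξ` gives `m ≠ 0` but no uniform lower bound, so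
every error term is kept proportional to `|m|`.

The cutoff for `|μ|` corresponds to a value of `|l|` halfway between the moduli of consecutive
roots, so that the largeness of `μ` and the largeness of the nearby root agree exactly. -/

/-! ### Weak derivatives and their continuous representatives -/

namespace HasWeakDeriv
variable {k : ℕ} {c d : ℝ} {f p q : ℝ → ℂ}

theorem trans (hp : HasWeakDeriv k c d f p) (hq : HasWeakDeriv 1 c d p q) :
    HasWeakDeriv (k + 1) c d f q := by
  intro φ h1 h2 h3
  have hd : ContDiff ℝ ∞ (deriv φ) := (contDiff_infty_iff_deriv.1 h1).2
  have e1 := hp (deriv φ) hd h2.deriv (tsupport_deriv_subset.trans h3)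
  have e2 := hq φ h1 h2 h3
  rw [iteratedDeriv_one] at e2
  rw [iteratedDeriv_succ', e1, e2]
  ring

theorem of_succ (hp : HasWeakDeriv k c d f p) (hq : HasWeakDeriv (k + 1) c d f q) :
    HasWeakDeriv 1 c d p q := by
  intro φ h1 h2 h3
  have hd : ContDiff ℝ ∞ (deriv φ) := (contDiff_infty_iff_deriv.1 h1).2
  have e1 := hp (deriv φ) hd h2.deriv (tsupport_deriv_subset.trans h3)
  have e2 := hq φ h1 h2 h3
  rw [iteratedDeriv_succ', e1, pow_succ, mul_assoc] at e2
  rw [iteratedDeriv_one, pow_one]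
  exact mul_left_cancel₀ (pow_ne_zero k (by norm_num)) e2

/-- Continuity on the whole interval lets integration by parts ignore a countable set of points. The
set `s` will be `{ξ}` for functions glued from two pieces. -/
theorem of_hasDerivAt (hcd : c ≤ d) {s : Set ℝ} (hs : s.Countable) (hp : ContinuousOn p (Icc c d))
    (hd : ∀ x ∈ Ioo c d \ s, HasDerivAt p (q x) x) (hq : IntegrableOn q (Ioo c d)) :
    HasWeakDeriv 1 c d p q := by
  intro φ h1 h2 h3
  have hφ' : Continuous (deriv φ) := h1.continuous_deriv (by exact_mod_cast le_top)
  have hpi : IntegrableOn p (Ioo c d) := hp.integrableOn_Icc.mono_set Ioo_subset_Icc_self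
  have i1 := integrable_smooth_smul hpi hφ'
  have i2 := integrable_smooth_smul hq h1.continuous
  have key := integral_eq_of_hasDerivAt_off_countable_of_le (fun x => φ x • p x)
    (fun x => deriv φ x • p x + φ x • q x) hcd hs (h1.continuous.continuousOn.smul hp)
    (fun x hx => by
      have := ((h1.differentiable (by simp)) x).hasDerivAt.smul (hd x hx)
      rw [add_comm] at this
      exact this)
    ((intervalIntegrable_iff_integrableOn_Ioo_of_le hcd).2 (i1.add i2))
  have z1 : φ c = 0 := image_eq_zero_of_notMem_tsupport fun h' => lt_irrefl _ (h3 h').1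
  have z2 : φ d = 0 := image_eq_zero_of_notMem_tsupport fun h' => lt_irrefl _ (h3 h').2
  rw [intervalIntegral.integral_of_le hcd, integral_Ioc_eq_integral_Ioo, integral_add i1 i2,
    z1, z2, zero_smul, zero_smul, sub_zero] at key
  rw [iteratedDeriv_one, pow_one]
  linear_combination key

/-- Subtracting a primitive of `q` leaves a function with zero weak derivative, hence a constant. -/
theorem ae_eq_primitive (h : HasWeakDeriv 1 c d p q) (hcd : c < d) (hp : IntegrableOn p (Ioo c d))
    (hq : IntegrableOn q (Ioo c d)) :
    ∃ C : ℂ, p =ᵐ[volume.restrict (Ioo c d)] fun x => C + ∫ t in c..x, q t := by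
  have hqI : IntervalIntegrable q volume c d :=
    (intervalIntegrable_iff_integrableOn_Ioo_of_le hcd.le).2 hq
  set F : ℝ → ℂ := fun x => ∫ t in c..x, q t with hF
  have hFc : ContinuousOn F (Icc c d) := by
    rw [← uIcc_of_le hcd.le]
    exact intervalIntegral.continuousOn_primitive_interval' hqI (by simp)
  have hFi : IntegrableOn F (Ioo c d) := hFc.integrableOn_Icc.mono_set Ioo_subset_Icc_self
  have w2 : HasWeakDeriv 1 c d F q := by
    intro ψ h1 h2 h3
    have hd0 : ψ d = 0 := image_eq_zero_of_notMem_tsupport fun h' => lt_irrefl _ (h3 h').2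
    have := integral_primitive hqI h1
    rw [intervalIntegral.integral_of_le hcd.le, integral_Ioc_eq_integral_Ioo,
      intervalIntegral.integral_of_le (f := fun x => ψ x • q x) hcd.le,
      integral_Ioc_eq_integral_Ioo, hd0] at this
    rw [iteratedDeriv_one, this]; simp
  have w3 : HasWeakDeriv 1 c d (p + (-1 : ℂ) • F) 0 := by
    have := h.add (w2.const_smul (-1)) hp (hFi.smul (-1 : ℂ)) hq (hq.smul (-1 : ℂ))
    simpa using this
  obtain ⟨C, hC⟩ := w3.exists_const hcd (hp.add (hFi.smul (-1 : ℂ)))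
  refine ⟨C, ?_⟩
  filter_upwards [hC] with x hx
  simp only [Pi.add_apply, Pi.smul_apply, smul_eq_mul] at hx
  linear_combination hx

/-- A weak derivative that has itself a weak derivative has a continuous representative. -/
theorem exists_isContinuousRep (hp : HasWeakDeriv k c d f p) (hq : HasWeakDeriv (k + 1) c d f q)
    (hcd : c < d) (hpi : IntegrableOn p (Ioo c d)) (hqi : IntegrableOn q (Ioo c d)) :
    ∃ g, IsContinuousRep k c d f g := by
  obtain ⟨C, hC⟩ := (hp.of_succ hq).ae_eq_primitive hcd hpi hqi
  refine ⟨fun x => C + ∫ t in c..x, q t, continuousOn_const.add ?_,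
    hp.congr_ae Filter.EventuallyEq.rfl hC⟩
  rw [← uIcc_of_le hcd.le]
  exact intervalIntegral.continuousOn_primitive_interval'
    ((intervalIntegrable_iff_integrableOn_Ioo_of_le hcd.le).2 hqi) (by simp)

end HasWeakDeriv

theorem MemSobolev.exists_isContinuousRep {m k : ℕ} {c d : ℝ} {f : ℝ → ℂ} (h : MemSobolev m c d f)
    (hk : k < m) (hcd : c < d) : ∃ g, IsContinuousRep k c d f g := by
  obtain ⟨p, hp, wp⟩ := h.2 k hk.le
  obtain ⟨q, hq, wq⟩ := h.2 (k + 1) hk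
  exact wp.exists_isContinuousRep wq hcd (hp.integrable (by norm_num)) (hq.integrable (by norm_num))

namespace IsContinuousRep
variable {k : ℕ} {c d : ℝ} {f p q : ℝ → ℂ}

theorem mono (h : IsContinuousRep k c d f p) {c' d' : ℝ} (hc : c ≤ c') (hd : d' ≤ d) :
    IsContinuousRep k c' d' f p :=
  ⟨h.1.mono (Icc_subset_Icc hc hd), h.2.mono hc hd⟩

/-- By continuity the representative equals a primitive of `q` everywhere on `[c, d]`, not just
almost everywhere, and `q` is continuous, so the fundamental theorem of calculus applies. -/
theorem hasDerivAt (hp : IsContinuousRep k c d f p) (hq : HasWeakDeriv (k + 1) c d f q)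
    (hqc : ContinuousOn q (Icc c d)) {x : ℝ} (hx : x ∈ Ioo c d) : HasDerivAt p (q x) x := by
  have hcd : c < d := hx.1.trans hx.2
  have hqi : IntegrableOn q (Ioo c d) := hqc.integrableOn_Icc.mono_set Ioo_subset_Icc_self
  obtain ⟨C, hC⟩ := (hp.2.of_succ hq).ae_eq_primitive hcd hp.integrableOn hqi
  have hqI : IntervalIntegrable q volume c d :=
    (intervalIntegrable_iff_integrableOn_Ioo_of_le hcd.le).2 hqi
  have hFc : ContinuousOn (fun x => C + ∫ t in c..x, q t) (Icc c d) := by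
    refine continuousOn_const.add ?_
    rw [← uIcc_of_le hcd.le]
    exact intervalIntegral.continuousOn_primitive_interval' hqI (by simp)
  have hpF : EqOn p (fun x => C + ∫ t in c..x, q t) (Icc c d) := by
    refine Measure.eqOn_Icc_of_ae_eq (μ := volume) hcd.ne ?_ hp.1 hFc
    rwa [← restrict_Ioo_eq_restrict_Icc]
  have hn : Icc c d ∈ nhds x := Icc_mem_nhds hx.1 hx.2
  have h1 : HasDerivAt (fun x => ∫ t in c..x, q t) (q x) x := by
    refine intervalIntegral.integral_hasDerivAt_right ?_ ?_ (hqc.continuousAt hn)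
    · exact hqI.mono_set (uIcc_subset_uIcc_left (by
        rw [uIcc_of_le hcd.le]; exact Ioo_subset_Icc_self hx))
    · exact (hqc.mono Ioo_subset_Icc_self).stronglyMeasurableAtFilter isOpen_Ioo x hx
  exact (h1.const_add C).congr_of_eventuallyEq (Filter.eventuallyEq_of_mem hn hpF)

theorem ae_eq (h : IsContinuousRep 0 c d f p) (hf : IntegrableOn f (Ioo c d)) :
    f =ᵐ[volume.restrict (Ioo c d)] p :=
  HasWeakDeriv.ae_unique (k := 0) (f := f) (fun φ _ _ _ => by simp) h.2 hf h.integrableOn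

end IsContinuousRep

/-! ### The graph of the operator away from the Dirac mass -/

theorem setIntegral_Ioo_eq_of_tsupport {c d c' d' : ℝ} (hc : c ≤ c') (hd : d' ≤ d) {ψ : ℝ → ℝ}
    (hψ : tsupport ψ ⊆ Ioo c' d') (F : ℝ → ℂ) :
    ∫ x in Ioo c d, ψ x • F x = ∫ x in Ioo c' d', ψ x • F x := by
  refine setIntegral_eq_of_subset_of_forall_sdiff_eq_zero measurableSet_Ioo
    (Ioo_subset_Ioo hc hd) ?_
  intro x hx
  rw [image_eq_zero_of_notMem_tsupport (fun hx' => hx.2 (hψ hx')), zero_smul]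

/-- Test functions supported in an interval that avoids `ξ` do not see the Dirac mass. -/
theorem IsBeamImage.hasWeakDeriv {a b α ξ : ℝ} {u v F : ℝ → ℂ} (h : IsBeamImage a b α ξ u v F)
    (ha : 0 < a) {c d : ℝ} (hc : 0 ≤ c) (hd : d ≤ 1) (hξ : ξ ∉ Ioo c d)
    (hv : IntegrableOn v (Ioo 0 1)) (hF : IntegrableOn F (Ioo 0 1)) :
    HasWeakDeriv 4 c d u (fun x => -(F x + b * v x) / a) := by
  obtain ⟨v₀, -, e⟩ := h
  intro φ h1 h2 h3
  have e' := e φ h1 h2 (h3.trans (Ioo_subset_Ioo hc hd))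
  have z : φ ξ = 0 := image_eq_zero_of_notMem_tsupport fun h' => hξ (h3 h')
  rw [z, setIntegral_Ioo_eq_of_tsupport hc hd h3, setIntegral_Ioo_eq_of_tsupport hc hd h3,
    setIntegral_Ioo_eq_of_tsupport hc hd
      ((tsupport_iteratedDeriv_subset' φ 4).trans h3)] at e'
  have hs := Ioo_subset_Ioo hc hd
  have i1 := integrable_smooth_smul (hF.mono_set hs) h1.continuous
  have i2 := integrable_smooth_smul (hv.mono_set hs) h1.continuous
  have ha' : (a : ℂ) ≠ 0 := by exact_mod_cast ha.ne'
  have e2 : ∫ x in Ioo c d, φ x • (-(F x + b * v x) / a) =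
      -(1 / (a : ℂ)) * (∫ x in Ioo c d, φ x • F x) + -((b : ℂ) / a) * ∫ x in Ioo c d, φ x • v x := by
    rw [← integral_const_mul, ← integral_const_mul,
      ← integral_add (i1.const_mul _) (i2.const_mul _)]
    congr 1
    ext x
    simp only [Complex.real_smul]
    field_simp
    ring
  rw [e2, e']
  simp only [zero_smul]
  field_simp
  ring

theorem ae_Ioo_of_ae_pieces {c ξ d : ℝ} {P : ℝ → Prop}
    (h1 : ∀ᵐ x ∂volume.restrict (Ioo c ξ), P x) (h2 : ∀ᵐ x ∂volume.restrict (Ioo ξ d), P x) :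
    ∀ᵐ x ∂volume.restrict (Ioo c d), P x := by
  rw [ae_restrict_iff' measurableSet_Ioo] at h1 h2 ⊢
  have h3 : ∀ᵐ x ∂(volume : Measure ℝ), x ≠ ξ := by
    simp [ae_iff]
  filter_upwards [h1, h2, h3] with x a1 a2 a3 hx
  rcases lt_or_gt_of_ne a3 with h | h
  · exact a1 ⟨hx.1, h⟩
  · exact a2 ⟨h, hx.2⟩

/-- The jump condition in `beamDomain` already accounts for the Dirac mass, so only the two
one-sided equations remain to be checked. -/
theorem mem_beamOperator_graph_iff {a b α : ℝ} (ha : 0 < a) {ξ : Ioo (0 : ℝ) 1}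
    {U W : energySpace} : (U, W) ∈ (beamOperator a b α ξ).graph ↔
      U ∈ beamDomain a α ξ ∧ W.1.1 = U.1.2 ∧
      HasWeakDeriv 4 0 ξ U.1.1 (fun x => -(W.1.2 x + b * U.1.2 x) / a) ∧
      HasWeakDeriv 4 ξ 1 U.1.1 (fun x => -(W.1.2 x + b * U.1.2 x) / a) := by
  have i (g : L2) := L2.integrableOn (c := 0) (d := 1) le_rfl le_rfl g
  have h0 : (0 : ℝ) ≤ ξ := ξ.2.1.le
  have h1 : (ξ : ℝ) ≤ 1 := ξ.2.2.le
  have fwd {U W : energySpace} (h : (U, W) ∈ (beamOperator a b α ξ).graph) :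
      U ∈ beamDomain a α ξ ∧ W.1.1 = U.1.2 ∧
      HasWeakDeriv 4 0 ξ U.1.1 (fun x => -(W.1.2 x + b * U.1.2 x) / a) ∧
      HasWeakDeriv 4 ξ 1 U.1.1 (fun x => -(W.1.2 x + b * U.1.2 x) / a) := by
    rw [beamOperator_graph] at h
    obtain ⟨k1, k2, k3⟩ := h
    exact ⟨k1, k2, k3.hasWeakDeriv ha le_rfl h1 (by simp) (i _) (i _),
      k3.hasWeakDeriv ha h0 le_rfl (by simp) (i _) (i _)⟩
  refine ⟨fwd, ?_⟩
  rintro ⟨k1, k2, k3, k4⟩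
  -- The operator is defined at `U`, and its value there satisfies the same one-sided equations as
  -- `W`. Uniqueness of weak derivatives then identifies the two.
  rw [← beamOperator_domain ha b α ξ] at k1
  have hg := (beamOperator a b α ξ).mem_graph ⟨U, k1⟩
  set W' := (beamOperator a b α ξ) ⟨U, k1⟩
  simp only at hg
  obtain ⟨-, l2, l3, l4⟩ := fwd hg
  have ig (g : energySpace) : IntegrableOn (fun x => -(g.1.2 x + b * U.1.2 x) / a) (Ioo 0 1) :=
    ((i g.1.2).add ((i U.1.2).const_mul (b : ℂ))).neg.div_const _
  have ha' : (a : ℂ) ≠ 0 := by exact_mod_cast ha.ne'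
  have hWW : W' = W := by
    refine Subtype.ext (Prod.ext (l2.trans k2.symm) (Lp.ext ?_))
    have sl := Ioo_subset_Ioo (le_refl (0 : ℝ)) h1
    have sr := Ioo_subset_Ioo h0 (le_refl (1 : ℝ))
    have el := l3.ae_unique k3 ((ig _).mono_set sl) ((ig _).mono_set sl)
    have er := l4.ae_unique k4 ((ig _).mono_set sr) ((ig _).mono_set sr)
    filter_upwards [ae_Ioo_of_ae_pieces el er] with x hx
    field_simp at hx
    linear_combination -hx
  rwa [hWW] at hg

/-! ### The classical transmission problem -/

/-- The functions `p 0, …, p 4` are continuous on `[0, c]`, each is the derivative of the previous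
one, and `p 0` solves `u'''' = Λ u + g` with hinged end `u(0) = u''(0) = 0`. -/
structure IsHingedSolution (c : ℝ) (Λ : ℂ) (g : ℝ → ℂ) (p : ℕ → ℝ → ℂ) : Prop where
  continuousOn : ∀ k ≤ 4, ContinuousOn (p k) (Icc 0 c)
  hasDerivAt : ∀ k < 4, ∀ x ∈ Ioo 0 c, HasDerivAt (p k) (p (k + 1) x) x
  zero : p 0 0 = 0
  two : p 2 0 = 0
  eqn : ∀ x ∈ Icc 0 c, p 4 x = Λ * p 0 x + g x

/-- Classical form of `(𝒜 - μ)(u, v) = (w, μ w)`: here `p` is the solution on `[0, ξ]` and `q` that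
on `[ξ, 1]` in the reflected variable `1 - x`, with the transmission conditions at `ξ`. -/
structure IsBeamSolution (a b α ξ : ℝ) (μ Λ : ℂ) (w : ℝ → ℂ) (p q : ℕ → ℝ → ℂ) : Prop where
  left : IsHingedSolution ξ Λ (fun x => -((2 * μ + b) / a * w x)) p
  right : IsHingedSolution (1 - ξ) Λ (fun x => -((2 * μ + b) / a * w (1 - x))) q
  match0 : p 0 ξ = q 0 (1 - ξ)
  match1 : p 1 ξ = -q 1 (1 - ξ)
  match2 : p 2 ξ = q 2 (1 - ξ)
  jump : a * (p 3 ξ + q 3 (1 - ξ)) = α * (μ * p 0 ξ + w ξ)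

/-- Elliptic regularity in one dimension: `u` and `w` have continuous representatives, so the weak
fourth derivative `Λ u - (2 μ + b) / a * w` is continuous on each piece and the lower derivatives
become classical. The source `W` allows one statement to serve eigenvectors (`W = 0`) and Jordan
chains of length two (`W` an eigenvector). -/
theorem exists_isBeamSolution {a b α : ℝ} (ha : 0 < a) {ξ : Ioo (0 : ℝ) 1} {μ Λ : ℂ}
    (hΛ : a * Λ = -(b * μ + μ ^ 2)) {U W : energySpace} {w : ℝ → ℂ}
    (h : (U, μ • U + W) ∈ (beamOperator a b α ξ).graph) (hW : W.1.2 = μ • W.1.1)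
    (hw : IsContinuousRep 0 0 1 W.1.1 w) :
    ∃ p q, IsBeamSolution a b α ξ μ Λ w p q ∧
      U.1.1 =ᵐ[volume.restrict (Ioo (0 : ℝ) ξ)] p 0 ∧
      U.1.1 =ᵐ[volume.restrict (Ioo (ξ : ℝ) 1)] fun x => q 0 (1 - x) := by
  rw [mem_beamOperator_graph_iff ha] at h
  obtain ⟨hU, hv, wl, wr⟩ := h
  obtain ⟨s1, s2, s3, s4, u₀, v₀, l₂, r₂, l₃, r₃, c1, c2, c3, c4, c5, c6, e1, e2, e3, e4,
    e5, e6, e7, e8⟩ := hU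
  have h0 := ξ.2.1
  have h1 := ξ.2.2
  obtain ⟨u₁, cu₁⟩ := s3.exists_isContinuousRep (k := 1) (by norm_num) one_pos
  obtain ⟨x, hx⟩ := ξ
  simp only at *
  have ha' : (a : ℂ) ≠ 0 := by exact_mod_cast ha.ne'
  have au : U.1.1 =ᵐ[volume.restrict (Ioo (0 : ℝ) 1)] u₀ := c1.ae_eq s3.integrableOn
  have aw : W.1.1 =ᵐ[volume.restrict (Ioo (0 : ℝ) 1)] w :=
    hw.ae_eq (L2.integrableOn le_rfl le_rfl _)
  have av : U.1.2 =ᵐ[volume.restrict (Ioo (0 : ℝ) 1)] fun t => μ * u₀ t + w t := by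
    rw [← hv]
    filter_upwards [L2.ae_add le_rfl le_rfl (μ • U.1.1) W.1.1, L2.ae_smul le_rfl le_rfl μ U.1.1,
      au, aw] with t a1 a2 a3 a4
    have a5 : (((μ • U + W : energySpace) : L2 × L2).1 : ℝ → ℂ) t =
      ((μ • U.1.1 + W.1.1 : L2) : ℝ → ℂ) t := rfl
    rw [a5, ← a1, Pi.add_apply, ← a2, Pi.smul_apply, a3, a4, smul_eq_mul]
  -- Substituting `v = μ u + w` into `-(μ v + μ w + b v) / a`: the terms in `w` add up to the factor
  -- `2 μ + b`, the derivative of `b μ + μ²` in `μ`.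
  have aF : (fun t => -((μ • U + W).1.2 t + b * U.1.2 t) / (a : ℂ))
      =ᵐ[volume.restrict (Ioo (0 : ℝ) 1)] fun t => Λ * u₀ t + -((2 * μ + b) / a * w t) := by
    filter_upwards [L2.ae_add le_rfl le_rfl (μ • U.1.2) (μ • W.1.1),
      L2.ae_smul le_rfl le_rfl μ U.1.2, L2.ae_smul le_rfl le_rfl μ W.1.1,
      av, aw] with t a1 a2 a3 a4 a6
    have a5 : (((μ • U + W : energySpace) : L2 × L2).2 : ℝ → ℂ) t =
      ((μ • U.1.2 + W.1.2 : L2) : ℝ → ℂ) t := rfl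
    rw [a5, hW, ← a1, Pi.add_apply, ← a2, ← a3, Pi.smul_apply, Pi.smul_apply, a4, a6,
      smul_eq_mul, smul_eq_mul]
    field_simp
    linear_combination (-u₀ t) * hΛ
  have ev0 : ∀ t ∈ Icc (0 : ℝ) 1, v₀ t = μ * u₀ t + w t := by
    refine (c2.congr_ae av).eqOn (f := fun t => μ * u₀ t + w t) ⟨?_, fun φ _ _ _ => by simp⟩ one_pos
    exact (continuousOn_const.mul c1.1).add hw.1
  have f4 : ContinuousOn (fun t => Λ * u₀ t + -((2 * μ + b) / a * w t)) (Icc 0 1) :=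
    (continuousOn_const.mul c1.1).add (continuousOn_const.mul hw.1).neg
  have ml := Measure.restrict_mono (μ := (volume : Measure ℝ)) (Ioo_subset_Ioo (le_refl (0 : ℝ)) h1.le) le_rfl
  have mr := Measure.restrict_mono (μ := (volume : Measure ℝ)) (Ioo_subset_Ioo h0.le (le_refl (1 : ℝ))) le_rfl
  have wl' := wl.congr_ae Filter.EventuallyEq.rfl (ae_mono ml aF)
  have wr' := wr.congr_ae Filter.EventuallyEq.rfl (ae_mono mr aF)
  have il := Icc_subset_Icc (le_refl (0 : ℝ)) h1.le
  have ir := Icc_subset_Icc h0.le (le_refl (1 : ℝ))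
  have maps : MapsTo (fun t : ℝ => 1 - t) (Icc 0 (1 - x)) (Icc x 1) := fun t ht =>
    ⟨by linarith [ht.2], by linarith [ht.1]⟩
  have refl_c {f : ℝ → ℂ} (hf : ContinuousOn f (Icc x 1)) :
      ContinuousOn (fun t => f (1 - t)) (Icc 0 (1 - x)) :=
    hf.comp (by fun_prop) maps
  have refl_d {f f' : ℝ → ℂ} (hf : ∀ t ∈ Ioo x 1, HasDerivAt f (f' t) t) :
      ∀ t ∈ Ioo 0 (1 - x), HasDerivAt (fun t => f (1 - t)) (-f' (1 - t)) t := fun t ht =>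
    HasDerivAt.comp_const_sub 1 t (hf (1 - t) ⟨by linarith [ht.2], by linarith [ht.1]⟩)
  have d0 : ∀ t ∈ Ioo (0 : ℝ) 1, HasDerivAt u₀ (u₁ t) t := fun t ht => c1.hasDerivAt cu₁.2 cu₁.1 ht
  let p : ℕ → ℝ → ℂ
    | 0 => u₀ | 1 => u₁ | 2 => l₂ | 3 => l₃
    | _ => fun t => Λ * u₀ t + -((2 * μ + b) / a * w t)
  -- Each derivative in the reflected variable `1 - x` brings a factor `-1`, hence the signs in odd
  -- order.
  let q : ℕ → ℝ → ℂ
    | 0 => fun t => u₀ (1 - t) | 1 => fun t => -u₁ (1 - t) | 2 => fun t => r₂ (1 - t)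
    | 3 => fun t => -r₃ (1 - t)
    | _ => fun t => Λ * u₀ (1 - t) + -((2 * μ + b) / a * w (1 - t))
  refine ⟨p, q, ⟨⟨?_, ?_, e1, e5, fun t ht => rfl⟩, ⟨?_, ?_, ?_, ?_, fun t ht => rfl⟩,
    ?_, ?_, ?_, ?_⟩, ae_mono ml au, ?_⟩
  · intro k hk
    interval_cases k
    exacts [c1.1.mono il, cu₁.1.mono il, c3.1, c5.1, f4.mono il]
  · intro k hk
    interval_cases k
    · exact fun t ht => d0 t ⟨ht.1, ht.2.trans h1⟩
    · exact fun t ht => (cu₁.mono le_rfl h1.le).hasDerivAt c3.2 c3.1 ht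
    · exact fun t ht => c3.hasDerivAt c5.2 c5.1 ht
    · exact fun t ht => c5.hasDerivAt wl' (f4.mono il) ht
  · intro k hk
    interval_cases k
    exacts [refl_c (c1.1.mono ir), (refl_c (cu₁.1.mono ir)).neg, refl_c c4.1, (refl_c c6.1).neg,
      refl_c (f4.mono ir)]
  · intro k hk
    interval_cases k
    · exact refl_d fun t ht => d0 t ⟨h0.trans ht.1, ht.2⟩
    · intro t ht
      have := (refl_d (fun t ht => (cu₁.mono h0.le le_rfl).hasDerivAt c4.2 c4.1 ht) t ht).neg
      rwa [neg_neg] at this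
    · exact refl_d fun t ht => c4.hasDerivAt c6.2 c6.1 ht
    · intro t ht
      have := (refl_d (fun t ht => c6.hasDerivAt wr' (f4.mono ir) ht) t ht).neg
      rwa [neg_neg] at this
  · simp [q, e3]
  · simp [q, e6]
  · simp [p, q]
  · simp [p, q]
  · simp [p, q, e7]
  · simp only [p, q, sub_sub_cancel]
    rw [ev0 x ⟨h0.le, h1.le⟩] at e8
    push_cast at e8
    field_simp at e8
    linear_combination -e8
  · filter_upwards [ae_mono mr au] with t ht
    simp [q, ht]

theorem ContinuousOn.memLp_Ioo {c d : ℝ} {f : ℝ → ℂ} (hf : ContinuousOn f (Icc c d)) :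
    MemLp f 2 (volume.restrict (Ioo c d)) := by
  obtain ⟨C, hC⟩ := (isCompact_Icc (a := c) (b := d)).exists_bound_of_continuousOn hf
  refine MemLp.of_bound ((hf.mono Ioo_subset_Icc_self).aestronglyMeasurable measurableSet_Ioo) C ?_
  filter_upwards [ae_restrict_mem measurableSet_Ioo] with x hx using hC x (Ioo_subset_Icc_self hx)

theorem isContinuousRep_of_hasDerivAt {c d : ℝ} (hcd : c ≤ d) {s : Set ℝ} (hs : s.Countable)
    {m : ℕ} {f : ℕ → ℝ → ℂ} (hc : ∀ k ≤ m, ContinuousOn (f k) (Icc c d))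
    (hd : ∀ k < m, ∀ x ∈ Ioo c d \ s, HasDerivAt (f k) (f (k + 1) x) x) :
    ∀ k ≤ m, IsContinuousRep k c d (f 0) (f k) := by
  intro k
  induction k with
  | zero => exact fun _ => ⟨hc 0 (Nat.zero_le _), fun φ _ _ _ => by simp⟩
  | succ k ih =>
    intro hk
    exact ⟨hc _ hk, (ih (by omega)).2.trans (.of_hasDerivAt hcd hs (hc k (by omega)) (hd k hk)
      ((hc _ hk).integrableOn_Icc.mono_set Ioo_subset_Icc_self))⟩

theorem memSobolev_of_isContinuousRep {c d : ℝ} {m : ℕ} {f : ℝ → ℂ} {g : ℕ → ℝ → ℂ}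
    (hf : MemLp f 2 (volume.restrict (Ioo c d))) (h : ∀ k ≤ m, IsContinuousRep k c d f (g k)) :
    MemSobolev m c d f :=
  ⟨hf, fun k hk => ⟨g k, (h k hk).1.memLp_Ioo, (h k hk).2⟩⟩

/-- The two classical pieces are glued at `ξ`. Matching up to second order makes the glued function
belong to `H²(0, 1)`, and the jump of the third derivative is the domain condition. -/
theorem IsBeamSolution.exists_eigenvector {a b α : ℝ} (ha : 0 < a) {ξ : Ioo (0 : ℝ) 1} {μ Λ : ℂ}
    (hΛ : a * Λ = -(b * μ + μ ^ 2)) {p q : ℕ → ℝ → ℂ}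
    (h : IsBeamSolution a b α ξ μ Λ 0 p q) :
    ∃ U : energySpace, (U, μ • U) ∈ (beamOperator a b α ξ).graph ∧
      U.1.1 =ᵐ[volume.restrict (Ioo (0 : ℝ) ξ)] p 0 ∧
      U.1.1 =ᵐ[volume.restrict (Ioo (ξ : ℝ) 1)] fun x => q 0 (1 - x) := by
  have h0 := ξ.2.1
  have h1 := ξ.2.2
  obtain ⟨hl, hr, m0, m1, m2, hj⟩ := h
  have ha' : (a : ℂ) ≠ 0 := by exact_mod_cast ha.ne'
  let r : ℕ → ℝ → ℂ := fun k x => (-1) ^ k * q k (1 - x)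
  have rc : ∀ k ≤ 4, ContinuousOn (r k) (Icc ξ 1) := fun k hk =>
    continuousOn_const.mul ((hr.continuousOn k hk).comp (by fun_prop) fun t ht =>
      ⟨by linarith [ht.2], by linarith [ht.1]⟩)
  have rd : ∀ k < 4, ∀ x ∈ Ioo (ξ : ℝ) 1, HasDerivAt (r k) (r (k + 1) x) x := by
    intro k hk x hx
    have := (HasDerivAt.comp_const_sub 1 x
      (hr.hasDerivAt k hk (1 - x) ⟨by linarith [hx.2], by linarith [hx.1]⟩)).const_mul ((-1 : ℂ) ^ k)
    refine HasDerivAt.congr_deriv (f := r k) this ?_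
    simp only [r, pow_succ]; ring
  let G : ℕ → ℝ → ℂ := fun k x => if x ≤ ξ then p k x else r k x
  have Gl (k) : EqOn (G k) (p k) (Icc 0 ξ) := fun x hx => if_pos hx.2
  have Gr (k) : EqOn (G k) (r k) (Ioc ξ 1) := fun x hx => if_neg (not_le.2 hx.1)
  -- At `ξ` itself the glued function takes the left value. The matching conditions identify it with
  -- the right value only up to order two.
  have Gr' (k) (hk : k ≤ 2) : EqOn (G k) (r k) (Icc ξ 1) := by
    intro x hx
    rcases hx.1.eq_or_lt with h | h
    · subst h
      rw [Gl k ⟨h0.le, le_rfl⟩]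
      interval_cases k <;> simp [r, *]
    · exact Gr k ⟨h, hx.2⟩
  have Gc : ∀ k ≤ 2, ContinuousOn (G k) (Icc 0 1) := by
    intro k hk
    have e : Icc (0 : ℝ) 1 = Icc 0 (ξ : ℝ) ∪ Icc (ξ : ℝ) 1 := (Icc_union_Icc_eq_Icc h0.le h1.le).symm
    rw [e]
    exact ContinuousOn.union_of_isClosed ((hl.continuousOn k (by omega)).congr (Gl k))
      ((rc k (by omega)).congr (Gr' k hk)) isClosed_Icc isClosed_Icc
  have Gd : ∀ k < 2, ∀ x ∈ Ioo (0 : ℝ) 1 \ {(ξ : ℝ)}, HasDerivAt (G k) (G (k + 1) x) x := by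
    rintro k hk x ⟨hx, hxξ⟩
    rcases lt_or_gt_of_ne (show x ≠ ξ from hxξ) with h | h
    · rw [Gl (k + 1) ⟨hx.1.le, h.le⟩]
      exact (hl.hasDerivAt k (by omega) x ⟨hx.1, h⟩).congr_of_eventuallyEq
        (Filter.eventuallyEq_of_mem (Icc_mem_nhds hx.1 h) (Gl k))
    · rw [Gr (k + 1) ⟨h, hx.2.le⟩]
      exact (rd k (by omega) x ⟨h, hx.2⟩).congr_of_eventuallyEq
        (Filter.eventuallyEq_of_mem (Ioc_mem_nhds h hx.2) (Gr k))
  have RG := isContinuousRep_of_hasDerivAt zero_le_one (countable_singleton (ξ : ℝ)) Gc Gd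
  have Rl := isContinuousRep_of_hasDerivAt h0.le countable_empty hl.continuousOn
    (fun k hk x hx => hl.hasDerivAt k hk x hx.1)
  have Rr := isContinuousRep_of_hasDerivAt h1.le countable_empty rc
    (fun k hk x hx => rd k hk x hx.1)
  have hG : MemLp (G 0) 2 (volume.restrict (Ioo 0 1)) := (Gc 0 (by norm_num)).memLp_Ioo
  set u : L2 := hG.toLp _ with hu
  have au : (G 0) =ᵐ[volume.restrict (Ioo (0 : ℝ) 1)] u := hG.coeFn_toLp.symm
  have ml := Measure.restrict_mono (μ := (volume : Measure ℝ))
    (Ioo_subset_Ioo (le_refl (0 : ℝ)) h1.le) le_rfl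
  have mr := Measure.restrict_mono (μ := (volume : Measure ℝ))
    (Ioo_subset_Ioo h0.le (le_refl (1 : ℝ))) le_rfl
  have al : p 0 =ᵐ[volume.restrict (Ioo (0 : ℝ) ξ)] u := by
    filter_upwards [ae_mono ml au, ae_restrict_mem measurableSet_Ioo] with t ht ht'
    rw [← ht, Gl 0 (Ioo_subset_Icc_self ht')]
  have ar : r 0 =ᵐ[volume.restrict (Ioo (ξ : ℝ) 1)] u := by
    filter_upwards [ae_mono mr au, ae_restrict_mem measurableSet_Ioo] with t ht ht'
    rw [← ht, Gr 0 (Ioo_subset_Ioc_self ht')]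
  have RG' := fun k hk => (RG k hk).congr_ae au
  have Rl' := fun k hk => (Rl k hk).congr_ae al
  have Rr' := fun k hk => (Rr k hk).congr_ae ar
  have SG := (memSobolev_of_isContinuousRep hG RG).congr_ae au
  have Sl := (memSobolev_of_isContinuousRep (hl.continuousOn 0 (by norm_num)).memLp_Ioo Rl).congr_ae al
  have Sr := (memSobolev_of_isContinuousRep (rc 0 (by norm_num)).memLp_Ioo Rr).congr_ae ar
  have av := L2.ae_smul (c := 0) (d := 1) le_rfl le_rfl μ u
  have G00 : G 0 0 = 0 := by rw [Gl 0 ⟨le_rfl, h0.le⟩, hl.zero]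
  have G01 : G 0 1 = 0 := by rw [Gr 0 ⟨h1, le_rfl⟩]; simp [r, hr.zero]
  have hU : MemH2H10 u := ⟨SG, G 0, RG' 0 (by norm_num), G00, G01⟩
  refine ⟨⟨(u, μ • u), hU⟩, ?_, al.symm, ?_⟩
  · rw [mem_beamOperator_graph_iff ha]
    refine ⟨⟨Sl, Sr, SG, (SG.const_smul μ).congr_ae av, G 0, μ • G 0, p 2, r 2, p 3, r 3,
      RG' 0 (by norm_num), ((RG' 0 (by norm_num)).const_smul μ).congr_ae av,
      Rl' 2 (by norm_num), Rr' 2 (by norm_num), Rl' 3 (by norm_num), Rr' 3 (by norm_num),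
      G00, by simp [G00], G01, by simp [G01], hl.two, by simp [r, hr.two], by simp [r, m2], ?_⟩,
      rfl, ?_, ?_⟩
    · simp only [r, Pi.smul_apply, smul_eq_mul]
      rw [Gl 0 ⟨h0.le, le_rfl⟩]
      simp only [Pi.zero_apply, add_zero] at hj
      push_cast
      field_simp
      linear_combination -hj
    · refine (Rl' 4 le_rfl).2.congr_ae Filter.EventuallyEq.rfl ?_
      filter_upwards [al, ae_mono ml (L2.ae_smul le_rfl le_rfl μ u),
        ae_mono ml (L2.ae_smul le_rfl le_rfl μ (μ • u)), ae_restrict_mem measurableSet_Ioo]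
        with t a1 a2 a3 ht
      have e : (((μ • (⟨(u, μ • u), hU⟩ : energySpace) : energySpace) : L2 × L2).2 : ℝ → ℂ) t
        = ((μ • (μ • u) : L2) : ℝ → ℂ) t := rfl
      rw [hl.eqn t (Ioo_subset_Icc_self ht), e, ← a3, Pi.smul_apply]
      rw [← a2, Pi.smul_apply, ← a1]
      simp only [Pi.zero_apply, smul_eq_mul]
      field_simp
      linear_combination p 0 t * hΛ
    · refine (Rr' 4 le_rfl).2.congr_ae Filter.EventuallyEq.rfl ?_
      filter_upwards [ar, ae_mono mr (L2.ae_smul le_rfl le_rfl μ u),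
        ae_mono mr (L2.ae_smul le_rfl le_rfl μ (μ • u)), ae_restrict_mem measurableSet_Ioo]
        with t a1 a2 a3 ht
      have e : (((μ • (⟨(u, μ • u), hU⟩ : energySpace) : energySpace) : L2 × L2).2 : ℝ → ℂ) t
        = ((μ • (μ • u) : L2) : ℝ → ℂ) t := rfl
      have e4 : r 4 t = Λ * r 0 t := by
        simp only [r]
        rw [hr.eqn (1 - t) ⟨by linarith [ht.2], by linarith [ht.1]⟩]
        simp only [Pi.zero_apply]
        ring
      rw [e4, e, ← a3, Pi.smul_apply]
      rw [← a2, Pi.smul_apply, ← a1]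
      simp only [smul_eq_mul]
      field_simp
      linear_combination r 0 t * hΛ
  · filter_upwards [ar] with t ht
    rw [← ht]; simp [r]

/-! ### Explicit solutions with a hinged end -/

theorem eqOn_const_of_hasDerivAt_zero {c : ℝ} {f : ℝ → ℂ} (hf : ContinuousOn f (Icc 0 c))
    (hd : ∀ x ∈ Ioo 0 c, HasDerivAt f 0 x) : ∀ x ∈ Icc 0 c, f x = f 0 := by
  intro x hx
  have := integral_eq_of_hasDerivAt_off_countable_of_le f (fun _ => 0) hx.1 countable_empty
    (hf.mono (Icc_subset_Icc_right hx.2)) (fun t ht => hd t ⟨ht.1.1, ht.1.2.trans_le hx.2⟩) (by simp)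
  simp only [intervalIntegral.integral_zero] at this
  exact (sub_eq_zero.1 this.symm)

theorem hasDerivAt_sinh_mul_ofReal (l : ℂ) (x : ℝ) :
    HasDerivAt (fun x : ℝ => Complex.sinh (l * x)) (l * Complex.cosh (l * x)) x := by
  have h := ((hasDerivAt_id (x : ℂ)).const_mul l).csinh.comp_ofReal
  simpa [mul_comm] using h

theorem hasDerivAt_cosh_mul_ofReal (l : ℂ) (x : ℝ) :
    HasDerivAt (fun x : ℝ => Complex.cosh (l * x)) (l * Complex.sinh (l * x)) x := by
  have h := ((hasDerivAt_id (x : ℂ)).const_mul l).ccosh.comp_ofReal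
  simpa [mul_comm] using h

theorem hasDerivAt_sin_mul_ofReal (l : ℂ) (x : ℝ) :
    HasDerivAt (fun x : ℝ => Complex.sin (l * x)) (l * Complex.cos (l * x)) x := by
  have h := ((hasDerivAt_id (x : ℂ)).const_mul l).csin.comp_ofReal
  simpa [mul_comm] using h

theorem hasDerivAt_cos_mul_ofReal (l : ℂ) (x : ℝ) :
    HasDerivAt (fun x : ℝ => Complex.cos (l * x)) (-(l * Complex.sin (l * x))) x := by
  have h := ((hasDerivAt_id (x : ℂ)).const_mul l).ccos.comp_ofReal
  simpa [mul_comm] using h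

/-- The solutions of `f'' = l² f` vanishing at `0`. -/
theorem eq_sinh_of_hasDerivAt {c : ℝ} {l : ℂ} (hl : l ≠ 0) {f f' : ℝ → ℂ}
    (hf : ContinuousOn f (Icc 0 c)) (hf' : ContinuousOn f' (Icc 0 c))
    (hd : ∀ x ∈ Ioo 0 c, HasDerivAt f (f' x) x)
    (hd' : ∀ x ∈ Ioo 0 c, HasDerivAt f' (l ^ 2 * f x) x) (h0 : f 0 = 0) :
    ∃ K : ℂ, ∀ x ∈ Icc 0 c, f x = K * Complex.sinh (l * x) ∧
      f' x = K * (l * Complex.cosh (l * x)) := by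
  have cs : Continuous fun x : ℝ => Complex.sinh (l * x) := by fun_prop
  have cc : Continuous fun x : ℝ => Complex.cosh (l * x) := by fun_prop
  -- `E1` and `E2` are two first integrals, linear in `f` and `f'`. The system has determinant
  -- proportional to `cosh² - sinh² = 1`, so it can be solved for `f` and `f'` without assuming a
  -- solution formula.
  have E1 := eqOn_const_of_hasDerivAt_zero
    (f := fun x => f' x * Complex.cosh (l * x) - l * f x * Complex.sinh (l * x))
    ((hf'.mul cc.continuousOn).sub ((continuousOn_const.mul hf).mul cs.continuousOn))
    (fun x hx => by
      have := ((hd' x hx).mul (hasDerivAt_cosh_mul_ofReal l x)).sub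
        (((hd x hx).const_mul l).mul (hasDerivAt_sinh_mul_ofReal l x))
      refine this.congr_deriv ?_
      ring)
  have E2 := eqOn_const_of_hasDerivAt_zero
    (f := fun x => f' x * Complex.sinh (l * x) - l * f x * Complex.cosh (l * x))
    ((hf'.mul cs.continuousOn).sub ((continuousOn_const.mul hf).mul cc.continuousOn))
    (fun x hx => by
      have := ((hd' x hx).mul (hasDerivAt_sinh_mul_ofReal l x)).sub
        (((hd x hx).const_mul l).mul (hasDerivAt_cosh_mul_ofReal l x))
      refine this.congr_deriv ?_
      ring)
  refine ⟨f' 0 / l, fun x hx => ?_⟩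
  have e1 := E1 x hx
  have e2 := E2 x hx
  simp only [h0, Complex.ofReal_zero, mul_zero, Complex.cosh_zero, Complex.sinh_zero, mul_one,
    sub_zero] at e1 e2
  have e3 := Complex.cosh_sq_sub_sinh_sq (l * x)
  constructor
  · field_simp
    linear_combination Complex.sinh (l * x) * e1 - Complex.cosh (l * x) * e2 - l * f x * e3
  · field_simp
    linear_combination Complex.cosh (l * x) * e1 - Complex.sinh (l * x) * e2 - f' x * e3

/-- The function `A sinh(l x) + B sin(l x)` and its derivatives. -/
noncomputable def hingedSol (l A B : ℂ) : ℕ → ℝ → ℂ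
  | 0 => fun x => A * Complex.sinh (l * x) + B * Complex.sin (l * x)
  | 1 => fun x => l * (A * Complex.cosh (l * x) + B * Complex.cos (l * x))
  | 2 => fun x => l ^ 2 * (A * Complex.sinh (l * x) - B * Complex.sin (l * x))
  | 3 => fun x => l ^ 3 * (A * Complex.cosh (l * x) - B * Complex.cos (l * x))
  | _ => fun x => l ^ 4 * (A * Complex.sinh (l * x) + B * Complex.sin (l * x))

theorem isHingedSolution_hingedSol (c : ℝ) (l A B : ℂ) {g : ℝ → ℂ} (hg : ∀ x, g x = 0) :
    IsHingedSolution c (l ^ 4) g (hingedSol l A B) := by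
  refine ⟨?_, ?_, by simp [hingedSol], by simp [hingedSol], fun x _ => by simp [hingedSol, hg]⟩
  · intro k hk
    refine Continuous.continuousOn ?_
    interval_cases k <;> unfold hingedSol <;> fun_prop
  · intro k hk x _
    have h1 := hasDerivAt_sinh_mul_ofReal l x
    have h2 := hasDerivAt_cosh_mul_ofReal l x
    have h3 := hasDerivAt_sin_mul_ofReal l x
    have h4 := hasDerivAt_cos_mul_ofReal l x
    interval_cases k
    · exact ((h1.const_mul A).add (h3.const_mul B)).congr_deriv (by simp only [hingedSol]; ring)
    · exact (((h2.const_mul A).add (h4.const_mul B)).const_mul l).congr_deriv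
        (by simp only [hingedSol]; ring)
    · exact (((h1.const_mul A).sub (h3.const_mul B)).const_mul (l ^ 2)).congr_deriv
        (by simp only [hingedSol]; ring)
    · exact (((h2.const_mul A).sub (h4.const_mul B)).const_mul (l ^ 3)).congr_deriv
        (by simp only [hingedSol]; ring)

/-- The operator factors as `∂⁴ - l⁴ = (∂² - l²)(∂² + l²)`. Thus `p'' + l² p` solves `f'' = l² f`
and `p'' - l² p` solves `f'' = (i l)² f`. Both vanish at `0` by the hinged condition, and their
difference recovers `p`. -/
theorem IsHingedSolution.exists_eq_hingedSol {c : ℝ} {l : ℂ} (hl : l ≠ 0) {g : ℝ → ℂ}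
    (hg : ∀ x, g x = 0) {p : ℕ → ℝ → ℂ} (h : IsHingedSolution c (l ^ 4) g p) :
    ∃ A B, ∀ k < 4, EqOn (p k) (hingedSol l A B k) (Icc 0 c) := by
  have C := h.continuousOn
  have D := h.hasDerivAt
  obtain ⟨K, hK⟩ := eq_sinh_of_hasDerivAt hl (f := fun x => p 2 x + l ^ 2 * p 0 x)
    (f' := fun x => p 3 x + l ^ 2 * p 1 x)
    ((C 2 (by norm_num)).add (continuousOn_const.mul (C 0 (by norm_num))))
    ((C 3 (by norm_num)).add (continuousOn_const.mul (C 1 (by norm_num))))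
    (fun x hx => (D 2 (by norm_num) x hx).add ((D 0 (by norm_num) x hx).const_mul _))
    (fun x hx => ((D 3 (by norm_num) x hx).add ((D 1 (by norm_num) x hx).const_mul _)).congr_deriv
      (by rw [h.eqn x (Ioo_subset_Icc_self hx), hg]; ring))
    (by simp [h.zero, h.two])
  obtain ⟨J, hJ⟩ := eq_sinh_of_hasDerivAt (l := l * Complex.I) (mul_ne_zero hl Complex.I_ne_zero)
    (f := fun x => p 2 x - l ^ 2 * p 0 x) (f' := fun x => p 3 x - l ^ 2 * p 1 x)
    ((C 2 (by norm_num)).sub (continuousOn_const.mul (C 0 (by norm_num))))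
    ((C 3 (by norm_num)).sub (continuousOn_const.mul (C 1 (by norm_num))))
    (fun x hx => (D 2 (by norm_num) x hx).sub ((D 0 (by norm_num) x hx).const_mul _))
    (fun x hx => ((D 3 (by norm_num) x hx).sub ((D 1 (by norm_num) x hx).const_mul _)).congr_deriv
      (by rw [h.eqn x (Ioo_subset_Icc_self hx), hg, mul_pow, Complex.I_sq]; ring))
    (by simp [h.zero, h.two])
  refine ⟨K / (2 * l ^ 2), -(J * Complex.I) / (2 * l ^ 2), fun k hk x hx => ?_⟩
  obtain ⟨a1, a2⟩ := hK x hx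
  obtain ⟨b1, b2⟩ := hJ x hx
  rw [mul_right_comm, Complex.sinh_mul_I] at b1
  rw [mul_right_comm l Complex.I (x : ℂ), Complex.cosh_mul_I] at b2
  interval_cases k <;> simp only [hingedSol] <;> field_simp
  · linear_combination a1 - b1
  · refine mul_left_cancel₀ hl ?_
    linear_combination a2 - b2
  · linear_combination a1 + b1
  · linear_combination a2 + b2

/-- Green's identity for the symmetric operator `∂⁴ - Λ`. The boundary terms at `0` vanish because
both functions have a hinged end there. -/
theorem IsHingedSolution.integral_mul_eq {c : ℝ} (hc : 0 ≤ c) {Λ : ℂ} {g g₀ : ℝ → ℂ}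
    (hg₀ : ∀ x, g₀ x = 0) {P p : ℕ → ℝ → ℂ} (hP : IsHingedSolution c Λ g P)
    (hp : IsHingedSolution c Λ g₀ p) :
    ∫ x in (0 : ℝ)..c, p 0 x * g x =
      p 0 c * P 3 c - p 1 c * P 2 c + p 2 c * P 1 c - p 3 c * P 0 c := by
  have C := hP.continuousOn
  have D := hP.hasDerivAt
  have C' := hp.continuousOn
  have D' := hp.hasDerivAt
  have key := integral_eq_of_hasDerivAt_off_countable_of_le
    (fun x => p 0 x * P 3 x - p 1 x * P 2 x + p 2 x * P 1 x - p 3 x * P 0 x)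
    (fun x => p 0 x * P 4 x - p 4 x * P 0 x) hc countable_empty
    (((((C' 0 (by norm_num)).mul (C 3 (by norm_num))).sub
      ((C' 1 (by norm_num)).mul (C 2 (by norm_num)))).add
      ((C' 2 (by norm_num)).mul (C 1 (by norm_num)))).sub
      ((C' 3 (by norm_num)).mul (C 0 (by norm_num))))
    (fun x hx => (((((D' 0 (by norm_num) x hx.1).mul (D 3 (by norm_num) x hx.1)).sub
      ((D' 1 (by norm_num) x hx.1).mul (D 2 (by norm_num) x hx.1))).add
      ((D' 2 (by norm_num) x hx.1).mul (D 1 (by norm_num) x hx.1))).sub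
      ((D' 3 (by norm_num) x hx.1).mul (D 0 (by norm_num) x hx.1))).congr_deriv (by ring))
    (ContinuousOn.intervalIntegrable (by
      rw [uIcc_of_le hc]
      exact ((C' 0 (by norm_num)).mul (C 4 (by norm_num))).sub
        ((C' 4 (by norm_num)).mul (C 0 (by norm_num)))))
  rw [hp.zero, hp.two, hP.zero, hP.two] at key
  simp only [mul_zero, zero_mul, sub_zero, add_zero] at key
  rw [← key]
  refine intervalIntegral.integral_congr fun x hx => ?_
  rw [uIcc_of_le hc] at hx
  simp only [hP.eqn x hx, hp.eqn x hx, hg₀]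
  ring

/-! ### Irrationality of `ξ` and the characteristic equation -/

/-- If both sines vanished, then `l = n π` and `l ξ = m π` with `n ≠ 0`, so `n ξ = m`, contradicting
irrationality. -/
theorem sin_mul_ne_zero_of_sin_eq_zero {ξ : ℝ} (hξ : Irrational ξ) {l : ℂ} (hl : l ≠ 0)
    (h : Complex.sin l = 0) : Complex.sin (l * ξ) ≠ 0 := by
  intro h'
  obtain ⟨n, rfl⟩ := Complex.sin_eq_zero_iff.1 h
  obtain ⟨m, hm⟩ := Complex.sin_eq_zero_iff.1 h'
  have hn : n ≠ 0 := by rintro rfl; simp at hl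
  have hπ : (Real.pi : ℂ) ≠ 0 := by exact_mod_cast Real.pi_ne_zero
  have e : (n : ℂ) * ξ = m := mul_right_cancel₀ hπ (by linear_combination hm)
  have e' : (n : ℝ) * ξ = m := by exact_mod_cast e
  refine (hξ.intCast_mul hn).ne_int m e'

theorem sin_mul_ne_zero_or {ξ : ℝ} (hξ : Irrational ξ) {l : ℂ} (hl : l ≠ 0) :
    Complex.sin (l * ξ) ≠ 0 ∨ Complex.sin (l * (1 - ξ : ℝ)) ≠ 0 := by
  by_contra! h
  have : Complex.sin l = 0 := by
    have e : l = l * ξ + l * (1 - ξ : ℝ) := by push_cast; ring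
    rw [e, Complex.sin_add, h.1, h.2]; ring
  exact sin_mul_ne_zero_of_sin_eq_zero hξ hl this h.1

theorem sinh_mul_ne_zero_or {ξ : ℝ} (hξ : Irrational ξ) {l : ℂ} (hl : l ≠ 0) :
    Complex.sinh (l * ξ) ≠ 0 ∨ Complex.sinh (l * (1 - ξ : ℝ)) ≠ 0 := by
  have e (r : ℝ) : Complex.sinh (l * r) = 0 ↔ Complex.sin (l * Complex.I * r) = 0 := by
    rw [mul_right_comm, Complex.sin_mul_I]; simp
  simp only [ne_eq, e]
  exact sin_mul_ne_zero_or hξ (mul_ne_zero hl Complex.I_ne_zero)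

/-- The zeros of `sin` are real and those of `sinh` are imaginary, so only `0` is common to both. -/
theorem sinh_ne_zero_or_sin_ne_zero {l : ℂ} (hl : l ≠ 0) :
    Complex.sinh l ≠ 0 ∨ Complex.sin l ≠ 0 := by
  by_contra! h
  obtain ⟨n, hn⟩ := Complex.sin_eq_zero_iff.1 h.2
  have h' : Complex.sin (l * Complex.I) = 0 := by rw [Complex.sin_mul_I, h.1, zero_mul]
  obtain ⟨m, hm⟩ := Complex.sin_eq_zero_iff.1 h'
  have e1 : l.im = 0 := by simp [hn]
  have e2 : l.re = 0 := by
    have := congrArg Complex.im hm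
    simpa using this
  exact hl (Complex.ext e2 e1)

/-- This allows the transmission conditions to be solved without deciding which of the two
coefficients is nonzero. -/
theorem exists_eq_mul_of_mul_eq_mul {A C s t : ℂ} (h : A * s = C * t) (hst : s ≠ 0 ∨ t ≠ 0) :
    ∃ k, A = k * t ∧ C = k * s := by
  by_cases ht : t = 0
  · subst ht
    have hs : s ≠ 0 := by simpa using hst
    have hA : A = 0 := by simpa [hs] using h
    exact ⟨C / s, by simp [hA], by field_simp⟩
  · exact ⟨A / t, by field_simp, by field_simp; linear_combination -h⟩

/-- The characteristic equation of the beam operator. -/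
def BeamCharEq (a α ξ : ℝ) (μ l : ℂ) : Prop :=
  2 * a * l ^ 3 * (Complex.sinh l * Complex.sin l) =
    α * μ * (Complex.sin l * (Complex.sinh (l * ξ) * Complex.sinh (l * (1 - ξ : ℝ))) -
      Complex.sinh l * (Complex.sin (l * ξ) * Complex.sin (l * (1 - ξ : ℝ))))

/-- The part on `[0, ξ]` of the eigenfunctions, up to a factor, with its derivatives. The part on
`[ξ, 1]` is `beamMode (1 - ξ) l` in the variable `1 - x`. -/
noncomputable def beamMode (ξ : ℝ) (l : ℂ) : ℕ → ℝ → ℂ :=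
  hingedSol l (Complex.sin l * Complex.sinh (l * (1 - ξ : ℝ)))
    (-(Complex.sinh l * Complex.sin (l * (1 - ξ : ℝ))))

theorem hingedSol_mul (l k A B : ℂ) (j : ℕ) (x : ℝ) :
    hingedSol l (k * A) (k * B) j x = k * hingedSol l A B j x := by
  rcases j with _ | _ | _ | _ | j <;> simp only [hingedSol] <;> ring

/-- Four coefficients face four conditions: the first three leave a single factor `k`, and the jump
condition is `k` times the characteristic equation. -/
theorem IsBeamSolution.exists_eq_beamMode {a b α ξ : ℝ} (hξ : Irrational ξ) (h0 : 0 < ξ)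
    (h1 : ξ < 1) {μ l : ℂ} (hl : l ≠ 0) {p q : ℕ → ℝ → ℂ}
    (h : IsBeamSolution a b α ξ μ (l ^ 4) 0 p q) :
    ∃ k, (∀ j < 4, ∀ x ∈ Icc 0 ξ, p j x = k * beamMode ξ l j x) ∧
      (∀ j < 4, ∀ x ∈ Icc 0 (1 - ξ), q j x = k * beamMode (1 - ξ) l j x) ∧
      (k = 0 ∨ BeamCharEq a α ξ μ l) := by
  obtain ⟨hp, hq, m0, m1, m2, hj⟩ := h
  obtain ⟨A, B, eA⟩ := hp.exists_eq_hingedSol hl (by simp)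
  obtain ⟨C, D, eC⟩ := hq.exists_eq_hingedSol hl (by simp)
  have i0 : ξ ∈ Icc 0 ξ := ⟨h0.le, le_rfl⟩
  have i1 : 1 - ξ ∈ Icc 0 (1 - ξ) := ⟨by linarith, le_rfl⟩
  rw [eA 0 (by norm_num) i0, eC 0 (by norm_num) i1] at m0
  rw [eA 1 (by norm_num) i0, eC 1 (by norm_num) i1] at m1
  rw [eA 2 (by norm_num) i0, eC 2 (by norm_num) i1] at m2
  rw [eA 3 (by norm_num) i0, eC 3 (by norm_num) i1, eA 0 (by norm_num) i0] at hj
  simp only [hingedSol, Pi.zero_apply, add_zero] at m0 m1 m2 hj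
  rw [← mul_neg] at m1
  have m1' := mul_left_cancel₀ hl m1
  have m2' := mul_left_cancel₀ (pow_ne_zero 2 hl) m2
  -- Half the sum of the conditions of orders zero and two isolates the `sinh` parts; half the
  -- difference isolates the `sin` parts.
  obtain ⟨s, hsA, hsC⟩ := exists_eq_mul_of_mul_eq_mul
    (A := A) (C := C) (s := Complex.sinh (l * ξ)) (t := Complex.sinh (l * (1 - ξ : ℝ)))
    (by linear_combination (m0 + m2') / 2) (sinh_mul_ne_zero_or hξ hl)
  obtain ⟨t, htB, htD⟩ := exists_eq_mul_of_mul_eq_mul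
    (A := B) (C := D) (s := Complex.sin (l * ξ)) (t := Complex.sin (l * (1 - ξ : ℝ)))
    (by linear_combination (m0 - m2') / 2) (sin_mul_ne_zero_or hξ hl)
  have el : l = l * ξ + l * (1 - ξ : ℝ) := by push_cast; ring
  have sh : Complex.sinh l = Complex.sinh (l * ξ) * Complex.cosh (l * (1 - ξ : ℝ)) +
      Complex.cosh (l * ξ) * Complex.sinh (l * (1 - ξ : ℝ)) := by
    conv_lhs => rw [el, Complex.sinh_add]
  have si : Complex.sin l = Complex.sin (l * ξ) * Complex.cos (l * (1 - ξ : ℝ)) +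
      Complex.cos (l * ξ) * Complex.sin (l * (1 - ξ : ℝ)) := by
    conv_lhs => rw [el, Complex.sin_add]
  rw [hsA, htB, hsC, htD] at m1' hj
  -- The first-order condition combines the two sides of `ξ` through the addition formulas.
  have e1 : s * Complex.sinh l + t * Complex.sin l = 0 := by
    rw [sh, si]
    linear_combination m1'
  obtain ⟨k, hks, hkt⟩ := exists_eq_mul_of_mul_eq_mul (A := s) (C := -t)
    (s := Complex.sinh l) (t := Complex.sin l) (by linear_combination e1)
    (sinh_ne_zero_or_sin_ne_zero hl)
  have hkt' : t = -(k * Complex.sinh l) := by rw [← hkt, neg_neg]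
  refine ⟨k, fun j hj x hx => ?_, fun j hj x hx => ?_, ?_⟩
  · rw [eA j hj hx, beamMode, ← hingedSol_mul, hsA, htB, hks, hkt']
    congr 1 <;> ring
  · rw [eC j hj hx, beamMode, ← hingedSol_mul, hsC, htD, hks, hkt', sub_sub_cancel]
    congr 1 <;> ring
  · by_cases hk : k = 0
    · exact Or.inl hk
    · refine Or.inr (mul_left_cancel₀ hk ?_)
      rw [hks, hkt'] at hj
      linear_combination hj + a * l ^ 3 * k * Complex.sin l * sh +
        a * l ^ 3 * k * Complex.sinh l * si

theorem isBeamSolution_beamMode {a b α ξ : ℝ} {μ l : ℂ} (h : BeamCharEq a α ξ μ l) :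
    IsBeamSolution a b α ξ μ (l ^ 4) 0 (beamMode ξ l) (beamMode (1 - ξ) l) := by
  have el : l = l * ξ + l * (1 - ξ : ℝ) := by push_cast; ring
  have sh : Complex.sinh l = Complex.sinh (l * ξ) * Complex.cosh (l * (1 - ξ : ℝ)) +
      Complex.cosh (l * ξ) * Complex.sinh (l * (1 - ξ : ℝ)) := by
    conv_lhs => rw [el, Complex.sinh_add]
  have si : Complex.sin l = Complex.sin (l * ξ) * Complex.cos (l * (1 - ξ : ℝ)) +
      Complex.cos (l * ξ) * Complex.sin (l * (1 - ξ : ℝ)) := by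
    conv_lhs => rw [el, Complex.sin_add]
  refine ⟨isHingedSolution_hingedSol _ _ _ _ (by simp), isHingedSolution_hingedSol _ _ _ _ (by simp),
    ?_, ?_, ?_, ?_⟩
  · simp only [beamMode, hingedSol, sub_sub_cancel]; ring
  · simp only [beamMode, hingedSol, sub_sub_cancel]
    linear_combination (-l * Complex.sin l) * sh + (l * Complex.sinh l) * si
  · simp only [beamMode, hingedSol, sub_sub_cancel]; ring
  · unfold BeamCharEq at h
    simp only [beamMode, hingedSol, sub_sub_cancel, Pi.zero_apply, add_zero]
    linear_combination h - a * l ^ 3 * Complex.sin l * sh - a * l ^ 3 * Complex.sinh l * si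

/-! ### Eigenspaces and Jordan chains -/

theorem isEigenvalueOf_iff {E : Type*} [AddCommGroup E] [Module ℂ E] {T : E →ₗ.[ℂ] E} {μ : ℂ} :
    IsEigenvalueOf T μ ↔ ∃ x ∈ eigenspaceOf T μ, x ≠ 0 := by
  simp only [mem_eigenspaceOf]
  constructor
  · rintro ⟨x, hx, h⟩
    exact ⟨x, ⟨x.2, h⟩, hx⟩
  · rintro ⟨x, ⟨h, e⟩, hx⟩
    exact ⟨⟨x, h⟩, hx, e⟩

theorem mem_eigenspaceOf_iff_graph {E : Type*} [AddCommGroup E] [Module ℂ E] {T : E →ₗ.[ℂ] E}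
    {μ : ℂ} {x : E} : x ∈ eigenspaceOf T μ ↔ (x, μ • x) ∈ T.graph := by
  rw [mem_eigenspaceOf, LinearPMap.mem_graph_iff]
  constructor
  · rintro ⟨h, e⟩
    exact ⟨⟨x, h⟩, rfl, e⟩
  · rintro ⟨y, rfl, e⟩
    exact ⟨y.2, e⟩

/-- If there are no Jordan chains of length two, the root space is the eigenspace. -/
theorem rootSpaceOf_eq_eigenspaceOf {E : Type*} [AddCommGroup E] [Module ℂ E] {T : E →ₗ.[ℂ] E}
    {μ : ℂ} (h : ∀ x y, y ∈ eigenspaceOf T μ → (x, μ • x + y) ∈ T.graph → y = 0) :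
    rootSpaceOf T μ = eigenspaceOf T μ := by
  refine le_antisymm (iSup_le fun k => ?_) (le_iSup (kerPow T μ) 1)
  induction k with
  | zero => exact bot_le
  | succ k ih =>
    rintro _ ⟨x, hx, rfl⟩
    have hy := ih hx
    have h0 := h x.1 _ hy (by
      rw [LinearPMap.mem_graph_iff]
      exact ⟨x, rfl, by simp [LinearPMap.toFun_eq_coe]⟩)
    rw [mem_eigenspaceOf]
    refine ⟨x.2, ?_⟩
    simpa [sub_eq_zero, LinearPMap.toFun_eq_coe] using h0

theorem rank_eq_one_of_forall_smul {E : Type*} [AddCommGroup E] [Module ℂ E] {S : Submodule ℂ E}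
    {x : E} (hx : x ∈ S) (h0 : x ≠ 0) (h : ∀ y ∈ S, ∃ c : ℂ, y = c • x) : Module.rank ℂ S = 1 := by
  rw [rank_eq_one_iff]
  refine ⟨⟨x, hx⟩, fun h' => h0 (congrArg Subtype.val h'), fun y => ?_⟩
  obtain ⟨c, hc⟩ := h y y.2
  exact ⟨c, Subtype.ext hc.symm⟩

theorem IsContinuousRep.of_ae_eq {c d : ℝ} {f p : ℝ → ℂ} (hp : ContinuousOn p (Icc c d))
    (h : f =ᵐ[volume.restrict (Ioo c d)] p) : IsContinuousRep 0 c d f p :=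
  IsContinuousRep.congr_ae ⟨hp, fun φ _ _ _ => by simp⟩ h.symm

section
variable {a b α : ℝ} {ξ : Ioo (0 : ℝ) 1} {μ l : ℂ}

theorem snd_eq_of_mem_eigenspaceOf (ha : 0 < a) {U : energySpace}
    (hU : U ∈ eigenspaceOf (beamOperator a b α ξ) μ) : U.1.2 = μ • U.1.1 := by
  rw [mem_eigenspaceOf_iff_graph, mem_beamOperator_graph_iff ha] at hU
  exact hU.2.1.symm

theorem exists_eq_beamMode_of_mem_eigenspaceOf (ha : 0 < a) (hξ : Irrational (ξ : ℝ)) (hl : l ≠ 0)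
    (hμ : a * l ^ 4 = -(b * μ + μ ^ 2)) {U : energySpace}
    (hU : U ∈ eigenspaceOf (beamOperator a b α ξ) μ) :
    ∃ k, U.1.1 =ᵐ[volume.restrict (Ioo (0 : ℝ) ξ)] (fun x => k * beamMode ξ l 0 x) ∧
      U.1.1 =ᵐ[volume.restrict (Ioo (ξ : ℝ) 1)] (fun x => k * beamMode (1 - ξ) l 0 (1 - x)) ∧
      (k = 0 ∨ BeamCharEq a α ξ μ l) := by
  rw [mem_eigenspaceOf_iff_graph] at hU
  obtain ⟨p, q, hs, el, er⟩ := exists_isBeamSolution ha hμ (W := 0) (w := 0)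
    (by rwa [add_zero]) (by simp) (IsContinuousRep.zero.congr_ae (L2.ae_zero le_rfl le_rfl))
  obtain ⟨k, k1, k2, k3⟩ := hs.exists_eq_beamMode hξ ξ.2.1 ξ.2.2 hl
  refine ⟨k, ?_, ?_, k3⟩
  · filter_upwards [el, ae_restrict_mem measurableSet_Ioo] with x hx hx'
    rw [hx, k1 0 (by norm_num) x (Ioo_subset_Icc_self hx')]
  · filter_upwards [er, ae_restrict_mem measurableSet_Ioo] with x hx hx'
    rw [hx, k2 0 (by norm_num) (1 - x) ⟨by linarith [hx'.2], by linarith [hx'.1]⟩]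

theorem eq_zero_of_ae_zero (ha : 0 < a) {U : energySpace}
    (hU : U ∈ eigenspaceOf (beamOperator a b α ξ) μ)
    (h1 : U.1.1 =ᵐ[volume.restrict (Ioo (0 : ℝ) ξ)] fun _ => 0)
    (h2 : U.1.1 =ᵐ[volume.restrict (Ioo (ξ : ℝ) 1)] fun _ => 0) : U = 0 := by
  have h : U.1.1 = 0 := by
    refine Lp.ext ?_
    filter_upwards [ae_Ioo_of_ae_pieces h1 h2, L2.ae_zero le_rfl le_rfl] with x e1 e2
    rw [e1, ← e2]; rfl
  refine Subtype.ext (Prod.ext h ?_)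
  rw [snd_eq_of_mem_eigenspaceOf ha hU, h]
  simp

theorem isEigenvalueOf_beamOperator_iff (ha : 0 < a) (hξ : Irrational (ξ : ℝ)) (hl : l ≠ 0)
    (hμ : a * l ^ 4 = -(b * μ + μ ^ 2)) :
    IsEigenvalueOf (beamOperator a b α ξ) μ ↔ BeamCharEq a α ξ μ l := by
  rw [isEigenvalueOf_iff]
  constructor
  · rintro ⟨U, hU, h0⟩
    obtain ⟨k, k1, k2, k3⟩ := exists_eq_beamMode_of_mem_eigenspaceOf ha hξ hl hμ hU
    refine k3.resolve_left ?_
    rintro rfl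
    simp only [zero_mul] at k1 k2
    exact h0 (eq_zero_of_ae_zero ha hU k1 k2)
  · intro h
    obtain ⟨U, hU, e1, e2⟩ := (isBeamSolution_beamMode (b := b) h).exists_eigenvector ha hμ
    refine ⟨U, mem_eigenspaceOf_iff_graph.2 hU, ?_⟩
    rintro rfl
    -- It remains to see that the mode is not identically zero. The first and third derivatives at
    -- `0` are `l (A + B)` and `l³ (A - B)`, so a vanishing function has vanishing coefficients.
    have vanish {c : ℝ} (hc : 0 < c) {A B : ℂ} (hz : ∀ x ∈ Icc 0 c, hingedSol l A B 0 x = 0) :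
        A = 0 ∧ B = 0 := by
      have H := isHingedSolution_hingedSol c l A B (g := 0) (by simp)
      have step (k : ℕ) (hk : k < 4) (h0 : ∀ x ∈ Icc 0 c, hingedSol l A B k x = 0) :
          ∀ x ∈ Icc 0 c, hingedSol l A B (k + 1) x = 0 := by
        have h1 : EqOn (hingedSol l A B (k + 1)) 0 (Ioo 0 c) := fun x hx => by
          have d := H.hasDerivAt k hk x hx
          have d' : HasDerivAt (hingedSol l A B k) 0 x :=
            (hasDerivAt_const x (0 : ℂ)).congr_of_eventuallyEq
              (Filter.eventuallyEq_of_mem (Icc_mem_nhds hx.1 hx.2) h0)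
          exact d.unique d'
        have h2 := h1.of_subset_closure (H.continuousOn (k + 1) hk) continuousOn_const
          Ioo_subset_Icc_self (by rw [closure_Ioo hc.ne])
        exact h2
      have z1 := step 0 (by norm_num) hz
      have z3 := step 2 (by norm_num) (step 1 (by norm_num) z1)
      have i0 : (0 : ℝ) ∈ Icc 0 c := ⟨le_rfl, hc.le⟩
      have y1 := z1 0 i0
      have y3 := z3 0 i0
      simp only [zero_add, Nat.reduceAdd, hingedSol, Complex.ofReal_zero, mul_zero, Complex.cosh_zero,
        Complex.cos_zero, mul_one, mul_eq_zero, hl, pow_eq_zero_iff, ne_eq, false_or, not_false_eq_true,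
        OfNat.ofNat_ne_zero] at y1 y3
      exact ⟨by linear_combination (y1 + y3) / 2, by linear_combination (y1 - y3) / 2⟩
    have H1 := isHingedSolution_hingedSol ξ l (Complex.sin l * Complex.sinh (l * (1 - ξ : ℝ)))
      (-(Complex.sinh l * Complex.sin (l * (1 - ξ : ℝ)))) (g := 0) (by simp)
    have H2 := isHingedSolution_hingedSol (1 - ξ) l
      (Complex.sin l * Complex.sinh (l * (1 - (1 - ξ) : ℝ)))
      (-(Complex.sinh l * Complex.sin (l * (1 - (1 - ξ) : ℝ)))) (g := 0) (by simp)
    have p1 : 0 < (ξ : ℝ) := ξ.2.1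
    have p2 : 0 < 1 - (ξ : ℝ) := sub_pos.2 ξ.2.2
    have c1 : ∀ x ∈ Icc 0 (ξ : ℝ), beamMode ξ l 0 x = 0 :=
      (IsContinuousRep.of_ae_eq (H1.continuousOn 0 (by norm_num)) e1).eqOn
        (IsContinuousRep.zero.congr_ae (L2.ae_zero le_rfl ξ.2.2.le)) p1
    have c2' : EqOn (fun x => beamMode (1 - ξ) l 0 (1 - x)) 0 (Icc (ξ : ℝ) 1) :=
      (IsContinuousRep.of_ae_eq ((H2.continuousOn 0 (by norm_num)).comp (by fun_prop)
        (fun x hx => ⟨by linarith [hx.2], by linarith [hx.1]⟩)) e2).eqOn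
        (IsContinuousRep.zero.congr_ae (L2.ae_zero ξ.2.1.le le_rfl)) ξ.2.2
    have c2 : ∀ x ∈ Icc 0 (1 - (ξ : ℝ)), beamMode (1 - ξ) l 0 x = 0 := fun x hx => by
      have := c2' (x := 1 - x) ⟨by linarith [hx.2], by linarith [hx.1]⟩
      simpa using this
    obtain ⟨v1, v2⟩ := vanish p1 c1
    obtain ⟨v3, v4⟩ := vanish p2 c2
    rw [sub_sub_cancel] at v3 v4
    rw [neg_eq_zero] at v2 v4
    -- All four coefficients would vanish. Cancelling whichever of `sinh l`, `sin l` is nonzero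
    -- leaves two simultaneous zeros that irrationality of `ξ` excludes.
    rcases sinh_ne_zero_or_sin_ne_zero hl with h | h
    · have w2 := (mul_eq_zero.1 v2).resolve_left h
      have w4 := (mul_eq_zero.1 v4).resolve_left h
      exact (sin_mul_ne_zero_or hξ hl).elim (fun h => h w4) (fun h => h w2)
    · have w1 := (mul_eq_zero.1 v1).resolve_left h
      have w3 := (mul_eq_zero.1 v3).resolve_left h
      exact (sinh_mul_ne_zero_or hξ hl).elim (fun h => h w3) (fun h => h w1)

theorem exists_smul_eq_of_mem_eigenspaceOf (ha : 0 < a) (hξ : Irrational (ξ : ℝ)) (hl : l ≠ 0)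
    (hμ : a * l ^ 4 = -(b * μ + μ ^ 2)) {U V : energySpace} (h0 : U ≠ 0)
    (hU : U ∈ eigenspaceOf (beamOperator a b α ξ) μ)
    (hV : V ∈ eigenspaceOf (beamOperator a b α ξ) μ) : ∃ c : ℂ, V = c • U := by
  obtain ⟨k, k1, k2, -⟩ := exists_eq_beamMode_of_mem_eigenspaceOf ha hξ hl hμ hU
  obtain ⟨j, j1, j2, -⟩ := exists_eq_beamMode_of_mem_eigenspaceOf ha hξ hl hμ hV
  have hk : k ≠ 0 := by
    rintro rfl
    simp only [zero_mul] at k1 k2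
    exact h0 (eq_zero_of_ae_zero ha hU k1 k2)
  refine ⟨j / k, ?_⟩
  have hW := Submodule.sub_mem _ hV (Submodule.smul_mem _ (j / k) hU)
  rw [← sub_eq_zero]
  have e (c d : ℝ) (hc : 0 ≤ c) (hd : d ≤ 1) :
      ((V - (j / k) • U : energySpace).1.1 : ℝ → ℂ) =ᵐ[volume.restrict (Ioo c d)]
        fun x => V.1.1 x - (j / k) * U.1.1 x := by
    have m := Measure.restrict_mono (μ := (volume : Measure ℝ)) (Ioo_subset_Ioo hc hd) le_rfl
    filter_upwards [ae_mono m (Lp.coeFn_sub V.1.1 ((j / k) • U.1.1)),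
      L2.ae_smul hc hd (j / k) U.1.1] with x h1 h2
    have : ((V - (j / k) • U : energySpace).1.1 : ℝ → ℂ) x =
      ((V.1.1 - (j / k) • U.1.1 : L2) : ℝ → ℂ) x := rfl
    rw [this, h1, Pi.sub_apply, ← h2]; rfl
  refine eq_zero_of_ae_zero ha hW ?_ ?_
  · filter_upwards [e 0 ξ le_rfl ξ.2.2.le, k1, j1] with x h1 h2 h3
    rw [h1, h2, h3]; field_simp; ring
  · filter_upwards [e ξ 1 ξ.2.1.le le_rfl, k2, j2] with x h1 h2 h3
    rw [h1, h2, h3]; field_simp; ring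

/-- A Jordan chain of length two over a non-zero eigenvector forces this quadratic identity. -/
theorem integral_beamMode_sq_of_chain (ha : 0 < a) (hξ : Irrational (ξ : ℝ)) (hl : l ≠ 0)
    (hμ : a * l ^ 4 = -(b * μ + μ ^ 2)) {U W : energySpace} (h0 : W ≠ 0)
    (hW : W ∈ eigenspaceOf (beamOperator a b α ξ) μ)
    (h : (U, μ • U + W) ∈ (beamOperator a b α ξ).graph) :
    (2 * μ + b) * ((∫ x in (0 : ℝ)..ξ, beamMode ξ l 0 x ^ 2) +
      ∫ x in (0 : ℝ)..(1 - ξ), beamMode (1 - ξ) l 0 x ^ 2) + α * beamMode ξ l 0 ξ ^ 2 = 0 := by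
  have p1 : 0 < (ξ : ℝ) := ξ.2.1
  have p2 : 0 < 1 - (ξ : ℝ) := sub_pos.2 ξ.2.2
  obtain ⟨-, w, hw, -, -⟩ := W.2
  have hs := snd_eq_of_mem_eigenspaceOf ha hW
  obtain ⟨P, Q, hPQ, -, -⟩ := exists_isBeamSolution ha hμ h hs hw
  have hWg := mem_eigenspaceOf_iff_graph.1 hW
  obtain ⟨p, q, hpq, el, er⟩ := exists_isBeamSolution ha hμ (W := 0) (w := 0)
    (by rwa [add_zero]) (by simp) (IsContinuousRep.zero.congr_ae (L2.ae_zero le_rfl le_rfl))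
  obtain ⟨k, k1, k2, -⟩ := hpq.exists_eq_beamMode hξ p1 ξ.2.2 hl
  have hk : k ≠ 0 := by
    rintro rfl
    refine h0 (eq_zero_of_ae_zero ha hW ?_ ?_)
    · filter_upwards [el, ae_restrict_mem measurableSet_Ioo] with x hx hx'
      rw [hx, k1 0 (by norm_num) x (Ioo_subset_Icc_self hx'), zero_mul]
    · filter_upwards [er, ae_restrict_mem measurableSet_Ioo] with x hx hx'
      rw [hx, k2 0 (by norm_num) (1 - x) ⟨by linarith [hx'.2], by linarith [hx'.1]⟩, zero_mul]
  have wp : EqOn w (p 0) (Icc 0 ξ) := (hw.mono le_rfl ξ.2.2.le).eqOn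
    (IsContinuousRep.of_ae_eq (hpq.left.continuousOn 0 (by norm_num)) el) p1
  have wq' : EqOn w (fun x => q 0 (1 - x)) (Icc ξ 1) := (hw.mono p1.le le_rfl).eqOn
    (IsContinuousRep.of_ae_eq ((hpq.right.continuousOn 0 (by norm_num)).comp (by fun_prop)
        (fun x hx => ⟨by linarith [hx.2], by linarith [hx.1]⟩)) er) ξ.2.2
  have wq : ∀ x ∈ Icc 0 (1 - (ξ : ℝ)), w (1 - x) = q 0 x := fun x hx => by
    rw [wq' ⟨by linarith [hx.2], by linarith [hx.1]⟩]; simp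
  -- The chain solution is paired with the eigenfunction on each piece. On adding, the boundary
  -- terms at `ξ` cancel by the matching conditions, except for those in the third derivatives,
  -- which the two jump conditions turn into a multiple of the squared value at `ξ`.
  have g1 := hPQ.left.integral_mul_eq p1.le (by simp) hpq.left
  have g2 := hPQ.right.integral_mul_eq p2.le (by simp) hpq.right
  set κ : ℂ := (2 * μ + b) / a with hκ
  have r1 : ∫ x in (0 : ℝ)..ξ, p 0 x * -(κ * w x) =
      -κ * k ^ 2 * ∫ x in (0 : ℝ)..ξ, beamMode ξ l 0 x ^ 2 := by
    rw [← intervalIntegral.integral_const_mul]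
    refine intervalIntegral.integral_congr fun x hx => ?_
    rw [uIcc_of_le p1.le] at hx
    rw [wp hx, k1 0 (by norm_num) x hx]; ring
  have r2 : ∫ x in (0 : ℝ)..(1 - ξ), q 0 x * -(κ * w (1 - x)) =
      -κ * k ^ 2 * ∫ x in (0 : ℝ)..(1 - ξ), beamMode (1 - ξ) l 0 x ^ 2 := by
    rw [← intervalIntegral.integral_const_mul]
    refine intervalIntegral.integral_congr fun x hx => ?_
    rw [uIcc_of_le p2.le] at hx
    rw [wq x hx, k2 0 (by norm_num) x hx]; ring
  rw [r1] at g1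
  rw [r2] at g2
  have J := hPQ.jump
  have j := hpq.jump
  have w1 := wp (x := ξ) ⟨p1.le, le_rfl⟩
  have z1 := k1 0 (by norm_num) ξ ⟨p1.le, le_rfl⟩
  rw [w1] at J
  simp only [Pi.zero_apply, add_zero] at j
  rw [← hPQ.match0, ← hPQ.match2, ← hpq.match0, ← hpq.match2] at g2
  have ha' : (a : ℂ) ≠ 0 := by exact_mod_cast ha.ne'
  have hm1 := hPQ.match1
  have hm1' := hpq.match1
  have hκ' : a * κ = 2 * μ + b := by rw [hκ]; field_simp
  refine mul_left_cancel₀ (pow_ne_zero 2 hk) ?_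
  have z2 : p 0 ξ ^ 2 = k ^ 2 * beamMode ξ l 0 ξ ^ 2 := by rw [z1]; ring
  rw [← hκ']
  linear_combination (-a) * (g1 + g2) - p 0 ξ * J + P 0 ξ * j - a * p 2 ξ * hm1
    + a * P 2 ξ * hm1' - α * z2

theorem geomMult_eq_one_and_algMult_eq_one (ha : 0 < a) (hξ : Irrational (ξ : ℝ)) (hl : l ≠ 0)
    (hμ : a * l ^ 4 = -(b * μ + μ ^ 2)) (he : IsEigenvalueOf (beamOperator a b α ξ) μ)
    (h : (2 * μ + b) * ((∫ x in (0 : ℝ)..ξ, beamMode ξ l 0 x ^ 2) +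
      ∫ x in (0 : ℝ)..(1 - ξ), beamMode (1 - ξ) l 0 x ^ 2) + α * beamMode ξ l 0 ξ ^ 2 ≠ 0) :
    geomMult (beamOperator a b α ξ) μ = 1 ∧ algMult (beamOperator a b α ξ) μ = 1 := by
  obtain ⟨U, hU, h0⟩ := isEigenvalueOf_iff.1 he
  have hr := rank_eq_one_of_forall_smul hU h0 fun V hV =>
    exists_smul_eq_of_mem_eigenspaceOf ha hξ hl hμ h0 hU hV
  refine ⟨hr, ?_⟩
  rw [algMult, rootSpaceOf_eq_eigenspaceOf]
  · exact hr
  · intro x y hy hxy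
    by_contra hy0
    exact h (integral_beamMode_sq_of_chain ha hξ hl hμ hy0 hy hxy)

end

/-! ### Bounds for the complex sine and hyperbolic sine -/

theorem Complex.norm_sin_sq (z : ℂ) :
    ‖Complex.sin z‖ ^ 2 = Real.sin z.re ^ 2 + Real.sinh z.im ^ 2 := by
  rw [← Complex.normSq_eq_norm_sq, Complex.sin_eq, ← Complex.ofReal_sin, ← Complex.ofReal_cos,
    ← Complex.ofReal_sinh, ← Complex.ofReal_cosh, ← Complex.ofReal_mul, ← Complex.ofReal_mul,
    Complex.normSq_add_mul_I, mul_pow, mul_pow, Real.cosh_sq, Real.cos_sq']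
  ring

theorem Complex.norm_sin_le_cosh (z : ℂ) : ‖Complex.sin z‖ ≤ Real.cosh z.im := by
  refine le_of_sq_le_sq ?_ (Real.cosh_pos _).le
  rw [Complex.norm_sin_sq, Real.cosh_sq]
  nlinarith [Real.sin_sq_le_one z.re]

theorem Complex.norm_cos_le_cosh (z : ℂ) : ‖Complex.cos z‖ ≤ Real.cosh z.im := by
  have h := Complex.norm_sin_le_cosh (z + Real.pi / 2)
  rw [Complex.sin_add_pi_div_two] at h
  have e : (z + Real.pi / 2 : ℂ).im = z.im := by
    have : (Real.pi / 2 : ℂ) = ((Real.pi / 2 : ℝ) : ℂ) := by push_cast; ring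
    rw [this, Complex.add_im, Complex.ofReal_im, add_zero]
  rwa [e] at h

theorem Complex.norm_sinh_eq (z : ℂ) : ‖Complex.sinh z‖ = ‖Complex.sin (z * Complex.I)‖ := by
  rw [Complex.sin_mul_I]; simp

theorem Complex.norm_sinh_le_cosh (z : ℂ) : ‖Complex.sinh z‖ ≤ Real.cosh z.re := by
  have h := Complex.norm_sin_le_cosh (z * Complex.I)
  rw [← Complex.norm_sinh_eq] at h
  simpa using h

theorem Complex.sinh_re_le_norm_sinh (z : ℂ) : Real.sinh z.re ≤ ‖Complex.sinh z‖ := by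
  refine le_of_sq_le_sq ?_ (norm_nonneg _)
  rw [Complex.norm_sinh_eq, Complex.norm_sin_sq]
  have : (z * Complex.I).im = z.re := by simp
  rw [this]
  nlinarith [sq_nonneg (Real.sin (z * Complex.I).re)]

theorem Real.cosh_le_two_mul_sinh {x : ℝ} (hx : 1 ≤ x) : Real.cosh x ≤ 2 * Real.sinh x := by
  have h1 := Real.cosh_sub_sinh x
  have h2 : Real.exp (-x) ≤ 1 := Real.exp_le_one_iff.2 (by linarith)
  have h3 : x ≤ Real.sinh x := Real.self_le_sinh_iff.2 (by linarith)
  linarith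

theorem Real.cosh_mul_cosh_le {x y : ℝ} (hxy : 0 ≤ x * y) :
    Real.cosh x * Real.cosh y ≤ Real.cosh (x + y) := by
  rw [Real.cosh_add]
  have : 0 ≤ Real.sinh x * Real.sinh y := by
    rcases le_total 0 x with hx | hx <;> rcases le_total 0 y with hy | hy
    · exact mul_nonneg (Real.sinh_nonneg_iff.2 hx) (Real.sinh_nonneg_iff.2 hy)
    · have : x * y = 0 := le_antisymm (mul_nonpos_of_nonneg_of_nonpos hx hy) hxy
      rcases mul_eq_zero.1 this with h | h <;> simp [h]
    · have : x * y = 0 := le_antisymm (mul_nonpos_of_nonpos_of_nonneg hx hy) hxy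
      rcases mul_eq_zero.1 this with h | h <;> simp [h]
    · exact mul_nonneg_of_nonpos_of_nonpos (Real.sinh_nonpos_iff.2 hx) (Real.sinh_nonpos_iff.2 hy)
  linarith

theorem Real.cosh_le_two {x : ℝ} (hx : |x| ≤ 1) : Real.cosh x ≤ 2 := by
  have h1 : Real.cosh x ≤ Real.cosh 1 := Real.cosh_le_cosh.2 (by simpa using hx)
  have h2 : Real.cosh 1 ≤ 2 := by
    rw [Real.cosh_eq]
    have := Real.exp_one_lt_d9
    have : Real.exp (-1) ≤ 1 := Real.exp_le_one_iff.2 (by norm_num)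
    linarith
  linarith

/-- With `x = Re l ≥ 1`, the chain is `cosh(x s) cosh(x t) ≤ cosh x ≤ 2 sinh x ≤ 2 |sinh l|`. It
makes the hyperbolic terms bounded once the equation is divided by `sinh l`. -/
theorem norm_sinh_mul_sinh_le {l : ℂ} (hl : 1 ≤ l.re) {s t : ℝ} (hs : 0 ≤ s) (ht : 0 ≤ t)
    (hst : s + t ≤ 1) : ‖Complex.sinh (l * s) * Complex.sinh (l * t)‖ ≤ 2 * ‖Complex.sinh l‖ := by
  rw [norm_mul]
  have h1 := Complex.norm_sinh_le_cosh (l * s)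
  have h2 := Complex.norm_sinh_le_cosh (l * t)
  rw [Complex.re_mul_ofReal] at h1 h2
  have h3 := mul_le_mul h1 h2 (norm_nonneg _) (Real.cosh_pos _).le
  have h0 : 0 ≤ l.re := by linarith
  have h4 := Real.cosh_mul_cosh_le (x := l.re * s) (y := l.re * t) (by positivity)
  have h5 : Real.cosh (l.re * s + l.re * t) ≤ Real.cosh l.re := by
    rw [Real.cosh_le_cosh, ← mul_add, abs_of_nonneg (by positivity), abs_of_nonneg h0]
    exact mul_le_of_le_one_right h0 hst
  have h6 := Real.cosh_le_two_mul_sinh hl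
  have h7 := Complex.sinh_re_le_norm_sinh l
  linarith

theorem norm_sin_mul_sin_le (l : ℂ) {s t : ℝ} (hs : 0 ≤ s) (ht : 0 ≤ t) (hst : s + t = 1) :
    ‖Complex.sin (l * s) * Complex.sin (l * t)‖ ≤ Real.cosh l.im := by
  rw [norm_mul]
  have h1 := Complex.norm_sin_le_cosh (l * s)
  have h2 := Complex.norm_sin_le_cosh (l * t)
  rw [Complex.im_mul_ofReal] at h1 h2
  have h3 := mul_le_mul h1 h2 (norm_nonneg _) (Real.cosh_pos _).le
  have h4 := Real.cosh_mul_cosh_le (x := l.im * s) (y := l.im * t) (by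
    have : l.im * s * (l.im * t) = l.im ^ 2 * (s * t) := by ring
    rw [this]; positivity)
  rw [← mul_add, hst, mul_one] at h4
  linarith

theorem sinh_ne_zero_of_one_le_re {l : ℂ} (hl : 1 ≤ l.re) : Complex.sinh l ≠ 0 := by
  intro h
  have := Complex.sinh_re_le_norm_sinh l
  rw [h, norm_zero] at this
  have h3 : l.re ≤ Real.sinh l.re := Real.self_le_sinh_iff.2 (by linarith)
  linarith

/-- In `sin²(Re l) + sinh²(Im l) ≤ 4 δ² (1 + sinh²(Im l))` the last term is absorbed for small `δ`,
giving `|sinh(Im l)| ≤ 3 δ` and `|sin(Re l)| ≤ 2 δ`. Jordan's inequality then puts `Re l` within `π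
δ ≤ 4 δ` of a multiple of `π`, and `7 = 3 + 4`. -/
theorem exists_int_norm_sub_le {l : ℂ} {δ : ℝ} (h0 : 0 ≤ δ) (hδ : δ ≤ 1 / 8)
    (h : ‖Complex.sin l‖ ≤ 2 * δ * Real.cosh l.im) : ∃ n : ℤ, ‖l - n * Real.pi‖ ≤ 7 * δ := by
  have h1 : ‖Complex.sin l‖ ^ 2 ≤ (2 * δ * Real.cosh l.im) ^ 2 := pow_le_pow_left₀ (norm_nonneg _) h 2
  rw [Complex.norm_sin_sq, mul_pow, Real.cosh_sq] at h1
  have hd : δ ^ 2 ≤ 1 / 64 := by nlinarith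
  have s0 := sq_nonneg (Real.sinh l.im)
  have r0 := sq_nonneg (Real.sin l.re)
  have hsh : Real.sinh l.im ^ 2 ≤ (3 * δ) ^ 2 := by nlinarith
  have hsi : Real.sin l.re ^ 2 ≤ (2 * δ) ^ 2 := by nlinarith
  have him : |l.im| ≤ 3 * δ := by
    have e1 : |Real.sinh l.im| ≤ 3 * δ := abs_le_of_sq_le_sq hsh (by linarith)
    have e2 : |l.im| ≤ Real.sinh |l.im| := Real.self_le_sinh_iff.2 (abs_nonneg _)
    rw [← Real.abs_sinh] at e2
    linarith
  have hsin : |Real.sin l.re| ≤ 2 * δ := abs_le_of_sq_le_sq hsi (by linarith)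
  set n := round (l.re / Real.pi) with hn
  set y := l.re - n * Real.pi with hy
  have hy2 : |y| ≤ Real.pi / 2 := by
    have e := abs_sub_round (l.re / Real.pi)
    have : y = (l.re / Real.pi - n) * Real.pi := by
      rw [hy]; field_simp
    rw [this, abs_mul, abs_of_pos Real.pi_pos]
    nlinarith [Real.pi_pos]
  have e1 := Real.mul_abs_le_abs_sin hy2
  have e2 : |Real.sin y| = |Real.sin l.re| := by
    rw [hy, Real.sin_sub_int_mul_pi, abs_mul, abs_zpow, abs_neg, abs_one, one_zpow, one_mul]
  have hre : |y| ≤ 4 * δ := by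
    have h4 := Real.pi_le_four
    have e3 : 2 / Real.pi * |y| ≤ 2 * δ := by linarith
    have e4 : |y| ≤ Real.pi * δ := by
      have : |y| = Real.pi / 2 * (2 / Real.pi * |y|) := by field_simp
      rw [this]
      nlinarith [Real.pi_pos]
    nlinarith
  refine ⟨n, ?_⟩
  have e5 := Complex.norm_le_abs_re_add_abs_im (l - n * Real.pi)
  have e6 : (l - n * Real.pi).re = y := by simp [hy]
  have e7 : (l - n * Real.pi).im = l.im := by simp
  rw [e6, e7] at e5
  linarith

/-! ### Asymptotic roots and the quarter-turn symmetry -/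

theorem sinh_mul_sin_eq_zero_iff (z : ℂ) : Complex.sinh z * Complex.sin z = 0 ↔
    ∃ n : ℤ, z = n * Real.pi ∨ z = Complex.I * n * Real.pi := by
  rw [mul_eq_zero]
  have h : Complex.sinh z = 0 ↔ Complex.sin (z * Complex.I) = 0 := by
    rw [Complex.sin_mul_I]; simp
  rw [h, Complex.sin_eq_zero_iff, Complex.sin_eq_zero_iff]
  constructor
  · rintro (⟨n, hn⟩ | ⟨n, hn⟩)
    · refine ⟨-n, Or.inr ?_⟩
      push_cast
      linear_combination -Complex.I * hn + z * Complex.I_sq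
    · exact ⟨n, Or.inl hn⟩
  · rintro ⟨n, rfl | rfl⟩
    · exact Or.inr ⟨n, rfl⟩
    · refine Or.inl ⟨-n, ?_⟩
      push_cast
      linear_combination (n * Real.pi) * Complex.I_sq

theorem exists_eq_nat_mul_pi_mul_of_root {z : ℂ} (h : Complex.sinh z * Complex.sin z = 0) :
    ∃ (n : ℕ) (u : ℂ), u ^ 4 = 1 ∧ z = n * Real.pi * u := by
  obtain ⟨n, h | h⟩ := (sinh_mul_sin_eq_zero_iff z).1 h
  · rcases Int.eq_nat_or_neg n with ⟨m, rfl | rfl⟩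
    · exact ⟨m, 1, by simp, by simp [h]⟩
    · exact ⟨m, -1, by norm_num, by simp [h]⟩
  · rcases Int.eq_nat_or_neg n with ⟨m, rfl | rfl⟩
    · exact ⟨m, Complex.I, by simp, by simp [h]; ring⟩
    · exact ⟨m, -Complex.I, by rw [neg_pow, Complex.I_pow_four]; norm_num, by simp [h]; ring⟩

theorem root_int_mul_pi_mul {u : ℂ} (hu : u ^ 4 = 1) (n : ℤ) :
    Complex.sinh (n * Real.pi * u) * Complex.sin (n * Real.pi * u) = 0 := by
  have : (u - 1) * ((u + 1) * ((u - Complex.I) * (u + Complex.I))) = 0 := by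
    linear_combination hu - (u ^ 2 - 1) * Complex.I_sq
  rw [sinh_mul_sin_eq_zero_iff]
  rcases mul_eq_zero.1 this with h | h
  · exact ⟨n, Or.inl (by linear_combination n * Real.pi * h)⟩
  rcases mul_eq_zero.1 h with h | h
  · exact ⟨-n, Or.inl (by push_cast; linear_combination n * Real.pi * h)⟩
  rcases mul_eq_zero.1 h with h | h
  · exact ⟨n, Or.inr (by linear_combination n * Real.pi * h)⟩
  · exact ⟨-n, Or.inr (by push_cast; linear_combination n * Real.pi * h)⟩

/-- A quarter turn exchanges `sinh` and `sin` up to a factor `i`, and both sides of the equation are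
multiplied by `i`. -/
theorem beamCharEq_mul_I {a α ξ : ℝ} {μ l : ℂ} :
    BeamCharEq a α ξ μ (l * Complex.I) ↔ BeamCharEq a α ξ μ l := by
  unfold BeamCharEq
  have e1 (r : ℝ) : l * Complex.I * r = l * r * Complex.I := by ring
  rw [e1, e1]
  simp only [Complex.sinh_mul_I, Complex.sin_mul_I]
  have i3 : Complex.I ^ 3 = -Complex.I := Complex.I_pow_three
  have i2 := Complex.I_sq
  constructor <;> intro h
  · refine mul_left_cancel₀ Complex.I_ne_zero ?_
    linear_combination h + (α * μ * (-Complex.sinh l * Complex.sin (l * ξ) *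
      Complex.sin (l * (1 - ξ : ℝ)) + Complex.sin l * Complex.sinh (l * ξ) *
      Complex.sinh (l * (1 - ξ : ℝ))) * -Complex.I + 2 * a * l ^ 3 * Complex.sinh l *
      Complex.sin l * (-Complex.I ^ 3 + Complex.I)) * i2
  · linear_combination Complex.I * h - (α * μ * (-Complex.sinh l * Complex.sin (l * ξ) *
      Complex.sin (l * (1 - ξ : ℝ)) + Complex.sin l * Complex.sinh (l * ξ) *
      Complex.sinh (l * (1 - ξ : ℝ))) * -Complex.I + 2 * a * l ^ 3 * Complex.sinh l *
      Complex.sin l * (-Complex.I ^ 3 + Complex.I)) * i2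

theorem exists_pow_I_of_pow_four {u : ℂ} (hu : u ^ 4 = 1) : ∃ k : ℕ, u = Complex.I ^ k := by
  have : (u - 1) * ((u + 1) * ((u - Complex.I) * (u + Complex.I))) = 0 := by
    linear_combination hu - (u ^ 2 - 1) * Complex.I_sq
  rcases mul_eq_zero.1 this with h | h
  · exact ⟨0, by linear_combination h⟩
  rcases mul_eq_zero.1 h with h | h
  · exact ⟨2, by rw [Complex.I_sq]; linear_combination h⟩
  rcases mul_eq_zero.1 h with h | h
  · exact ⟨1, by linear_combination h⟩
  · exact ⟨3, by rw [Complex.I_pow_three]; linear_combination h⟩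

theorem beamCharEq_mul {a α ξ : ℝ} {μ l u : ℂ} (hu : u ^ 4 = 1) :
    BeamCharEq a α ξ μ (l * u) ↔ BeamCharEq a α ξ μ l := by
  obtain ⟨k, rfl⟩ := exists_pow_I_of_pow_four hu
  clear hu
  induction k with
  | zero => simp
  | succ k ih => rw [pow_succ, ← mul_assoc, beamCharEq_mul_I, ih]

theorem exists_rotation (l : ℂ) : ∃ u : ℂ, u ^ 4 = 1 ∧ |(l * u).im| ≤ (l * u).re := by
  rcases le_total |l.im| |l.re| with h | h
  · rcases le_total 0 l.re with h' | h'
    · exact ⟨1, by simp, by simpa [abs_of_nonneg h'] using h⟩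
    · exact ⟨-1, by norm_num, by simpa [abs_of_nonpos h'] using h⟩
  · rcases le_total 0 l.im with h' | h'
    · exact ⟨-Complex.I, by rw [neg_pow, Complex.I_pow_four]; norm_num, by simpa [abs_of_nonneg h'] using h⟩
    · exact ⟨Complex.I, by simp, by simpa [abs_of_nonpos h'] using h⟩

theorem norm_eq_one_of_pow_four {u : ℂ} (hu : u ^ 4 = 1) : ‖u‖ = 1 :=
  Complex.norm_eq_one_of_pow_eq_one hu (by norm_num)

theorem norm_le_two_mul_re {l : ℂ} (h : |l.im| ≤ l.re) : ‖l‖ ≤ 2 * l.re := by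
  have := Complex.norm_le_abs_re_add_abs_im l
  rw [abs_of_nonneg ((abs_nonneg _).trans h)] at this
  linarith

/-! ### Large solutions lie near the asymptotic roots -/

section
variable {a b α ξ : ℝ} {μ l ε : ℂ}

/-- Division by `2 a l³ sinh l` leaves `sin l = ε (sin l · q - m)` with `|q| ≤ 2`, where `m` is the
product of the two sines, and the first term is absorbed because `|ε| ≤ 1/4`. Keeping `m` in the
bound, instead of a constant, is what makes the later multiplicity estimate work. -/
theorem BeamCharEq.norm_sin_le (ha : 0 < a) (h0 : 0 ≤ ξ) (h1 : ξ ≤ 1) (h : BeamCharEq a α ξ μ l)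
    (hε : α * μ = 2 * a * l ^ 3 * ε) (hl : 1 ≤ l.re) (hε4 : ‖ε‖ ≤ 1 / 4) :
    ‖Complex.sin l‖ ≤ 2 * ‖ε‖ * ‖Complex.sin (l * ξ) * Complex.sin (l * (1 - ξ : ℝ))‖ := by
  have hl0 : l ≠ 0 := by rintro rfl; simp at hl; linarith
  have ha' : (a : ℂ) ≠ 0 := by exact_mod_cast ha.ne'
  have hne : 2 * (a : ℂ) * l ^ 3 ≠ 0 := by simp [ha', hl0]
  rw [BeamCharEq, hε, mul_assoc _ ε] at h
  have h2 := mul_left_cancel₀ hne h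
  have h3 := norm_sinh_mul_sinh_le hl h0 (sub_nonneg.2 h1) (by simp)
  set H := Complex.sinh (l * ξ) * Complex.sinh (l * (1 - ξ : ℝ))
  set m := Complex.sin (l * ξ) * Complex.sin (l * (1 - ξ : ℝ))
  have hs : 0 < ‖Complex.sinh l‖ := norm_pos_iff.2 (sinh_ne_zero_of_one_le_re hl)
  have h4 : ‖Complex.sinh l‖ * ‖Complex.sin l‖ ≤
      ‖ε‖ * (‖Complex.sin l‖ * ‖H‖ + ‖Complex.sinh l‖ * ‖m‖) := by
    rw [← norm_mul (Complex.sinh l) (Complex.sin l), h2, norm_mul ε, ← norm_mul (Complex.sin l),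
      ← norm_mul (Complex.sinh l)]
    exact mul_le_mul_of_nonneg_left (norm_sub_le (Complex.sin l * H) (Complex.sinh l * m))
      (norm_nonneg ε)
  have h5 : ‖Complex.sinh l‖ * ‖Complex.sin l‖ ≤
      ‖Complex.sinh l‖ * (‖ε‖ * (2 * ‖Complex.sin l‖ + ‖m‖)) := by
    have := mul_le_mul_of_nonneg_left h3 (mul_nonneg (norm_nonneg ε) (norm_nonneg (Complex.sin l)))
    nlinarith
  have h6 := le_of_mul_le_mul_left h5 hs
  nlinarith [mul_le_mul_of_nonneg_right hε4 (norm_nonneg (Complex.sin l))]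

theorem mul_norm_pow_four (ha : 0 < a) (hμ : a * l ^ 4 = -(b * μ + μ ^ 2)) :
    a * ‖l‖ ^ 4 = ‖μ‖ * ‖μ + b‖ := by
  have : ‖(a : ℂ) * l ^ 4‖ = ‖μ * (μ + b)‖ := by
    rw [hμ, norm_neg]; congr 1; ring
  rwa [norm_mul, norm_mul, norm_pow, Complex.norm_real, Real.norm_of_nonneg ha.le] at this

theorem norm_add_ofReal_le (hb : 0 ≤ b) : ‖μ + b‖ ≤ ‖μ‖ + b := by
  have := norm_add_le μ b
  rwa [Complex.norm_real, Real.norm_of_nonneg hb] at this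

theorem norm_sub_le_norm_add_ofReal (hb : 0 ≤ b) : ‖μ‖ - b ≤ ‖μ + b‖ := by
  have := norm_sub_le (μ + b) b
  rw [add_sub_cancel_right, Complex.norm_real, Real.norm_of_nonneg hb] at this
  linarith

theorem norm_le_of_quadratic (ha : 0 < a) (hb : 0 ≤ b) (hμ : a * l ^ 4 = -(b * μ + μ ^ 2))
    (hl : b ≤ √a * ‖l‖ ^ 2) : ‖μ‖ ≤ 2 * (√a * ‖l‖ ^ 2) := by
  by_contra! h
  have h1 := mul_norm_pow_four ha hμ
  have h2 := norm_sub_le_norm_add_ofReal (μ := μ) hb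
  have h3 : a * ‖l‖ ^ 4 = (√a * ‖l‖ ^ 2) ^ 2 := by
    rw [mul_pow, Real.sq_sqrt ha.le]; ring
  rw [h3] at h1
  set X := √a * ‖l‖ ^ 2
  have hX : 0 ≤ X := by positivity
  nlinarith [norm_nonneg μ]

theorem norm_eps_le (ha : 0 < a) (hb : 0 ≤ b) (hα : 0 ≤ α) (hμ : a * l ^ 4 = -(b * μ + μ ^ 2))
    (hl0 : l ≠ 0) (hl : b ≤ √a * ‖l‖ ^ 2) (hε : α * μ = 2 * a * l ^ 3 * ε) :
    ‖ε‖ ≤ α / √a / ‖l‖ := by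
  have h1 := norm_le_of_quadratic ha hb hμ hl
  have hn : 0 < ‖l‖ := norm_pos_iff.2 hl0
  have hs : 0 < √a := Real.sqrt_pos.2 ha
  have h2 : α * ‖μ‖ = 2 * a * ‖l‖ ^ 3 * ‖ε‖ := by
    have := congrArg norm hε
    simpa [abs_of_pos ha, abs_of_nonneg hα] using this
  rw [div_div, le_div_iff₀ (by positivity)]
  have ha2 : a = √a ^ 2 := (Real.sq_sqrt ha.le).symm
  have h3 : 2 * (√a * ‖l‖ ^ 2) * (‖ε‖ * (√a * ‖l‖)) ≤ 2 * (√a * ‖l‖ ^ 2) * α := by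
    have := mul_le_mul_of_nonneg_left h1 hα
    rw [h2] at this
    calc _ = 2 * √a ^ 2 * ‖l‖ ^ 3 * ‖ε‖ := by ring
      _ ≤ _ := by rw [← ha2]; linarith
  exact le_of_mul_le_mul_left h3 (by positivity)

theorem exists_eps (ha : 0 < a) (hl0 : l ≠ 0) : ∃ ε : ℂ, α * μ = 2 * a * l ^ 3 * ε := by
  have ha' : (a : ℂ) ≠ 0 := by exact_mod_cast ha.ne'
  exact ⟨α * μ / (2 * a * l ^ 3), by field_simp⟩

/-- Large eigenvalues correspond to `l` close to a root of the asymptotic equation. -/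
theorem BeamCharEq.exists_root (ha : 0 < a) (hb : 0 ≤ b) (hα : 0 ≤ α) (h0 : 0 ≤ ξ) (h1 : ξ ≤ 1)
    (hμ : a * l ^ 4 = -(b * μ + μ ^ 2)) (h : BeamCharEq a α ξ μ l) (hl2 : 2 ≤ ‖l‖)
    (hl8 : 8 * (α / √a) ≤ ‖l‖) (hlb : b ≤ √a * ‖l‖ ^ 2) :
    ∃ z : ℂ, Complex.sinh z * Complex.sin z = 0 ∧ ‖l - z‖ ≤ 7 * (α / √a / ‖l‖) := by
  obtain ⟨u, hu, hre⟩ := exists_rotation l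
  have hun := norm_eq_one_of_pow_four hu
  have hn : ‖l * u‖ = ‖l‖ := by rw [norm_mul, hun, mul_one]
  have hl1 : 1 ≤ (l * u).re := by
    have := norm_le_two_mul_re hre
    linarith
  have hlu0 : l * u ≠ 0 := by rw [← norm_pos_iff, hn]; linarith
  have hμ' : a * (l * u) ^ 4 = -(b * μ + μ ^ 2) := by rw [mul_pow, hu, mul_one, hμ]
  obtain ⟨ε, hε⟩ := exists_eps (μ := μ) (α := α) ha hlu0
  have hεn := norm_eps_le ha hb hα hμ' hlu0 (by rwa [hn]) hε
  rw [hn] at hεn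
  have hδ : α / √a / ‖l‖ ≤ 1 / 8 := by
    rw [div_le_iff₀ (by linarith)]; linarith
  have h2 := ((beamCharEq_mul hu).2 h).norm_sin_le ha h0 h1 hε hl1 (by linarith)
  have h3 := norm_sin_mul_sin_le (l * u) h0 (sub_nonneg.2 h1) (by ring)
  obtain ⟨n, hn⟩ := exists_int_norm_sub_le (l := l * u) (norm_nonneg ε) (by linarith)
    (h2.trans (mul_le_mul_of_nonneg_left h3 (by positivity)))
  -- `u³` is the inverse of `u`: it rotates the real root found in the sector back to a root near
  -- `l`.
  have hu3 : (u ^ 3) ^ 4 = 1 := by rw [← pow_mul, mul_comm, pow_mul, hu, one_pow]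
  refine ⟨n * Real.pi * u ^ 3, root_int_mul_pi_mul hu3 n, ?_⟩
  have e : l - n * Real.pi * u ^ 3 = (l * u - n * Real.pi) * u ^ 3 := by
    linear_combination -l * hu
  rw [e, norm_mul, norm_pow, hun, one_pow, mul_one]
  linarith

/-! ### Simplicity of the large eigenvalues -/

theorem integral_sin_sq_mul {c : ℝ} (hc : 0 ≤ c) (hl : l ≠ 0) :
    ∫ x in (0 : ℝ)..c, Complex.sin (l * x) ^ 2 =
      c / 2 - Complex.sin (l * c) * Complex.cos (l * c) / (2 * l) := by
  rw [integral_eq_of_hasDerivAt_off_countable_of_le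
    (fun x : ℝ => (x : ℂ) / 2 - Complex.sin (l * x) * Complex.cos (l * x) / (2 * l)) _ hc
    countable_empty (by fun_prop) (fun x _ => ?_) (Continuous.intervalIntegrable (by fun_prop) _ _)]
  · simp
  · have h1 := hasDerivAt_sin_mul_ofReal l x
    have h2 := hasDerivAt_cos_mul_ofReal l x
    have h3 : HasDerivAt (fun x : ℝ => (x : ℂ) / 2) (1 / 2) x :=
      (Complex.ofRealCLM.hasDerivAt (x := x)).div_const 2
    refine (h3.sub ((h1.mul h2).div_const (2 * l))).congr_deriv ?_
    field_simp
    linear_combination -Complex.sin_sq_add_cos_sq (l * x)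

theorem norm_sin_mul_le_two (him : |l.im| ≤ 1) {x : ℝ} (h0 : 0 ≤ x) (h1 : x ≤ 1) :
    ‖Complex.sin (l * x)‖ ≤ 2 := by
  refine (Complex.norm_sin_le_cosh _).trans (Real.cosh_le_two ?_)
  rw [Complex.im_mul_ofReal, abs_mul, abs_of_nonneg h0]
  exact mul_le_one₀ him h0 h1

theorem norm_cos_mul_le_two (him : |l.im| ≤ 1) {x : ℝ} (h0 : 0 ≤ x) (h1 : x ≤ 1) :
    ‖Complex.cos (l * x)‖ ≤ 2 := by
  refine (Complex.norm_cos_le_cosh _).trans (Real.cosh_le_two ?_)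
  rw [Complex.im_mul_ofReal, abs_mul, abs_of_nonneg h0]
  exact mul_le_one₀ him h0 h1

/-- With `sinh l` factored out, the remaining mode stays bounded as `l` grows along the strip `|Im
l| ≤ 1`, and its hyperbolic part carries the small factor `sin l`. -/
theorem beamMode_eq (hl : 1 ≤ l.re) (c x : ℝ) : beamMode c l 0 x = Complex.sinh l *
    (Complex.sin l * (Complex.sinh (l * (1 - c : ℝ)) * Complex.sinh (l * x) / Complex.sinh l) -
      Complex.sin (l * (1 - c : ℝ)) * Complex.sin (l * x)) := by
  have := sinh_ne_zero_of_one_le_re hl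
  simp only [beamMode, hingedSol]
  field_simp
  ring

/-- Asymptotics of the mass of a normalized mode. -/
theorem norm_integral_mode_sq_le {c δ : ℝ} (hc0 : 0 ≤ c) (hc1 : c ≤ 1) (hl : 1 ≤ l.re)
    (him : |l.im| ≤ 1) (hδ0 : 0 ≤ δ) (hδ : δ ≤ 1 / 16)
    (hs : ‖Complex.sin l‖ ≤ 2 * δ * ‖Complex.sin (l * c) * Complex.sin (l * (1 - c : ℝ))‖) :
    ‖(∫ x in (0 : ℝ)..c, (Complex.sin l * (Complex.sinh (l * (1 - c : ℝ)) * Complex.sinh (l * x) /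
      Complex.sinh l) - Complex.sin (l * (1 - c : ℝ)) * Complex.sin (l * x)) ^ 2) +
      Complex.cos l * (Complex.sin (l * c) * Complex.sin (l * (1 - c : ℝ))) * (c / 2)‖ ≤
    ‖Complex.sin (l * c) * Complex.sin (l * (1 - c : ℝ))‖ * (40 * δ + 6 / ‖l‖) := by
  have hr0 : 0 ≤ 1 - c := by linarith
  have hl0 : l ≠ 0 := by rintro rfl; simp at hl; linarith
  have hn : 0 < ‖l‖ := norm_pos_iff.2 hl0
  have bsr := norm_sin_mul_le_two him hr0 (by linarith)
  have bsc := norm_sin_mul_le_two him hc0 hc1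
  have bcc := norm_cos_mul_le_two him hc0 hc1
  have bcl := norm_cos_mul_le_two him zero_le_one le_rfl
  rw [Complex.ofReal_one, mul_one] at bcl
  have hm : ‖Complex.sin (l * c) * Complex.sin (l * (1 - c : ℝ))‖ ≤ 4 := by
    rw [norm_mul]; nlinarith [norm_nonneg (Complex.sin (l * c))]
  set m := Complex.sin (l * c) * Complex.sin (l * (1 - c : ℝ)) with hmdef
  set S : ℝ → ℂ := fun x => Complex.sin l *
    (Complex.sinh (l * (1 - c : ℝ)) * Complex.sinh (l * x) / Complex.sinh l) with hS
  set T : ℝ → ℂ := fun x => Complex.sin (l * (1 - c : ℝ)) * Complex.sin (l * x) with hT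
  have hSb : ∀ x ∈ Icc 0 c, ‖S x‖ ≤ 4 * δ * ‖m‖ := by
    intro x hx
    have h1 := norm_sinh_mul_sinh_le hl hr0 hx.1 (by linarith [hx.2])
    have h2 : ‖Complex.sinh (l * (1 - c : ℝ)) * Complex.sinh (l * x) / Complex.sinh l‖ ≤ 2 := by
      rw [norm_div, div_le_iff₀ (norm_pos_iff.2 (sinh_ne_zero_of_one_le_re hl))]
      exact h1
    rw [hS, norm_mul]
    have := mul_le_mul hs h2 (norm_nonneg _) (by positivity)
    linarith
  have hTb : ∀ x ∈ Icc 0 c, ‖T x‖ ≤ 4 := by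
    intro x hx
    have h1 := norm_sin_mul_le_two him hx.1 (hx.2.trans hc1)
    rw [hT, norm_mul]
    have := mul_le_mul bsr h1 (norm_nonneg _) (by norm_num)
    linarith
  have cS : Continuous S := by fun_prop
  have cT : Continuous T := by fun_prop
  have split : ∫ x in (0 : ℝ)..c, (S x - T x) ^ 2 =
      (∫ x in (0 : ℝ)..c, T x ^ 2) + ∫ x in (0 : ℝ)..c, S x * (S x - 2 * T x) := by
    rw [← intervalIntegral.integral_add (Continuous.intervalIntegrable (by fun_prop) _ _)
      (Continuous.intervalIntegrable (by fun_prop) _ _)]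
    congr 1
    ext x
    ring
  -- The cross terms are at most `4 δ |m| · (1 + 2 · 4)`, using `|S| ≤ 1` and `|T| ≤ 4`.
  have hI2 : ‖∫ x in (0 : ℝ)..c, S x * (S x - 2 * T x)‖ ≤ 36 * δ * ‖m‖ := by
    have h1 := intervalIntegral.norm_integral_le_of_norm_le_const (a := 0) (b := c)
      (f := fun x => S x * (S x - 2 * T x)) (C := 36 * δ * ‖m‖) (fun x hx => by
        rw [uIoc_of_le hc0] at hx
        have hx' := Ioc_subset_Icc_self hx
        have s1 := hSb x hx'
        have t1 := hTb x hx'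
        have s2 : ‖S x‖ ≤ 1 := by
          refine s1.trans ?_
          nlinarith [norm_nonneg m]
        have e : ‖S x - 2 * T x‖ ≤ 9 := by
          have := norm_sub_le (S x) (2 * T x)
          rw [norm_mul 2, Complex.norm_ofNat] at this
          linarith
        rw [norm_mul]
        have := mul_le_mul s1 e (norm_nonneg _) (by positivity)
        linarith)
    rw [sub_zero, abs_of_nonneg hc0] at h1
    refine h1.trans ?_
    exact mul_le_of_le_one_right (by positivity) hc1
  have hI1 : ∫ x in (0 : ℝ)..c, T x ^ 2 = Complex.sin (l * (1 - c : ℝ)) ^ 2 *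
      (c / 2 - Complex.sin (l * c) * Complex.cos (l * c) / (2 * l)) := by
    rw [← integral_sin_sq_mul hc0 hl0, ← intervalIntegral.integral_const_mul]
    congr 1
    ext x
    simp only [hT]; ring
  -- Only one of the two factors is expanded as `sin(l - l c)`. The square thereby becomes `-m cos
  -- l` plus a multiple of `sin l`, both of which are controlled by `|m|`.
  have hsq : Complex.sin (l * (1 - c : ℝ)) ^ 2 =
      Complex.sin l * (Complex.cos (l * c) * Complex.sin (l * (1 - c : ℝ))) - Complex.cos l * m := by
    have e : l * (1 - c : ℝ) = l - l * c := by push_cast; ring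
    have e2 : Complex.sin (l * (1 - c : ℝ)) =
        Complex.sin l * Complex.cos (l * c) - Complex.cos l * Complex.sin (l * c) := by
      rw [e, Complex.sin_sub]
    rw [sq]
    nth_rewrite 1 [e2]
    rw [hmdef]; ring
  set Y := Complex.sin l * (Complex.cos (l * c) * Complex.sin (l * (1 - c : ℝ))) with hY
  have hYb : ‖Y‖ ≤ 8 * δ * ‖m‖ := by
    rw [hY, norm_mul]
    have h1 : ‖Complex.cos (l * c) * Complex.sin (l * (1 - c : ℝ))‖ ≤ 4 := by
      rw [norm_mul]; nlinarith [norm_nonneg (Complex.cos (l * c))]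
    have := mul_le_mul hs h1 (norm_nonneg _) (by positivity)
    linarith
  set E := Complex.sin (l * c) * Complex.cos (l * c) / (2 * l) with hE
  have hEb : ‖E‖ ≤ 2 / ‖l‖ := by
    rw [hE, norm_div, norm_mul, norm_mul, Complex.norm_ofNat, div_le_div_iff₀ (by positivity) hn]
    have : ‖Complex.sin (l * c)‖ * ‖Complex.cos (l * c)‖ ≤ 4 := by
      nlinarith [norm_nonneg (Complex.sin (l * c))]
    nlinarith
  have hsqb : ‖Y - Complex.cos l * m‖ ≤ 3 * ‖m‖ := by
    have h1 := norm_sub_le Y (Complex.cos l * m)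
    rw [norm_mul (Complex.cos l)] at h1
    nlinarith [norm_nonneg m]
  have e : (∫ x in (0 : ℝ)..c, (S x - T x) ^ 2) + Complex.cos l * m * (c / 2) =
      Y * (c / 2) - (Y - Complex.cos l * m) * E + ∫ x in (0 : ℝ)..c, S x * (S x - 2 * T x) := by
    rw [split, hI1, hsq]; ring
  rw [e]
  have n1 : ‖Y * (c / 2 : ℂ)‖ ≤ 4 * δ * ‖m‖ := by
    have : ‖(c / 2 : ℂ)‖ ≤ 1 / 2 := by
      rw [norm_div, Complex.norm_real, Complex.norm_ofNat, Real.norm_of_nonneg hc0]; linarith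
    rw [norm_mul]
    have := mul_le_mul hYb this (norm_nonneg _) (by positivity)
    linarith
  have n2 : ‖(Y - Complex.cos l * m) * E‖ ≤ ‖m‖ * (6 / ‖l‖) := by
    rw [norm_mul]
    have := mul_le_mul hsqb hEb (norm_nonneg _) (by positivity)
    refine this.trans_eq ?_
    ring
  have n3 := norm_add_le (Y * (c / 2 : ℂ) - (Y - Complex.cos l * m) * E)
    (∫ x in (0 : ℝ)..c, S x * (S x - 2 * T x))
  have n4 := norm_sub_le (Y * (c / 2 : ℂ)) ((Y - Complex.cos l * m) * E)
  linarith

/-- If the product vanished, the bound would force `sin l = 0`, and then neither factor could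
vanish. -/
theorem sin_mul_sin_ne_zero (hξ : Irrational ξ) (hl : l ≠ 0)
    (h : ∃ δ : ℝ, ‖Complex.sin l‖ ≤
      2 * δ * ‖Complex.sin (l * ξ) * Complex.sin (l * (1 - ξ : ℝ))‖) :
    Complex.sin (l * ξ) * Complex.sin (l * (1 - ξ : ℝ)) ≠ 0 := by
  obtain ⟨δ, h⟩ := h
  intro h0
  rw [h0, norm_zero, mul_zero] at h
  have hs : Complex.sin l = 0 := norm_le_zero_iff.1 h
  rcases mul_eq_zero.1 h0 with h1 | h1
  · exact sin_mul_ne_zero_of_sin_eq_zero hξ hl hs h1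
  · refine sin_mul_ne_zero_of_sin_eq_zero (ξ := 1 - ξ) ?_ hl hs h1
    exact_mod_cast hξ.natCast_sub 1

/-- For large eigenvalues the obstruction to Jordan chains does not vanish. -/
theorem BeamCharEq.chain_obstruction_ne_zero (ha : 0 < a) (hb : 0 ≤ b) (hα : 0 ≤ α)
    (h0 : 0 < ξ) (h1 : ξ < 1) (hξ : Irrational ξ) (hμ : a * l ^ 4 = -(b * μ + μ ^ 2))
    (h : BeamCharEq a α ξ μ l) (hre : |l.im| ≤ l.re) (hl2 : 2 ≤ ‖l‖)
    (hlb : b ≤ √a * ‖l‖ ^ 2)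
    (hlk : 8 * (80 * (α / √a) + 12) ≤ ‖l‖) (hμα : 128 * α < ‖2 * μ + b‖) :
    (2 * μ + b) * ((∫ x in (0 : ℝ)..ξ, beamMode ξ l 0 x ^ 2) +
      ∫ x in (0 : ℝ)..(1 - ξ), beamMode (1 - ξ) l 0 x ^ 2) + α * beamMode ξ l 0 ξ ^ 2 ≠ 0 := by
  have hn : 0 < ‖l‖ := by linarith
  have hl0 : l ≠ 0 := norm_pos_iff.1 hn
  have hl1 : 1 ≤ l.re := by
    have := norm_le_two_mul_re hre
    linarith
  obtain ⟨ε, hε⟩ := exists_eps (μ := μ) (α := α) ha hl0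
  have hεn := norm_eps_le ha hb hα hμ hl0 hlb hε
  have hδ : α / √a / ‖l‖ ≤ 1 / 16 := by
    rw [div_le_iff₀ hn]; linarith
  have hs := h.norm_sin_le ha h0.le h1.le hε hl1 (by linarith)
  have h3 := norm_sin_mul_sin_le l h0.le (sub_nonneg.2 h1.le) (by ring)
  have him : |l.im| ≤ 1 := by
    obtain ⟨n, hn⟩ := exists_int_norm_sub_le (l := l) (norm_nonneg ε) (by linarith)
      (hs.trans (mul_le_mul_of_nonneg_left h3 (by positivity)))
    have := (Complex.abs_im_le_norm (l - n * Real.pi)).trans hn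
    have e : (l - n * Real.pi).im = l.im := by simp
    rw [e] at this
    linarith
  have hm0 := sin_mul_sin_ne_zero hξ hl0 ⟨_, hs⟩
  have bsr := norm_sin_mul_le_two him (sub_nonneg.2 h1.le) (by linarith)
  have bsc := norm_sin_mul_le_two him h0.le h1.le
  have hm4 : ‖Complex.sin (l * ξ) * Complex.sin (l * (1 - ξ : ℝ))‖ ≤ 4 := by
    rw [norm_mul]; nlinarith [norm_nonneg (Complex.sin (l * ξ))]
  have hs' : ‖Complex.sin l‖ ≤ 2 * ‖ε‖ *
      ‖Complex.sin (l * (1 - ξ : ℝ)) * Complex.sin (l * (1 - (1 - ξ) : ℝ))‖ := by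
    rwa [sub_sub_cancel, mul_comm (Complex.sin (l * (1 - ξ : ℝ)))]
  have I1 := norm_integral_mode_sq_le h0.le h1.le hl1 him (norm_nonneg ε) (by linarith) hs
  have I2 := norm_integral_mode_sq_le (sub_nonneg.2 h1.le) (by linarith) hl1 him (norm_nonneg ε)
    (by linarith) hs'
  have hq := norm_sinh_mul_sinh_le hl1 (sub_nonneg.2 h1.le) h0.le (by simp)
  have hsh := sinh_ne_zero_of_one_le_re hl1
  simp only [beamMode_eq hl1, mul_pow (Complex.sinh l), intervalIntegral.integral_const_mul]
  rw [sub_sub_cancel, mul_comm (Complex.sin (l * (1 - ξ : ℝ))) (Complex.sin (l * ξ))] at I2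
  rw [sub_sub_cancel]
  set m := Complex.sin (l * ξ) * Complex.sin (l * (1 - ξ : ℝ)) with hm
  set J1 := ∫ x in (0 : ℝ)..ξ, (Complex.sin l * (Complex.sinh (l * (1 - ξ : ℝ)) *
    Complex.sinh (l * x) / Complex.sinh l) - Complex.sin (l * (1 - ξ : ℝ)) *
    Complex.sin (l * x)) ^ 2
  set J2 := ∫ x in (0 : ℝ)..(1 - ξ), (Complex.sin l * (Complex.sinh (l * ξ) *
    Complex.sinh (l * x) / Complex.sinh l) - Complex.sin (l * ξ) * Complex.sin (l * x)) ^ 2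
  have hmp : 0 < ‖m‖ := norm_pos_iff.2 hm0
  have hsn : ‖Complex.sin l‖ ≤ 1 / 2 := by
    refine hs.trans ?_
    have := mul_le_mul (show 2 * ‖ε‖ ≤ 1 / 8 by linarith) hm4 hmp.le (by norm_num)
    linarith
  have hcos : 1 / 2 ≤ ‖Complex.cos l‖ := by
    have e : ‖(1 : ℂ)‖ ≤ ‖Complex.sin l‖ ^ 2 + ‖Complex.cos l‖ ^ 2 := by
      rw [← Complex.sin_sq_add_cos_sq l, ← norm_pow, ← norm_pow]
      exact norm_add_le _ _
    rw [norm_one] at e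
    by_contra! hlt
    nlinarith [norm_nonneg (Complex.cos l), norm_nonneg (Complex.sin l)]
  have herr : 80 * ‖ε‖ + 12 / ‖l‖ ≤ 1 / 8 := by
    have : 80 * (α / √a / ‖l‖) + 12 / ‖l‖ ≤ 1 / 8 := by
      have e : 80 * (α / √a / ‖l‖) + 12 / ‖l‖ = (80 * (α / √a) + 12) / ‖l‖ := by ring
      rw [e, div_le_iff₀ hn]; linarith
    linarith
  -- The weights `ξ/2` and `(1 - ξ)/2` add up to `1/2`, so the main term is `m cos l / 2`, of
  -- modulus at least `|m|/4`. The errors take away at most `|m|/8`.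
  have hI : ‖m‖ / 8 ≤ ‖J1 + J2‖ := by
    have e1 : Complex.cos l * m / 2 = (J1 + Complex.cos l * m * (ξ / 2)) +
        (J2 + Complex.cos l * m * ((1 - ξ : ℝ) / 2)) - (J1 + J2) := by push_cast; ring
    have e2 := norm_sub_le ((J1 + Complex.cos l * m * (ξ / 2)) +
        (J2 + Complex.cos l * m * ((1 - ξ : ℝ) / 2))) (J1 + J2)
    have e3 := norm_add_le (J1 + Complex.cos l * m * (ξ / 2))
        (J2 + Complex.cos l * m * ((1 - ξ : ℝ) / 2))
    rw [← e1, norm_div, norm_mul, Complex.norm_ofNat] at e2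
    have e4 := mul_le_mul_of_nonneg_left herr hmp.le
    have e5 := mul_le_mul_of_nonneg_right hcos hmp.le
    have e6 : ‖m‖ * (40 * ‖ε‖ + 6 / ‖l‖) + ‖m‖ * (40 * ‖ε‖ + 6 / ‖l‖) =
      ‖m‖ * (80 * ‖ε‖ + 12 / ‖l‖) := by ring
    linarith
  set V := Complex.sin l * (Complex.sinh (l * (1 - ξ : ℝ)) * Complex.sinh (l * ξ) /
    Complex.sinh l) - Complex.sin (l * (1 - ξ : ℝ)) * Complex.sin (l * ξ) with hV
  have hVb : ‖V‖ ≤ 2 * ‖m‖ := by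
    have h2 : ‖Complex.sinh (l * (1 - ξ : ℝ)) * Complex.sinh (l * ξ) / Complex.sinh l‖ ≤ 2 := by
      rw [norm_div, div_le_iff₀ (norm_pos_iff.2 hsh)]
      exact hq
    have e1 := norm_sub_le (Complex.sin l * (Complex.sinh (l * (1 - ξ : ℝ)) * Complex.sinh (l * ξ) /
      Complex.sinh l)) (Complex.sin (l * (1 - ξ : ℝ)) * Complex.sin (l * ξ))
    rw [← hV, mul_comm (Complex.sin (l * (1 - ξ : ℝ))) (Complex.sin (l * ξ)), ← hm,
      norm_mul (Complex.sin l)] at e1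
    have e2 := mul_le_mul hs h2 (norm_nonneg _) (by positivity)
    nlinarith
  have hV2 : ‖(α : ℂ) * V ^ 2‖ ≤ α * (16 * ‖m‖) := by
    rw [norm_mul, norm_pow, Complex.norm_real, Real.norm_of_nonneg hα]
    refine mul_le_mul_of_nonneg_left ?_ hα
    nlinarith [norm_nonneg V]
  -- After cancelling `sinh² l`, the identity would give `|2 μ + b| |m| / 8 ≤ 16 α |m|`. Since `m ≠
  -- 0`, this contradicts `128 α < |2 μ + b|`.
  intro hz
  have hz' : Complex.sinh l ^ 2 * ((2 * μ + b) * (J1 + J2) + α * V ^ 2) = 0 := by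
    linear_combination hz
  have hz2 := (mul_eq_zero.1 hz').resolve_left (pow_ne_zero 2 hsh)
  have hz3 : ‖(2 * μ + b) * (J1 + J2)‖ = ‖(α : ℂ) * V ^ 2‖ := by
    rw [eq_neg_of_add_eq_zero_left hz2, norm_neg]
  rw [norm_mul] at hz3
  have h5 := mul_le_mul_of_nonneg_left hI (norm_nonneg (2 * μ + b))
  have h6 := mul_lt_mul_of_pos_right hμα (show 0 < ‖m‖ / 8 by positivity)
  linarith

end

/-! ### Exactly one solution near each large root -/

theorem Complex.cos_sub_int_mul_pi_eq (l : ℂ) (n : ℤ) :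
    Complex.cos (l - n * Real.pi) = (-1) ^ n * Complex.cos l := by
  rw [Complex.cos_antiperiodic.sub_int_mul_eq n, Int.cast_negOnePow]

/-- A small holomorphic perturbation of `sin` has exactly one zero near each `n π`. -/
theorem exists_unique_zero_sin_add : ∃ r η : ℝ, 0 < r ∧ r ≤ 1 / 2 ∧ 0 < η ∧
    ∀ (n : ℤ) (G : ℂ → ℂ), DifferentiableOn ℂ G (Metric.ball (n * Real.pi : ℂ) 1) →
      (∀ l ∈ Metric.ball (n * Real.pi : ℂ) 1, ‖G l‖ ≤ η) →
      ∃ l ∈ Metric.closedBall (n * Real.pi : ℂ) r, Complex.sin l + G l = 0 ∧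
        ‖l - n * Real.pi‖ ≤ 2 * ‖G (n * Real.pi)‖ ∧
        ∀ l' ∈ Metric.closedBall (n * Real.pi : ℂ) r, Complex.sin l' + G l' = 0 → l' = l := by
  obtain ⟨δ, hδ0, hδ⟩ := Metric.continuousAt_iff.1
    (show ContinuousAt (fun w : ℂ => 1 - Complex.cos w) 0 by fun_prop) (1 / 4) (by norm_num)
  simp only [Complex.cos_zero, sub_self, dist_zero_right] at hδ
  set r := min (δ / 2) (1 / 2) with hr
  have r0 : 0 < r := lt_min (by linarith) (by norm_num)
  have r1 : r ≤ 1 / 2 := min_le_right _ _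
  have r2 : r ≤ δ / 2 := min_le_left _ _
  -- The bound `1/16` yields `|G'| ≤ 1/4` by Cauchy's estimate on discs of radius `1/4`; the bound
  -- `r/2` makes the closed disc stable under the iteration.
  refine ⟨r, min (1 / 16) (r / 2), r0, r1, lt_min (by norm_num) (by linarith), ?_⟩
  intro n G hG hGb
  set c : ℂ := n * Real.pi with hc
  set σ : ℂ := (-1) ^ n with hσ
  have hσ1 : ‖σ‖ = 1 := by rw [hσ, norm_zpow, norm_neg, norm_one, one_zpow]
  have hσ0 : σ ≠ 0 := norm_pos_iff.1 (by rw [hσ1]; exact one_pos)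
  -- A simplified Newton map: `σ = (-1)ⁿ` is the inverse of the derivative of `sin` at `n π`, so
  -- `g'` is at most `1/2` in modulus on the small disc.
  set g : ℂ → ℂ := fun l => l - σ * (Complex.sin l + G l) with hg
  have hfix (l : ℂ) : g l = l ↔ Complex.sin l + G l = 0 := by
    simp [hg, hσ0]
  have hsub : Metric.closedBall c r ⊆ Metric.ball c 1 :=
    Metric.closedBall_subset_ball (by linarith)
  have hd : ∀ l ∈ Metric.closedBall c r,
      HasDerivWithinAt g (1 - σ * (Complex.cos l + deriv G l)) (Metric.closedBall c r) l := by
    intro l hl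
    have h1 := (hG.differentiableAt (Metric.isOpen_ball.mem_nhds (hsub hl))).hasDerivAt
    exact ((hasDerivAt_id l).sub (((Complex.hasDerivAt_sin l).add h1).const_mul σ)).hasDerivWithinAt
  have hdb : ∀ l ∈ Metric.closedBall c r, ‖1 - σ * (Complex.cos l + deriv G l)‖ ≤ 1 / 2 := by
    intro l hl
    rw [Metric.mem_closedBall, dist_eq_norm] at hl
    have hcl : Metric.closedBall l (1 / 4) ⊆ Metric.ball c 1 := by
      intro w hw
      rw [Metric.mem_closedBall, dist_eq_norm] at hw
      rw [Metric.mem_ball, dist_eq_norm]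
      have := norm_add_le (w - l) (l - c)
      rw [sub_add_sub_cancel] at this
      linarith
    have h1 : ‖deriv G l‖ ≤ (1 / 16) / (1 / 4) := by
      refine Complex.norm_deriv_le_of_forall_mem_sphere_norm_le (by norm_num) ?_ ?_
      · exact (hG.mono hcl).diffContOnCl_ball subset_rfl
      · intro w hw
        exact (hGb w (hcl (Metric.sphere_subset_closedBall hw))).trans (min_le_left _ _)
    have h2 : ‖1 - Complex.cos (l - c)‖ < 1 / 4 := hδ (by linarith)
    rw [hc, Complex.cos_sub_int_mul_pi_eq, ← hσ] at h2
    have e : 1 - σ * (Complex.cos l + deriv G l) = (1 - σ * Complex.cos l) - σ * deriv G l := by ring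
    have h3 := norm_sub_le (1 - σ * Complex.cos l) (σ * deriv G l)
    rw [norm_mul σ (deriv G l), hσ1, one_mul] at h3
    rw [e]
    linarith
  have hlip : ∀ l ∈ Metric.closedBall c r, ∀ l' ∈ Metric.closedBall c r,
      ‖g l' - g l‖ ≤ 1 / 2 * ‖l' - l‖ := fun l hl l' hl' =>
    (convex_closedBall c r).norm_image_sub_le_of_norm_hasDerivWithin_le hd hdb hl hl'
  have hcm : c ∈ Metric.closedBall c r := Metric.mem_closedBall_self r0.le
  have hgc : ‖g c - c‖ = ‖G c‖ := by
    have : Complex.sin c = 0 := Complex.sin_eq_zero_iff.2 ⟨n, rfl⟩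
    simp [hg, this, hσ1]
  have hGc : ‖G c‖ ≤ r / 2 := (hGb c (hsub hcm)).trans (min_le_right _ _)
  have hmaps : MapsTo g (Metric.closedBall c r) (Metric.closedBall c r) := by
    intro l hl
    have h1 := hlip c hcm l hl
    rw [Metric.mem_closedBall, dist_eq_norm] at hl ⊢
    have h2 := norm_add_le (g l - g c) (g c - c)
    rw [sub_add_sub_cancel] at h2
    linarith
  have hcon : ContractingWith (1 / 2) (hmaps.restrict g _ _) := by
    refine ⟨by rw [← NNReal.coe_lt_coe]; norm_num, LipschitzWith.of_dist_le_mul ?_⟩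
    rintro ⟨x, hx⟩ ⟨y, hy⟩
    have := hlip y hy x hx
    rw [Subtype.dist_eq, Subtype.dist_eq, dist_eq_norm, dist_eq_norm]
    simpa using this
  obtain ⟨l, hl, hf, -⟩ := hcon.exists_fixedPoint' Metric.isClosed_closedBall.isComplete hmaps hcm
    (edist_ne_top _ _)
  have hgl : g l = l := hf
  refine ⟨l, hl, (hfix l).1 hgl, ?_, fun l' hl' h' => ?_⟩
  -- With Lipschitz constant `1/2`, `|l - c| ≤ |l - c| / 2 + |G(c)|`, which gives the factor `2`.
  · have h1 := hlip c hcm l hl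
    have h2 := norm_add_le (g l - g c) (g c - c)
    rw [sub_add_sub_cancel, hgl] at h2
    rw [hgl] at h1
    linarith
  · have h1 := hlip l hl l' hl'
    rw [hgl, (hfix l').2 h'] at h1
    have : ‖l' - l‖ = 0 := le_antisymm (by linarith) (norm_nonneg _)
    exact sub_eq_zero.1 (norm_eq_zero.1 this)

theorem Complex.exp_half_log_sq {x : ℂ} (hx : x ≠ 0) : Complex.exp (Complex.log x / 2) ^ 2 = x := by
  rw [← Complex.exp_nat_mul]
  conv_rhs => rw [← Complex.exp_log hx]
  congr 1
  push_cast
  ring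

theorem Complex.exp_half_log_re_nonneg (x : ℂ) : 0 ≤ (Complex.exp (Complex.log x / 2)).re := by
  rw [Complex.exp_re]
  refine mul_nonneg (Real.exp_pos _).le (Real.cos_nonneg_of_mem_Icc ?_)
  have e : (Complex.log x / 2).im = Complex.arg x / 2 := by
    rw [← Complex.log_im x]; simp
  rw [e]
  exact ⟨by linarith [Complex.neg_pi_lt_arg x], by linarith [Complex.arg_le_pi x]⟩

/-- For the square root `q` with `Re q ≥ 0`, `|q - 1| |q + 1| = |t|` and `|q + 1| ≥ 1`. -/
theorem norm_exp_half_log_sub_one_le {t : ℂ} (ht : ‖t‖ < 1) :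
    ‖Complex.exp (Complex.log (1 - t) / 2) - 1‖ ≤ ‖t‖ := by
  have h0 : 1 - t ≠ 0 := by
    intro h
    rw [← sub_eq_zero.1 h, norm_one] at ht
    exact lt_irrefl _ ht
  have h1 := Complex.exp_half_log_sq h0
  have h2 := Complex.exp_half_log_re_nonneg (1 - t)
  set q := Complex.exp (Complex.log (1 - t) / 2)
  have h3 : ‖q - 1‖ * ‖q + 1‖ = ‖t‖ := by
    rw [← norm_mul, ← norm_neg t]; congr 1; linear_combination h1
  have h4 : 1 ≤ ‖q + 1‖ := by
    have := Complex.re_le_norm (q + 1)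
    rw [Complex.add_re, Complex.one_re] at this
    linarith
  rw [← h3]
  exact le_mul_of_one_le_right (norm_nonneg _) h4

/-- A holomorphic branch `μ = M(l)` of the relation `a l⁴ = -(b μ + μ²)`, with `Im μ` of given
sign. -/
theorem exists_branch {a b s X : ℝ} (ha : 0 < a) (hb : 0 ≤ b) (hs : s ^ 2 = 1) (hX : 16 ≤ X)
    (hXb : b ≤ √a * (X - 1) ^ 2) : ∃ M : ℂ → ℂ, DifferentiableOn ℂ M (Metric.ball (X : ℂ) 1) ∧
      ∀ l ∈ Metric.ball (X : ℂ) 1, a * l ^ 4 = -(b * M l + M l ^ 2) ∧ 0 < s * (M l).im := by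
  have hsa : 0 < √a := Real.sqrt_pos.2 ha
  have ha' : (a : ℂ) ≠ 0 := by exact_mod_cast ha.ne'
  have hsq : ((√a : ℝ) : ℂ) ^ 2 = a := by exact_mod_cast Real.sq_sqrt ha.le
  have hs' : (s : ℂ) ^ 2 = 1 := by exact_mod_cast hs
  have hX0 : (X : ℂ) ≠ 0 := by exact_mod_cast (show X ≠ 0 by linarith)
  -- Completing the square turns the relation into `(μ + b/2)² = -a l⁴ (1 - b² / (4 a l⁴))`. The
  -- function `q` is the principal square root of the last factor, which stays near `1`.
  let q : ℂ → ℂ := fun l => Complex.exp (Complex.log (1 - b ^ 2 / (4 * a * l ^ 4)) / 2)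
  have key : ∀ l ∈ Metric.ball (X : ℂ) 1, l ≠ 0 ∧ ‖(b : ℂ) ^ 2 / (4 * a * l ^ 4)‖ ≤ 1 / 4 := by
    intro l hl
    rw [Metric.mem_ball, dist_eq_norm] at hl
    have hn : X - 1 ≤ ‖l‖ := by
      have := norm_sub_norm_le (X : ℂ) l
      rw [norm_sub_rev, Complex.norm_real, Real.norm_of_nonneg (by linarith)] at this
      linarith
    have hl0 : 0 < ‖l‖ := by linarith
    refine ⟨norm_pos_iff.1 hl0, ?_⟩
    rw [norm_div, norm_mul, norm_mul, norm_pow, norm_pow, Complex.norm_real, Complex.norm_real,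
      Complex.norm_ofNat, Real.norm_of_nonneg ha.le, Real.norm_of_nonneg hb,
      div_le_iff₀ (by positivity)]
    have h1 : b ≤ √a * ‖l‖ ^ 2 := hXb.trans
      (mul_le_mul_of_nonneg_left (pow_le_pow_left₀ (by linarith) hn 2) hsa.le)
    have h2 : b ^ 2 ≤ (√a * ‖l‖ ^ 2) ^ 2 := pow_le_pow_left₀ hb h1 2
    rw [mul_pow, Real.sq_sqrt ha.le] at h2
    linarith
  refine ⟨fun l => -b / 2 + s * Complex.I * √a * l ^ 2 * q l, ?_, fun l hl => ⟨?_, ?_⟩⟩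
  · intro l hl
    obtain ⟨hl0, ht⟩ := key l hl
    have hd : DifferentiableAt ℂ (fun l : ℂ => 1 - (b : ℂ) ^ 2 / (4 * a * l ^ 4)) l := by
      refine (differentiableAt_const _).sub ((differentiableAt_const _).div (by fun_prop) ?_)
      simp [ha', hl0]
    have hslit : 1 - (b : ℂ) ^ 2 / (4 * a * l ^ 4) ∈ Complex.slitPlane := by
      refine Or.inl ?_
      have := Complex.re_le_norm ((b : ℂ) ^ 2 / (4 * a * l ^ 4))
      rw [Complex.sub_re, Complex.one_re]
      linarith
    have hq : DifferentiableAt ℂ q l := ((hd.clog hslit).div_const 2).cexp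
    have hp : DifferentiableAt ℂ (fun l : ℂ => (s : ℂ) * Complex.I * √a * l ^ 2) l := by fun_prop
    exact ((hp.mul hq).const_add _).differentiableWithinAt
  · obtain ⟨hl0, ht⟩ := key l hl
    have h0 : 1 - (b : ℂ) ^ 2 / (4 * a * l ^ 4) ≠ 0 := by
      intro h
      rw [← sub_eq_zero.1 h, norm_one] at ht
      norm_num at ht
    have hq2 : q l ^ 2 = 1 - (b : ℂ) ^ 2 / (4 * a * l ^ 4) := Complex.exp_half_log_sq h0
    have hq3 : a * l ^ 4 * q l ^ 2 = a * l ^ 4 - b ^ 2 / 4 := by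
      rw [hq2]; field_simp
    have e : ((s : ℂ) * Complex.I * √a * l ^ 2 * q l) ^ 2 = -(a * l ^ 4 * q l ^ 2) := by
      calc _ = (s : ℂ) ^ 2 * Complex.I ^ 2 * (√a : ℂ) ^ 2 * l ^ 4 * q l ^ 2 := by ring
        _ = _ := by rw [hs', hsq, Complex.I_sq]; ring
    linear_combination e - hq3
  · obtain ⟨hl0, ht⟩ := key l hl
    have hq1 : ‖q l - 1‖ ≤ 1 / 4 := (norm_exp_half_log_sub_one_le (by linarith)).trans ht
    rw [Metric.mem_ball, dist_eq_norm] at hl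
    set v := (l - X) / X with hv
    have hvn : ‖v‖ ≤ 1 / 16 := by
      rw [hv, norm_div, Complex.norm_real, Real.norm_of_nonneg (by linarith),
        div_le_iff₀ (by linarith)]
      linarith
    have hlv : l = X * (1 + v) := by rw [hv]; field_simp; ring
    -- `M(l) + b/2 = s i √a X² y` with `|y - 1| < 1`, so `Im M(l)` has the sign of `s`.
    set y := (1 + v) ^ 2 * q l with hy
    have hy1 : ‖y - 1‖ < 1 := by
      have e : y - 1 = (1 + v) ^ 2 * (q l - 1) + v * (2 + v) := by rw [hy]; ring
      have h1 : ‖1 + v‖ ≤ 17 / 16 := by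
        have := norm_add_le 1 v
        rw [norm_one] at this
        linarith
      have h2 : ‖2 + v‖ ≤ 33 / 16 := by
        have := norm_add_le 2 v
        rw [Complex.norm_ofNat] at this
        linarith
      have h3 : ‖(1 + v) ^ 2 * (q l - 1)‖ ≤ (17 / 16) ^ 2 * (1 / 4) := by
        rw [norm_mul, norm_pow]
        exact mul_le_mul (pow_le_pow_left₀ (norm_nonneg _) h1 2) hq1 (norm_nonneg _) (by norm_num)
      have h4 : ‖v * (2 + v)‖ ≤ 1 / 16 * (33 / 16) := by
        rw [norm_mul]
        exact mul_le_mul hvn h2 (norm_nonneg _) (by norm_num)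
      have h5 := norm_add_le ((1 + v) ^ 2 * (q l - 1)) (v * (2 + v))
      rw [e]
      linarith
    have hyre : 0 < y.re := by
      have := (Complex.abs_re_le_norm (y - 1)).trans_lt hy1
      rw [Complex.sub_re, Complex.one_re, abs_lt] at this
      linarith
    have him : (-(b : ℂ) / 2 + s * Complex.I * √a * l ^ 2 * q l) =
        ((-b / 2 : ℝ) : ℂ) + ((s * √a * X ^ 2 : ℝ) : ℂ) * (y * Complex.I) := by
      rw [hy]
      conv_lhs => rw [show l ^ 2 = (X * (1 + v)) ^ 2 by rw [← hlv]]
      push_cast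
      ring
    beta_reduce
    rw [him, Complex.add_im, Complex.ofReal_im, Complex.im_ofReal_mul, Complex.mul_I_im, zero_add]
    have e : s * (s * √a * X ^ 2 * y.re) = s ^ 2 * (√a * X ^ 2 * y.re) := by ring
    rw [e, hs, one_mul]
    have : 0 < X := by linarith
    positivity

theorem beamCharEq_iff_sin_add {a α ξ : ℝ} (ha : 0 < a) {μ l : ℂ} (hl : 1 ≤ l.re) :
    BeamCharEq a α ξ μ l ↔ Complex.sin l + -(α * μ / (2 * a * l ^ 3)) *
      (Complex.sin l * (Complex.sinh (l * ξ) * Complex.sinh (l * (1 - ξ : ℝ)) / Complex.sinh l) -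
        Complex.sin (l * ξ) * Complex.sin (l * (1 - ξ : ℝ))) = 0 := by
  have hs := sinh_ne_zero_of_one_le_re hl
  have hl0 : l ≠ 0 := by rintro rfl; simp at hl; linarith
  have ha' : (a : ℂ) ≠ 0 := by exact_mod_cast ha.ne'
  unfold BeamCharEq
  have hne : 2 * a * l ^ 3 * Complex.sinh l ≠ 0 := by simp [hs, hl0, ha']
  have e : 2 * a * l ^ 3 * Complex.sinh l * (Complex.sin l + -(α * μ / (2 * a * l ^ 3)) *
      (Complex.sin l * (Complex.sinh (l * ξ) * Complex.sinh (l * (1 - ξ : ℝ)) / Complex.sinh l) -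
        Complex.sin (l * ξ) * Complex.sin (l * (1 - ξ : ℝ)))) =
      2 * a * l ^ 3 * (Complex.sinh l * Complex.sin l) -
      α * μ * (Complex.sin l * (Complex.sinh (l * ξ) * Complex.sinh (l * (1 - ξ : ℝ))) -
      Complex.sinh l * (Complex.sin (l * ξ) * Complex.sin (l * (1 - ξ : ℝ)))) := by
    field_simp
    ring
  constructor
  · intro h
    rw [h, sub_self] at e
    exact (mul_eq_zero.1 e).resolve_left hne
  · intro h
    rw [h, mul_zero] at e
    exact sub_eq_zero.1 e.symm

/-- Near a large `n π` the characteristic equation has exactly one solution with `Im μ` of given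
sign. -/
theorem exists_unique_beamCharEq : ∃ r η : ℝ, 0 < r ∧ r ≤ 1 / 2 ∧ 0 < η ∧
    ∀ (a b α ξ s : ℝ) (n : ℕ), 0 < a → 0 ≤ b → 0 ≤ α → 0 ≤ ξ → ξ ≤ 1 → s ^ 2 = 1 →
      16 ≤ n * Real.pi → b ≤ √a * (n * Real.pi - 1) ^ 2 →
      8 * (α / √a) ≤ η * (n * Real.pi - 1) →
      ∃ μ l : ℂ, (a * l ^ 4 = -(b * μ + μ ^ 2) ∧ 0 < s * μ.im ∧ BeamCharEq a α ξ μ l) ∧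
        ‖l - n * Real.pi‖ ≤ r ∧ ‖l - n * Real.pi‖ ≤ 16 * (α / √a) / (n * Real.pi) ∧
        ∀ μ' l' : ℂ, a * l' ^ 4 = -(b * μ' + μ' ^ 2) → 0 < s * μ'.im → BeamCharEq a α ξ μ' l' →
          ‖l' - n * Real.pi‖ ≤ r → μ' = μ ∧ l' = l := by
  obtain ⟨r, η, r0, r1, η0, H⟩ := exists_unique_zero_sin_add
  refine ⟨r, η, r0, r1, η0, ?_⟩
  intro a b α ξ s n ha hb hα hξ0 hξ1 hs hX hXb hXη
  set X : ℝ := n * Real.pi with hXdef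
  have hXc : ((n : ℤ) : ℂ) * Real.pi = X := by rw [hXdef]; push_cast; ring
  have hXc' : (n : ℂ) * Real.pi = X := by rw [hXdef]; push_cast; ring
  obtain ⟨M, hM, hM'⟩ := exists_branch ha hb hs hX hXb
  have hsa : 0 < √a := Real.sqrt_pos.2 ha
  have ha' : (a : ℂ) ≠ 0 := by exact_mod_cast ha.ne'
  have ball_norm : ∀ l ∈ Metric.ball (X : ℂ) 1, X - 1 ≤ ‖l‖ ∧ 1 ≤ l.re ∧ |l.im| ≤ 1 := by
    intro l hl
    rw [Metric.mem_ball, dist_eq_norm] at hl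
    have h1 := norm_sub_norm_le (X : ℂ) l
    rw [norm_sub_rev, Complex.norm_real, Real.norm_of_nonneg (by linarith)] at h1
    have h2 := (Complex.abs_re_le_norm (l - X)).trans hl.le
    have h3 := (Complex.abs_im_le_norm (l - X)).trans hl.le
    rw [Complex.sub_re, Complex.ofReal_re, abs_le] at h2
    rw [Complex.sub_im, Complex.ofReal_im, sub_zero] at h3
    exact ⟨by linarith, by linarith, h3⟩
  set G : ℂ → ℂ := fun l => -(α * M l / (2 * a * l ^ 3)) *
      (Complex.sin l * (Complex.sinh (l * ξ) * Complex.sinh (l * (1 - ξ : ℝ)) / Complex.sinh l) -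
        Complex.sin (l * ξ) * Complex.sin (l * (1 - ξ : ℝ))) with hG
  have hGd : DifferentiableOn ℂ G (Metric.ball (X : ℂ) 1) := by
    intro l hl
    obtain ⟨b1, b2, -⟩ := ball_norm l hl
    have hl0 : l ≠ 0 := norm_pos_iff.1 (by linarith)
    have d1 : DifferentiableAt ℂ M l := hM.differentiableAt (Metric.isOpen_ball.mem_nhds hl)
    refine DifferentiableAt.differentiableWithinAt ?_
    refine (((d1.const_mul _).div (by fun_prop) (by simp [ha', hl0])).neg).mul ?_
    refine DifferentiableAt.sub (DifferentiableAt.mul (by fun_prop) (DifferentiableAt.div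
      (by fun_prop) (by fun_prop) (sinh_ne_zero_of_one_le_re b2))) (by fun_prop)
  -- In the strip the bracket in `G` is at most `2 · 2 + 2 · 2 = 8`.
  have hGb : ∀ l ∈ Metric.ball (X : ℂ) 1, ‖G l‖ ≤ 8 * (α / √a / ‖l‖) := by
    intro l hl
    obtain ⟨b1, b2, b3⟩ := ball_norm l hl
    have hl0 : l ≠ 0 := norm_pos_iff.1 (by linarith)
    have hbl : b ≤ √a * ‖l‖ ^ 2 := hXb.trans
      (mul_le_mul_of_nonneg_left (pow_le_pow_left₀ (by linarith) b1 2) hsa.le)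
    have e1 := norm_eps_le (ε := α * M l / (2 * a * l ^ 3)) ha hb hα (hM' l hl).1 hl0 hbl
      (by field_simp)
    have e2 := norm_sinh_mul_sinh_le b2 hξ0 (sub_nonneg.2 hξ1) (by simp)
    have e3 : ‖Complex.sinh (l * ξ) * Complex.sinh (l * (1 - ξ : ℝ)) / Complex.sinh l‖ ≤ 2 := by
      rw [norm_div, div_le_iff₀ (norm_pos_iff.2 (sinh_ne_zero_of_one_le_re b2))]
      exact e2
    have e4 : ‖Complex.sin l‖ ≤ 2 := by
      have := norm_sin_mul_le_two b3 zero_le_one le_rfl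
      rwa [Complex.ofReal_one, mul_one] at this
    have e5 := mul_le_mul (norm_sin_mul_le_two b3 hξ0 hξ1)
      (norm_sin_mul_le_two b3 (sub_nonneg.2 hξ1) (by linarith)) (norm_nonneg _) (by norm_num)
    have e6 := mul_le_mul e4 e3 (norm_nonneg _) (by norm_num)
    have e7 := norm_sub_le (Complex.sin l * (Complex.sinh (l * ξ) * Complex.sinh (l * (1 - ξ : ℝ)) /
      Complex.sinh l)) (Complex.sin (l * ξ) * Complex.sin (l * (1 - ξ : ℝ)))
    rw [norm_mul (Complex.sin l), norm_mul (Complex.sin (l * ξ))] at e7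
    rw [hG, norm_mul, norm_neg]
    have := mul_le_mul e1 (show _ ≤ (8 : ℝ) by linarith) (norm_nonneg _) (by positivity)
    linarith
  obtain ⟨l, hl, h1, h2, h3⟩ := H n G (by rwa [hXc]) (by
    rw [hXc]
    intro l hl
    refine (hGb l hl).trans ?_
    obtain ⟨b1, -, -⟩ := ball_norm l hl
    have : 8 * (α / √a / ‖l‖) = 8 * (α / √a) / ‖l‖ := by ring
    rw [this, div_le_iff₀ (by linarith)]
    nlinarith)
  rw [hXc] at hl h2 h3
  have hsub : Metric.closedBall (X : ℂ) r ⊆ Metric.ball (X : ℂ) 1 :=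
    Metric.closedBall_subset_ball (by linarith)
  have hlb := hsub hl
  rw [hXc']
  refine ⟨M l, l, ⟨(hM' l hlb).1, (hM' l hlb).2, ?_⟩, by simpa [dist_eq_norm] using hl, ?_, ?_⟩
  · rw [beamCharEq_iff_sin_add ha (ball_norm l hlb).2.1]
    exact h1
  · have := hGb X (Metric.mem_ball_self one_pos)
    rw [Complex.norm_real, Real.norm_of_nonneg (by linarith)] at this
    refine h2.trans ?_
    have e : 16 * (α / √a) / X = 2 * (8 * (α / √a / X)) := by ring
    rw [e]; linarith
  · intro μ' l' hμ' hs' hc' hl'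
    have hl'm : l' ∈ Metric.closedBall (X : ℂ) r := by simpa [dist_eq_norm] using hl'
    have hl'b := hsub hl'm
    obtain ⟨m1, m2⟩ := hM' l' hl'b
    -- The two solutions `μ` for a given `l` add up to the real number `-b`, so their imaginary
    -- parts are opposite and the sign condition selects the branch `M`.
    have hμM : μ' = M l' := by
      have e : (μ' - M l') * (μ' + M l' + b) = 0 := by linear_combination hμ' - m1
      rcases mul_eq_zero.1 e with h | h
      · exact sub_eq_zero.1 h
      · have := congrArg Complex.im h
        simp only [Complex.add_im, Complex.ofReal_im, add_zero, Complex.zero_im] at this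
        have e2 : s * μ'.im + s * (M l').im = 0 := by rw [← mul_add, this, mul_zero]
        linarith
    have hll : l' = l := h3 l' hl'm (by
      rw [hμM, beamCharEq_iff_sin_add ha (ball_norm l' hl'b).2.1] at hc'
      exact hc')
    exact ⟨by rw [hμM, hll], hll⟩

/-! ### Thresholds and conclusion -/

theorem pow_four_eq_div_iff {a b : ℝ} (ha : 0 < a) {μ l : ℂ} :
    l ^ 4 = -(b * μ + μ ^ 2) / a ↔ a * l ^ 4 = -(b * μ + μ ^ 2) := by
  have ha' : (a : ℂ) ≠ 0 := by exact_mod_cast ha.ne'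
  rw [eq_div_iff ha', mul_comm]

theorem exists_norm_root_eq {z : ℂ} (h : Complex.sinh z * Complex.sin z = 0) :
    ∃ n : ℕ, ‖z‖ = n * Real.pi := by
  obtain ⟨n, u, hu, rfl⟩ := exists_eq_nat_mul_pi_mul_of_root h
  refine ⟨n, ?_⟩
  rw [norm_mul, norm_mul, norm_eq_one_of_pow_four hu, Complex.norm_natCast, Complex.norm_real,
    Real.norm_of_nonneg Real.pi_pos.le, mul_one]

/-- A large eigenvalue has only large `l`'s. -/
theorem lt_norm_of_lt_norm {a b t R : ℝ} (ha : 0 < a) (hb : 0 ≤ b)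
    (htR : √a * t ^ 2 ≤ R - b) {μ l : ℂ} (hμ : a * l ^ 4 = -(b * μ + μ ^ 2)) (h : R < ‖μ‖) :
    t < ‖l‖ := by
  by_contra! hle
  have h1 := mul_norm_pow_four ha hμ
  have h2 := norm_sub_le_norm_add_ofReal (μ := μ) hb
  have h3 : √a * ‖l‖ ^ 2 ≤ √a * t ^ 2 :=
    mul_le_mul_of_nonneg_left (pow_le_pow_left₀ (norm_nonneg _) hle 2) (Real.sqrt_nonneg a)
  have h4 : a * ‖l‖ ^ 4 = (√a * ‖l‖ ^ 2) ^ 2 := by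
    rw [mul_pow, Real.sq_sqrt ha.le]; ring
  rw [h4] at h1
  have hX : 0 ≤ √a * ‖l‖ ^ 2 := by positivity
  set X := √a * ‖l‖ ^ 2
  nlinarith [norm_nonneg μ]

/-- An eigenvalue with a large `l` is large. -/
theorem lt_norm_of_lt_norm' {a b t R : ℝ} (ha : 0 < a) (hb : 0 ≤ b) (ht : 0 ≤ t)
    (htR : R + b < √a * t ^ 2) {μ l : ℂ} (hμ : a * l ^ 4 = -(b * μ + μ ^ 2)) (h : t ≤ ‖l‖) :
    R < ‖μ‖ := by
  by_contra! hle
  have h1 := mul_norm_pow_four ha hμ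
  have h2 := norm_add_ofReal_le (μ := μ) hb
  have h3 : √a * t ^ 2 ≤ √a * ‖l‖ ^ 2 :=
    mul_le_mul_of_nonneg_left (pow_le_pow_left₀ ht h 2) (Real.sqrt_nonneg a)
  have h4 : a * ‖l‖ ^ 4 = (√a * ‖l‖ ^ 2) ^ 2 := by
    rw [mul_pow, Real.sq_sqrt ha.le]; ring
  rw [h4] at h1
  set X := √a * ‖l‖ ^ 2
  have h5 : ‖μ‖ * ‖μ + b‖ ≤ (R + b) * (R + b) :=
    mul_le_mul (by linarith) (by linarith) (norm_nonneg _) (by linarith [norm_nonneg μ])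
  nlinarith [norm_nonneg μ]

/-- Multiplication by the fourth root of unity `u` preserves both `l⁴` and the characteristic
equation, so the count near a positive real root carries over to its rotations. The condition `C / X
≤ r` puts every competing pair inside the disc of uniqueness. -/
theorem existsUnique_pair_near_root {a b α s r X C : ℝ} {ξ : Ioo (0 : ℝ) 1} (ha : 0 < a)
    (hξ : Irrational (ξ : ℝ)) {u : ℂ} (hu : u ^ 4 = 1) (hX : 0 < X) (hrX : r < X) (hC : C / X ≤ r)
    (h : ∃ μ l : ℂ, (a * l ^ 4 = -(b * μ + μ ^ 2) ∧ 0 < s * μ.im ∧ BeamCharEq a α ξ μ l) ∧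
        ‖l - X‖ ≤ r ∧ ‖l - X‖ ≤ C / X ∧
        ∀ μ' l' : ℂ, a * l' ^ 4 = -(b * μ' + μ' ^ 2) → 0 < s * μ'.im → BeamCharEq a α ξ μ' l' →
          ‖l' - X‖ ≤ r → μ' = μ ∧ l' = l) :
    ∃! p : ℂ × ℂ, IsEigenvalueOf (beamOperator a b α ξ) p.1 ∧ 0 < s * p.1.im ∧
      p.2 ^ 4 = -(b * p.1 + p.1 ^ 2) / a ∧ ‖p.2 - X * u‖ ≤ C / X := by
  obtain ⟨μ, l, ⟨h1, h2, h3⟩, -, h4, h5⟩ := h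
  have hun := norm_eq_one_of_pow_four hu
  have ne_zero {l' : ℂ} (h : ‖l' - X‖ ≤ C / X) : l' ≠ 0 := by
    rintro rfl
    rw [zero_sub, norm_neg, Complex.norm_real, Real.norm_of_nonneg hX.le] at h
    linarith
  refine ⟨(μ, l * u), ⟨?_, h2, ?_, ?_⟩, ?_⟩
  · exact (isEigenvalueOf_beamOperator_iff ha hξ (ne_zero h4) h1).2 h3
  · rw [pow_four_eq_div_iff ha, mul_pow, hu, mul_one]; exact h1
  · rw [← sub_mul, norm_mul, hun, mul_one]; exact h4
  · rintro ⟨μ', l'⟩ ⟨k1, k2, k3, k4⟩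
    simp only at k1 k2 k3 k4
    rw [pow_four_eq_div_iff ha] at k3
    have hu3 : (u ^ 3) ^ 4 = 1 := by rw [← pow_mul, mul_comm, pow_mul, hu, one_pow]
    have e : l' * u ^ 3 - X = (l' - X * u) * u ^ 3 := by linear_combination X * hu
    have k5 : ‖l' * u ^ 3 - X‖ ≤ C / X := by
      rw [e, norm_mul, norm_pow, hun, one_pow, mul_one]; exact k4
    have k6 : l' ≠ 0 := fun h0 => ne_zero k5 (by rw [h0, zero_mul])
    have k7 := (isEigenvalueOf_beamOperator_iff ha hξ k6 k3).1 k1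
    obtain ⟨e1, e2⟩ := h5 μ' (l' * u ^ 3) (by rw [mul_pow, hu3, mul_one]; exact k3) k2
      ((beamCharEq_mul hu3).2 k7) (k5.trans hC)
    refine Prod.ext e1 ?_
    simp only
    rw [← e2]
    linear_combination -l' * hu

theorem mainTheorem5 (a b α : ℝ) (ξ : Ioo (0 : ℝ) 1) (ha : 0 < a) (hb : 0 < b) (hα : 0 < α)
    (hαb : α * b < 6) (hξ : Irrational (ξ : ℝ)) :
    (∀ z : ℂ, Complex.sinh z * Complex.sin z = 0 ↔
      ∃ n : ℤ, z = n * Real.pi ∨ z = Complex.I * n * Real.pi) ∧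
    ∃ C ρ R : ℝ, 0 < C ∧ 0 < ρ ∧ 0 < R ∧
      (∀ μ : ℂ, IsEigenvalueOf (beamOperator a b α ξ) μ →
        (R < ‖μ‖ ↔ ∀ l : ℂ, l ^ 4 = -(b * μ + μ ^ 2) / a →
          ∃ z : ℂ, Complex.sinh z * Complex.sin z = 0 ∧ ρ ≤ ‖z‖ ∧ ‖l - z‖ ≤ C / ‖z‖)) ∧
      (∀ z : ℂ, Complex.sinh z * Complex.sin z = 0 → ρ ≤ ‖z‖ →
        (∃! p : ℂ × ℂ, IsEigenvalueOf (beamOperator a b α ξ) p.1 ∧ 0 < p.1.im ∧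
          p.2 ^ 4 = -(b * p.1 + p.1 ^ 2) / a ∧ ‖p.2 - z‖ ≤ C / ‖z‖) ∧
        (∃! p : ℂ × ℂ, IsEigenvalueOf (beamOperator a b α ξ) p.1 ∧ p.1.im < 0 ∧
          p.2 ^ 4 = -(b * p.1 + p.1 ^ 2) / a ∧ ‖p.2 - z‖ ≤ C / ‖z‖)) ∧
      (∀ μ : ℂ, IsEigenvalueOf (beamOperator a b α ξ) μ → R < ‖μ‖ →
        geomMult (beamOperator a b α ξ) μ = 1 ∧ algMult (beamOperator a b α ξ) μ = 1) := by
  refine ⟨sinh_mul_sin_eq_zero_iff, ?_⟩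
  obtain ⟨r, η, r0, r1, η0, H⟩ := exists_unique_beamCharEq
  have h0 : 0 < (ξ : ℝ) := ξ.2.1
  have h1 : (ξ : ℝ) < 1 := ξ.2.2
  have hsa : 0 < √a := Real.sqrt_pos.2 ha
  set K := α / √a with hK
  have hK0 : 0 < K := div_pos hα hsa
  have hπ := Real.pi_gt_three
  have hπ4 := Real.pi_le_four
  -- a threshold beyond which all the estimates hold
  set L : ℝ := 100 + 1000 * K + b / √a + 8 * K / η + 16 * K / r + (128 * α + b) / √a with hL
  have p1 : 0 < b / √a := by positivity
  have p2 : 0 < 8 * K / η := by positivity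
  have p3 : 0 < 16 * K / r := by positivity
  have p4 : 0 < (128 * α + b) / √a := by positivity
  obtain ⟨N, hN⟩ := exists_nat_gt L
  have hN0 : (0 : ℝ) < N := by linarith
  set t : ℝ := N * Real.pi with ht
  have hNt : (N : ℝ) ≤ t := le_mul_of_one_le_right hN0.le (by linarith)
  have hLt : ∀ x, t ≤ x → 100 ≤ x ∧ 1000 * K ≤ x ∧ b ≤ √a * (x - 1) ∧ 8 * K ≤ η * (x - 1) ∧
      16 * K ≤ r * x ∧ 128 * α + b ≤ √a * x := by
    intro x hx
    refine ⟨by linarith, by linarith, ?_, ?_, ?_, ?_⟩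
    · have : b / √a ≤ x - 1 := by linarith
      rwa [div_le_iff₀' hsa] at this
    · have : 8 * K / η ≤ x - 1 := by linarith
      rwa [div_le_iff₀' η0] at this
    · have : 16 * K / r ≤ x := by linarith
      rwa [div_le_iff₀' r0] at this
    · have : (128 * α + b) / √a ≤ x := by linarith
      rwa [div_le_iff₀' hsa] at this
  have hbx : ∀ x, t ≤ x → b ≤ √a * (x - 1) ^ 2 := by
    intro x hx
    obtain ⟨q1, -, q3, -⟩ := hLt x hx
    have : x - 1 ≤ (x - 1) ^ 2 := le_self_pow₀ (by linarith) two_ne_zero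
    exact q3.trans (mul_le_mul_of_nonneg_left this hsa.le)
  have hbx' : ∀ x, t ≤ x → b ≤ √a * x ^ 2 := by
    intro x hx
    refine (hbx x hx).trans (mul_le_mul_of_nonneg_left ?_ hsa.le)
    exact pow_le_pow_left₀ (by linarith [(hLt x hx).1]) (by linarith) 2
  -- Halfway between the consecutive root moduli `N π` and `(N + 1) π`. The two inequalities below
  -- show that `√a ρ²` separates the values of `|μ|` belonging to `|l| ≤ t + π/8` from those
  -- belonging to `|l| ≥ t + 7π/8`; the shift by `b` is absorbed because `t` is large.
  set ρ : ℝ := t + Real.pi / 2 with hρ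
  have hat : 0 < √a * t := mul_pos hsa (by linarith)
  have hbt : b ≤ √a * t := by linarith [(hLt t le_rfl).2.2.2.2.2]
  have hbt' : b ≤ √a * t * (3 / 4 * Real.pi) :=
    hbt.trans (le_mul_of_one_le_right hat.le (by linarith))
  have hR1 : √a * (t + Real.pi / 8) ^ 2 ≤ √a * ρ ^ 2 - b := by
    have e : √a * ρ ^ 2 = √a * (t + Real.pi / 8) ^ 2 + (√a * t) * (3 / 4 * Real.pi) +
      √a * (15 / 64 * Real.pi ^ 2) := by rw [hρ]; ring
    have : 0 ≤ √a * (15 / 64 * Real.pi ^ 2) := by positivity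
    linarith
  have hR2 : √a * ρ ^ 2 + b < √a * (t + 7 / 8 * Real.pi) ^ 2 := by
    have e : √a * (t + 7 / 8 * Real.pi) ^ 2 = √a * ρ ^ 2 + (√a * t) * (3 / 4 * Real.pi) +
      √a * (33 / 64 * Real.pi ^ 2) := by rw [hρ]; ring
    have : 0 < √a * (33 / 64 * Real.pi ^ 2) := by positivity
    linarith
  -- a root of norm larger than `t` has norm at least `t + π`
  have hgap : ∀ z : ℂ, Complex.sinh z * Complex.sin z = 0 → t < ‖z‖ → t + Real.pi ≤ ‖z‖ := by
    intro z hz hlt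
    obtain ⟨n, hn⟩ := exists_norm_root_eq hz
    rw [hn, ht] at hlt ⊢
    have h2 : (N : ℝ) < n := lt_of_mul_lt_mul_right hlt Real.pi_pos.le
    have h3 : (N : ℝ) + 1 ≤ n := by exact_mod_cast h2
    have h4 := mul_le_mul_of_nonneg_right h3 Real.pi_pos.le
    linarith
  have hbig : ∀ μ l : ℂ, a * l ^ 4 = -(b * μ + μ ^ 2) → √a * ρ ^ 2 < ‖μ‖ →
      t + Real.pi / 8 < ‖l‖ := fun μ l hμ h =>
    lt_norm_of_lt_norm ha hb.le hR1 hμ h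
  -- The constant `16 K` comes from the existence estimate.
  refine ⟨16 * K, ρ, √a * ρ ^ 2, by positivity, by linarith,
    mul_pos hsa (pow_pos (by linarith) 2), ?_, ?_, ?_⟩
  · intro μ hμe
    constructor
    · intro hμR l hl
      rw [pow_four_eq_div_iff ha] at hl
      have hlt := hbig μ l hl hμR
      obtain ⟨q1, q2, -⟩ := hLt ‖l‖ (by linarith)
      have hlp : 0 < ‖l‖ := by linarith
      have hc := (isEigenvalueOf_beamOperator_iff ha hξ (norm_pos_iff.1 hlp) hl).1 hμe
      obtain ⟨z, hz, hlz⟩ := hc.exists_root ha hb.le hα.le h0.le h1.le hl (by linarith)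
        (by linarith) (hbx' _ (by linarith))
      have hsmall : 7 * (K / ‖l‖) ≤ Real.pi / 8 := by
        have : K / ‖l‖ ≤ 1 / 1000 := by
          rw [div_le_iff₀ hlp]; linarith
        linarith
      have hz1 := norm_sub_norm_le l z
      have hz2 := norm_sub_norm_le z l
      rw [norm_sub_rev] at hz2
      have hzt := hgap z hz (by linarith)
      refine ⟨z, hz, by linarith, hlz.trans ?_⟩
      -- Passing from `|l|` to `|z| ≤ 2 |l|` in the denominator costs a factor `2`, and `14 K ≤ 16
      -- K`.
      have e : 7 * (K / ‖l‖) = 7 * K / ‖l‖ := by ring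
      rw [e, div_le_div_iff₀ hlp (by linarith)]
      have h2 : 7 * K * ‖z‖ ≤ 7 * K * (2 * ‖l‖) :=
        mul_le_mul_of_nonneg_left (by linarith) (by linarith)
      have h3 := mul_pos hK0 hlp
      linarith
    · intro h
      -- A single fourth root suffices here: its nearby root `z` has modulus at least `t + π`, so
      -- `|l| ≥ t + 7π/8`.
      obtain ⟨l, hl⟩ := IsAlgClosed.exists_pow_nat_eq (-(b * μ + μ ^ 2) / (a : ℂ))
        (n := 4) (by norm_num)
      obtain ⟨z, hz, hzρ, hlz⟩ := h l hl
      rw [pow_four_eq_div_iff ha] at hl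
      have hzt := hgap z hz (by linarith)
      have hsmall : 16 * K / ‖z‖ ≤ Real.pi / 8 := by
        rw [div_le_iff₀ (by linarith)]
        have h2 := (hLt ‖z‖ (by linarith)).2.1
        have h3 := mul_le_mul_of_nonneg_right (show 3 / 8 ≤ Real.pi / 8 by linarith) (norm_nonneg z)
        linarith
      have hz2 := norm_sub_norm_le z l
      rw [norm_sub_rev] at hz2
      exact lt_norm_of_lt_norm' ha hb.le (by positivity) hR2 hl (by linarith)
  · intro z hz hzρ
    obtain ⟨n, u, hu, rfl⟩ := exists_eq_nat_mul_pi_mul_of_root hz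
    have hnorm : ‖(n * Real.pi * u : ℂ)‖ = n * Real.pi := by
      rw [norm_mul, norm_mul, norm_eq_one_of_pow_four hu, Complex.norm_natCast, Complex.norm_real,
        Real.norm_of_nonneg Real.pi_pos.le, mul_one]
    rw [hnorm] at hzρ ⊢
    set X : ℝ := n * Real.pi with hX
    have hXc : (n : ℂ) * Real.pi = (X : ℂ) := by rw [hX]; push_cast; ring
    obtain ⟨q1, q2, q3, q4, q5, q6⟩ := hLt X (by linarith)
    have hb2 := hbx X (by linarith)
    have main (s : ℝ) (hs : s ^ 2 = 1) := existsUnique_pair_near_root (b := b) (s := s) (r := r)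
      (X := X) (C := 16 * K) ha hξ hu (by linarith) (by linarith)
      (by rw [div_le_iff₀ (by linarith)]; exact q5) (by
        rw [← hXc]
        exact H a b α ξ s n ha hb.le hα.le h0.le h1.le hs (by linarith) hb2 q4)
    rw [hXc]
    refine ⟨?_, ?_⟩
    · simpa only [one_mul] using main 1 (by norm_num)
    · simpa only [neg_mul, one_mul, neg_pos] using main (-1) (by norm_num)
  · intro μ hμe hμR
    obtain ⟨l, hl⟩ := IsAlgClosed.exists_pow_nat_eq (-(b * μ + μ ^ 2) / (a : ℂ))
      (n := 4) (by norm_num)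
    rw [pow_four_eq_div_iff ha] at hl
    -- The eigenvalue does not depend on which fourth root is used, so the one in the sector where
    -- `sinh` dominates is chosen.
    obtain ⟨u, hu, hre⟩ := exists_rotation l
    have hl' : a * (l * u) ^ 4 = -(b * μ + μ ^ 2) := by rw [mul_pow, hu, mul_one, hl]
    have hlt := hbig μ _ hl' hμR
    obtain ⟨q1, q2, -⟩ := hLt ‖l * u‖ (by linarith)
    have hl0 : l * u ≠ 0 := norm_pos_iff.1 (by linarith)
    have hc := (isEigenvalueOf_beamOperator_iff ha hξ hl0 hl').1 hμe
    refine geomMult_eq_one_and_algMult_eq_one ha hξ hl0 hl' hμe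
      (hc.chain_obstruction_ne_zero ha hb.le hα.le h0 h1 hξ hl' hre (by linarith)
        (hbx' _ (by linarith)) (by linarith) ?_)
    have e1 := norm_sub_le_norm_add_ofReal (μ := 2 * μ) hb.le
    rw [norm_mul, Complex.norm_ofNat] at e1
    have e2 := (hLt t le_rfl).2.2.2.2.2
    have e3 : √a * t ≤ √a * ρ ^ 2 := by
      refine mul_le_mul_of_nonneg_left ?_ hsa.le
      exact (show t ≤ ρ by linarith).trans (le_self_pow₀ (by linarith) two_ne_zero)
    linarith
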